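/- Let $n\ge 1$ and let $H\colon\mathbb R^n\times\mathbb R^n\to\mathbb R$, $(q,p)\mapsto H(q,p)$, be a Hamiltonian of classical type: $H$ is of class $C^2$, even in $p$, and there is a continuous function $\nu\colon\mathbb R^n\to\,]0,\infty[$ with $\frac{\partial^2H}{\partial p^2}(q,p)[\xi,\xi]\ge\nu(q)\|\xi\|^2$ for all $q,p,\xi\in\mathbb R^n$. Put $V(q)=H(q,0)$. Let $D\subset\mathbb R^n$ be a potential well for $H$ with energy $E$ (an open set with boundary of class $C^2$ such that $V<E$ on $D$, and $V=E$, $\nabla V\neq0$ on $\partial D$), and assume that $\overline D$ is compact. For $q\in D$ let $U(q,\cdot)\colon\mathbb R^n\to\mathbb R$ be the unique function that is positively homogeneous of degree $2$ and satisfies $U(q,p)=1$ if and only if $H(q,p)=E$. Let $G(q,v)=\max_{p\in\mathbb R^n}\big(\langle v,p\rangle-U(q,p)\big)$ for $q\in D$, and $G(q,v)=0$ for $q\in\partial D$ ($v\in\mathbb R^n$). For $\gamma\in W^{1,2}([0,1],\overline D)$ (absolutely continuous with $\dot\gamma\in L^2$) let $\mathcal J(\gamma)=\int_0^1G(\gamma(s),\dot\gamma(s))\,ds$,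 and for $y\in D$ let $$X_y=\{\gamma\in W^{1,2}([0,1],\overline D):\ \gamma(0)=y,\ \gamma([0,1[)\subset D,\ \gamma(1)\in\partial D\}.$$ Then there is a constant $\bar\delta>0$ with the following two properties. 1. For every $y\in D$ with $\operatorname{dist}(y,\partial D)\le\bar\delta$ there exist a unique $t_y>0$ and a unique solution $(q_y,p_y)\colon[0,t_y]\to\mathbb R^{2n}$ of Hamilton's equations $\dot q=\frac{\partial H}{\partial p}(q,p)$, $\dot p=-\frac{\partial H}{\partial q}(q,p)$ with energy $H(q_y,p_y)\equiv E$ such that $q_y(0)\in\partial D$, $q_y(t_y)=y$ and $\operatorname{dist}(q_y(t),\partial D)\le\bar\delta$ for all $t\in[0,t_y]$. 2. For every $y\in D$ with $\operatorname{dist}(y,\partial D)\le\bar\delta$ there is exactly one minimizer of $\mathcal J$ in $X_y$. -/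

import Mathlib

open Set MeasureTheory

noncomputable section

/-- The configuration space `ℝⁿ` with its Euclidean norm and inner product. -/
abbrev Conf (n : ℕ) : Type := EuclideanSpace ℝ (Fin n)

/-- Hamiltonians of classical type on `ℝ²ⁿ = ℝⁿ × ℝⁿ`: of class `C²`, even in the momentum `p`, and
with `∂²H/∂p²(q,p)[ξ,ξ] ≥ ν(q)‖ξ‖²` for a continuous function `ν > 0` of `q` alone. -/
structure IsClassicalHamiltonian {n : ℕ} (H : Conf n × Conf n → ℝ) : Prop where
  contDiff : ContDiff ℝ 2 H
  even : ∀ q p : Conf n, H (q, -p) = H (q, p)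
  posDef : ∃ ν : Conf n → ℝ, Continuous ν ∧ (∀ q, 0 < ν q) ∧
    ∀ q p ξ : Conf n,
      ν q * ‖ξ‖ ^ 2 ≤ fderiv ℝ (fun p' : Conf n => fderiv ℝ (fun p'' : Conf n => H (q, p'')) p') p ξ ξ

/-- The potential energy `V(q) = H(q,0)`. -/
def potential {n : ℕ} (H : Conf n × Conf n → ℝ) (q : Conf n) : ℝ := H (q, 0)

/-- The set `D` has boundary of class `C²`: near each boundary point, `D` is the sublevel set
`{f < 0}` of a `C²` function without critical points. -/
def HasC2Boundary {n : ℕ} (D : Set (Conf n)) : Prop :=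
  ∀ Q ∈ frontier D, ∃ W : Set (Conf n), IsOpen W ∧ Q ∈ W ∧ ∃ f : Conf n → ℝ,
    ContDiffOn ℝ 2 f W ∧ (∀ x ∈ W, fderiv ℝ f x ≠ 0) ∧ D ∩ W = {x ∈ W | f x < 0}

/-- `D` is a potential well for `H`, with `V = E` on its boundary. -/
structure IsPotentialWell {n : ℕ} (H : Conf n × Conf n → ℝ) (D : Set (Conf n)) (E : ℝ) : Prop where
  isOpen : IsOpen D
  boundary : HasC2Boundary D
  lt_of_mem : ∀ q ∈ D, potential H q < E
  eq_of_mem_frontier : ∀ q ∈ frontier D, potential H q = E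
  gradient_ne_zero : ∀ q ∈ frontier D, gradient (potential H) q ≠ 0

/-- `(q,p) : [0,T] → ℝ²ⁿ` solves Hamilton's equations `q' = ∂H/∂p`, `p' = -∂H/∂q`
(with one-sided derivatives at the endpoints). -/
def IsHamiltonSolution {n : ℕ} (H : Conf n × Conf n → ℝ) (T : ℝ) (q p : ℝ → Conf n) : Prop :=
  ∀ t ∈ Icc 0 T,
    HasDerivWithinAt q (gradient (fun p' : Conf n => H (q t, p')) (p t)) (Icc 0 T) t ∧
    HasDerivWithinAt p (-gradient (fun q' : Conf n => H (q', p t)) (q t)) (Icc 0 T) t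

/-- `(q,p)` is, on `[0,T]`, a solution of Hamilton's equations with energy `E` that leaves from
`∂D`, arrives at `y` at the time `T > 0` and stays within distance `δ` of `∂D`. -/
structure IsCollarSolution {n : ℕ} (H : Conf n × Conf n → ℝ) (D : Set (Conf n)) (E δ : ℝ)
    (y : Conf n) (T : ℝ) (q p : ℝ → Conf n) : Prop where
  pos : 0 < T
  solution : IsHamiltonSolution H T q p
  energy : ∀ t ∈ Icc 0 T, H (q t, p t) = E
  start : q 0 ∈ frontier D
  arrive : q T = y
  near : ∀ t ∈ Icc 0 T, Metric.infDist (q t) (frontier D) ≤ δ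

/-- The collar property of `δ`: for each `y ∈ D` with `dist(y,∂D) ≤ δ` there are a unique time
`T > 0` and a unique solution on `[0,T]` as in `IsCollarSolution`. Functions on `[0,T]` are
represented by functions on `ℝ`, so that they are compared on `[0,T]` only. -/
def CollarProperty {n : ℕ} (H : Conf n × Conf n → ℝ) (D : Set (Conf n)) (E δ : ℝ) : Prop :=
  ∀ y ∈ D, Metric.infDist y (frontier D) ≤ δ →
    ∃ (T : ℝ) (q p : ℝ → Conf n), IsCollarSolution H D E δ y T q p ∧
      ∀ (T' : ℝ) (q' p' : ℝ → Conf n), IsCollarSolution H D E δ y T' q' p' →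
        T' = T ∧ EqOn q' q (Icc 0 T) ∧ EqOn p' p (Icc 0 T)

/-- For `q ∈ D`, the function `U(q,·)` that is homogeneous of degree `2` and equal to `1` exactly
on `{p | H(q,p) = E}`. It is the square of the Minkowski functional
`inf {r > 0 | H(q, p/r) ≤ E}` of the convex body `{p | H(q,p) ≤ E}`, which is a neighbourhood
of `0` because `V(q) < E`. -/
def jacobiU {n : ℕ} (H : Conf n × Conf n → ℝ) (E : ℝ) (q p : Conf n) : ℝ :=
  gauge {p' : Conf n | H (q, p') ≤ E} p ^ 2

open Classical in
/-- The square `G = F²` of the Jacobi–Finsler metric: on `D` the Legendre transform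
`G(q,v) = max_p (⟨v,p⟩ - U(q,p))`, extended by `0` (that is, by continuity) to `∂D`. -/
def jacobiG {n : ℕ} (H : Conf n × Conf n → ℝ) (D : Set (Conf n)) (E : ℝ) (q v : Conf n) : ℝ :=
  if q ∈ D then ⨆ p : Conf n, (inner ℝ v p - jacobiU H E q p) else 0

/-- `γ ∈ W^{1,2}([0,1], A)`: `γ` maps `[0,1]` to `A`, is absolutely continuous on `[0,1]` and has its
(almost everywhere defined) derivative in `L²`. -/
structure IsW12 {n : ℕ} (A : Set (Conf n)) (γ : ℝ → Conf n) : Prop where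
  mapsTo : MapsTo γ (Icc 0 1) A
  absCont : AbsolutelyContinuousOnInterval γ 0 1
  memLp_deriv : MemLp (deriv γ) 2 (volume.restrict (Ioo (0 : ℝ) 1))

/-- The Jacobi–Finsler energy `𝒥(γ) = ∫₀¹ G(γ(s), γ'(s)) ds`. -/
def jacobiEnergy {n : ℕ} (H : Conf n × Conf n → ℝ) (D : Set (Conf n)) (E : ℝ)
    (γ : ℝ → Conf n) : ℝ :=
  ∫ s in (0 : ℝ)..1, jacobiG H D E (γ s) (deriv γ s)

/-- The space `X_y` of the curves `γ ∈ W^{1,2}([0,1], closure D)` with `γ(0) = y`,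
`γ([0,1[) ⊆ D` and `γ(1) ∈ ∂D`. -/
def curvesToBoundary {n : ℕ} (D : Set (Conf n)) (y : Conf n) : Set (ℝ → Conf n) :=
  {γ | IsW12 (closure D) γ ∧ γ 0 = y ∧ (∀ s ∈ Ico (0 : ℝ) 1, γ s ∈ D) ∧ γ 1 ∈ frontier D}

end

noncomputable section

open Filter Topology InnerProductSpace

/-! On `∂D` the potential equals `E`, and `H(q,p) ≥ V(q) + c‖p‖²` near `∂D`. A solution of energy
`E` starting on `∂D` therefore starts at rest, and the candidates form a family `q(Q,t)` indexed by
`Q ∈ ∂D`. Along such a trajectory `p ≈ -t∇V(Q)`, the velocity has size `t` and points inwards, and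
the displacement has size `t²`. Hence `Q` and `T²` are Lipschitz functions of `q(Q,T)`
(`inverse_lipschitz`). This gives injectivity directly, although `T ↦ q(Q,T)` has zero velocity at
`T = 0`. Surjectivity onto a collar comes from a fixed point argument followed by connectedness
(`exists_q_eq`). A solution that stays in the collar cannot outlive the time `τ`, because its
potential drops quadratically in time (`eq_flow_of_isCollarSolution`). This is property 1.

Property 2 is a calibration argument. Let `S(y)` be the action `∫ p dq` of the trajectory from `∂D`
to `y`, truncated at a level `w` that is reached only inside the collar. Where `S < w` in `D`, its
differential is the arrival momentum `P`, and `H(y, P(y)) = E` (`hasFDerivAt_S`, `energy_P`).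
Testing the Legendre transform at `-kP` gives `G(γ,γ') ≥ -k (S ∘ γ)' - k²`. Integration yields `𝒥(γ)
≥ k S(y) - k²`, and the best choice `k = S(y)/2` gives `S(y)²/4`. Thanks to the truncation, curves
that leave the collar need no separate treatment.

Equality forces `γ'` to be parallel to `∂H/∂p(γ, P(γ))` and `S ∘ γ` to be affine
(`eq_of_jacobiG_eq`). The first makes the starting point `Q` of the trajectory through `γ(s)`
constant in `s`; the second fixes the action, hence the time, so the curve is determined
(`rigidity`). Conversely, the trajectory through `y`, run backwards with its action decreasing at
constant speed, has energy at most `S(y)²/4` (`exists_jacobiEnergy_le`). -/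

/-- The partial gradient `∂H/∂q`. -/
def gradQ {n : ℕ} (H : Conf n × Conf n → ℝ) (z : Conf n × Conf n) : Conf n :=
  gradient (fun q' : Conf n => H (q', z.2)) z.1

/-- The partial gradient `∂H/∂p`. -/
def gradP {n : ℕ} (H : Conf n × Conf n → ℝ) (z : Conf n × Conf n) : Conf n :=
  gradient (fun p' : Conf n => H (z.1, p')) z.2

/-! ### Partial gradients and convexity in the momentum. -/

section HamiltonianCalculus

variable {n : ℕ} {H : Conf n × Conf n → ℝ}

theorem hasFDerivAt_partial_left (hH : Differentiable ℝ H) (z : Conf n × Conf n) :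
    HasFDerivAt (fun q' : Conf n => H (q', z.2))
      ((fderiv ℝ H z).comp (ContinuousLinearMap.inl ℝ _ _)) z.1 := by
  have h1 : HasFDerivAt H (fderiv ℝ H z) (z.1, z.2) := (hH z).hasFDerivAt
  exact h1.comp z.1 (hasFDerivAt_prodMk_left z.1 z.2)

theorem hasFDerivAt_partial_right (hH : Differentiable ℝ H) (z : Conf n × Conf n) :
    HasFDerivAt (fun p' : Conf n => H (z.1, p'))
      ((fderiv ℝ H z).comp (ContinuousLinearMap.inr ℝ _ _)) z.2 := by
  have h1 : HasFDerivAt H (fderiv ℝ H z) (z.1, z.2) := (hH z).hasFDerivAt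
  exact h1.comp z.2 (hasFDerivAt_prodMk_right z.1 z.2)

theorem inner_gradQ (hH : Differentiable ℝ H) (z : Conf n × Conf n) (x : Conf n) :
    inner ℝ (gradQ H z) x = fderiv ℝ H z (x, 0) := by
  rw [gradQ, inner_gradient_left, (hasFDerivAt_partial_left hH z).fderiv]
  simp

theorem inner_gradP (hH : Differentiable ℝ H) (z : Conf n × Conf n) (x : Conf n) :
    inner ℝ (gradP H z) x = fderiv ℝ H z (0, x) := by
  rw [gradP, inner_gradient_left, (hasFDerivAt_partial_right hH z).fderiv]
  simp

theorem fderiv_eq_inner_add_inner (hH : Differentiable ℝ H) (z w : Conf n × Conf n) :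
    fderiv ℝ H z w = inner ℝ (gradQ H z) w.1 + inner ℝ (gradP H z) w.2 := by
  rw [inner_gradQ hH, inner_gradP hH, ← map_add]
  simp

theorem contDiff_gradQ (hH : ContDiff ℝ 2 H) : ContDiff ℝ 1 (gradQ H) := by
  have h : gradQ H = fun z => (toDual ℝ (Conf n)).symm
      ((fderiv ℝ H z).comp (ContinuousLinearMap.inl ℝ _ _)) := by
    ext1 z
    rw [gradQ, gradient, (hasFDerivAt_partial_left (hH.differentiable (by simp)) z).fderiv]
  rw [h]
  have h2 : ContDiff ℝ 1 (fderiv ℝ H) := hH.fderiv_right (by norm_num)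
  exact (toDual ℝ (Conf n)).symm.contDiff.comp (h2.clm_comp contDiff_const)

theorem contDiff_gradP (hH : ContDiff ℝ 2 H) : ContDiff ℝ 1 (gradP H) := by
  have h : gradP H = fun z => (toDual ℝ (Conf n)).symm
      ((fderiv ℝ H z).comp (ContinuousLinearMap.inr ℝ _ _)) := by
    ext1 z
    rw [gradP, gradient, (hasFDerivAt_partial_right (hH.differentiable (by simp)) z).fderiv]
  rw [h]
  have h2 : ContDiff ℝ 1 (fderiv ℝ H) := hH.fderiv_right (by norm_num)
  exact (toDual ℝ (Conf n)).symm.contDiff.comp (h2.clm_comp contDiff_const)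

/-- An even function has an even differential up to sign, so it vanishes at `0`. Consequently points
at rest have zero velocity, and `p = 0` minimises `H(q,·)`. -/
theorem gradP_zero (hH : Differentiable ℝ H) (heven : ∀ q p : Conf n, H (q, -p) = H (q, p))
    (q : Conf n) : gradP H (q, 0) = 0 := by
  have h1 := hasFDerivAt_partial_right hH (q, 0)
  set A := (fderiv ℝ H (q, 0)).comp (ContinuousLinearMap.inr ℝ (Conf n) (Conf n)) with hA
  have h2 : HasFDerivAt (fun p' : Conf n => H (q, p')) (-A) 0 := by
    have h3 : HasFDerivAt (fun p' : Conf n => H (q, p')) A (-0) := by simpa using h1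
    have h4 : HasFDerivAt (fun p' : Conf n => H (q, -p'))
        (A.comp (-ContinuousLinearMap.id ℝ (Conf n))) 0 :=
      h3.comp (0 : Conf n) ((hasFDerivAt_id (𝕜 := ℝ) (0 : Conf n)).neg)
    simpa only [heven, ContinuousLinearMap.comp_neg, ContinuousLinearMap.comp_id] using h4
  have h5 : A = -A := h1.unique h2
  have h6 : A = 0 := by
    have : (2 : ℝ) • A = 0 := by rw [two_smul]; nth_rw 2 [h5]; simp
    simpa using this
  rw [gradP, gradient, h1.fderiv, h6, map_zero]

/-- A `C²` function whose Hessian is bounded below by `ν` lies above its tangent paraboloids. -/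
theorem quadratic_lower_bound_of_hessian {F : Type*} [NormedAddCommGroup F] [NormedSpace ℝ F]
    {h : F → ℝ} (hC : ContDiff ℝ 2 h) {ν : ℝ}
    (hν : ∀ p ξ : F, ν * ‖ξ‖ ^ 2 ≤ fderiv ℝ (fderiv ℝ h) p ξ ξ) (p ξ : F) :
    h p + fderiv ℝ h p ξ + ν / 2 * ‖ξ‖ ^ 2 ≤ h (p + ξ) := by
  have hd : Differentiable ℝ h := hC.differentiable (by simp)
  have hd2 : Differentiable ℝ (fderiv ℝ h) :=
    (hC.fderiv_right (m := 1) (by norm_num)).differentiable (by simp)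
  have hl : ∀ t : ℝ, HasDerivAt (fun t : ℝ => p + t • ξ) ξ t := fun t => by
    simpa using ((hasDerivAt_id t).smul_const ξ).const_add p
  have hf : ∀ t : ℝ, HasDerivAt (fun t : ℝ => h (p + t • ξ)) (fderiv ℝ h (p + t • ξ) ξ) t :=
    fun t => (hd (p + t • ξ)).hasFDerivAt.comp_hasDerivAt t (hl t)
  have hf' : ∀ t : ℝ, HasDerivAt (fun t : ℝ => fderiv ℝ h (p + t • ξ) ξ)
      (fderiv ℝ (fderiv ℝ h) (p + t • ξ) ξ ξ) t := fun t => by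
    have h1 : HasFDerivAt (fun x => fderiv ℝ h x ξ)
        ((ContinuousLinearMap.apply ℝ ℝ ξ).comp (fderiv ℝ (fderiv ℝ h) (p + t • ξ)))
        (p + t • ξ) :=
      (ContinuousLinearMap.apply ℝ ℝ ξ).hasFDerivAt.comp (p + t • ξ) (hd2 (p + t • ξ)).hasFDerivAt
    exact h1.comp_hasDerivAt t (hl t)
  have key1 : ∀ t : ℝ, 0 ≤ t → fderiv ℝ h p ξ + ν * ‖ξ‖ ^ 2 * t ≤ fderiv ℝ h (p + t • ξ) ξ := by
    intro t ht
    have hm : Monotone (fun t : ℝ => fderiv ℝ h (p + t • ξ) ξ - ν * ‖ξ‖ ^ 2 * t) := by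
      refine monotone_of_hasDerivAt_nonneg
        (f' := fun t => fderiv ℝ (fderiv ℝ h) (p + t • ξ) ξ ξ - ν * ‖ξ‖ ^ 2 * 1)
        (fun t => (hf' t).sub ((hasDerivAt_id t).const_mul _)) fun t => ?_
      have := hν (p + t • ξ) ξ
      simp only [Pi.zero_apply]; linarith
    have := hm ht
    simp only [zero_smul, add_zero, mul_zero, sub_zero] at this
    linarith
  have hm : MonotoneOn (fun t : ℝ => h (p + t • ξ) -
      (fderiv ℝ h p ξ * t + ν / 2 * ‖ξ‖ ^ 2 * t ^ 2)) (Icc 0 1) := by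
    have hD : ∀ t : ℝ, HasDerivAt (fun t : ℝ => h (p + t • ξ) -
        (fderiv ℝ h p ξ * t + ν / 2 * ‖ξ‖ ^ 2 * t ^ 2))
        (fderiv ℝ h (p + t • ξ) ξ - (fderiv ℝ h p ξ * 1 + ν / 2 * ‖ξ‖ ^ 2 * (2 * t))) t := by
      intro t
      refine (hf t).sub (((hasDerivAt_id t).const_mul _).add ?_)
      simpa using (hasDerivAt_pow 2 t).const_mul (ν / 2 * ‖ξ‖ ^ 2)
    refine monotoneOn_of_hasDerivWithinAt_nonneg (convex_Icc 0 1)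
      (fun t _ => (hD t).continuousAt.continuousWithinAt)
      (fun t _ => (hD t).hasDerivWithinAt) fun t ht => ?_
    rw [interior_Icc] at ht
    have := key1 t ht.1.le
    linarith
  have h1 := hm (left_mem_Icc.2 zero_le_one) (right_mem_Icc.2 zero_le_one) zero_le_one
  simp only [zero_smul, add_zero, mul_zero, one_smul, ne_eq, OfNat.ofNat_ne_zero,
    not_false_eq_true, zero_pow, one_pow, mul_one, sub_zero] at h1
  linarith

/-- Uniform convexity of `H` in the momentum, integrated along segments. -/
theorem quadratic_lower_bound (hH : ContDiff ℝ 2 H) {q : Conf n} {ν : ℝ}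
    (hν : ∀ p ξ : Conf n, ν * ‖ξ‖ ^ 2 ≤
      fderiv ℝ (fun p' : Conf n => fderiv ℝ (fun p'' : Conf n => H (q, p'')) p') p ξ ξ)
    (p p' : Conf n) :
    H (q, p) + inner ℝ (gradP H (q, p)) (p' - p) + ν / 2 * ‖p' - p‖ ^ 2 ≤ H (q, p') := by
  have hC : ContDiff ℝ 2 (fun p'' : Conf n => H (q, p'')) :=
    hH.comp (contDiff_const.prodMk contDiff_id)
  have h1 := quadratic_lower_bound_of_hessian hC hν p (p' - p)
  rw [add_sub_cancel] at h1
  rwa [gradP, inner_gradient_left]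

end HamiltonianCalculus

/-! ### Comparison forms of the mean value inequality. -/

section MeanValue

/-- The bound is a function `B'` rather than a constant: derivatives of size `t` must integrate to
increments of size `t²`. -/
theorem norm_sub_le_of_hasDerivAt_le {G : Type*} [NormedAddCommGroup G] [NormedSpace ℝ G]
    {f f' : ℝ → G} {B B' : ℝ → ℝ} {a b : ℝ} (hab : a ≤ b)
    (hf : ∀ x ∈ Icc a b, HasDerivAt f (f' x) x) (hB : ∀ x, HasDerivAt B (B' x) x)
    (bound : ∀ x ∈ Icc a b, ‖f' x‖ ≤ B' x) : ‖f b - f a‖ ≤ B b - B a := by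
  refine image_norm_le_of_norm_deriv_right_le_deriv_boundary (f := fun x => f x - f a)
    (B := fun x => B x - B a) (f' := f') (B' := B') (a := a) (b := b)
    (fun x hx => ((hf x hx).sub_const _).continuousAt.continuousWithinAt)
    (fun x hx => ((hf x (Ico_subset_Icc_self hx)).sub_const _).hasDerivWithinAt) (by simp)
    (fun x => (hB x).sub_const _) (fun x hx => bound x (Ico_subset_Icc_self hx))
    (right_mem_Icc.2 hab)

theorem sub_le_sub_of_le_hasDerivAt {f f' B B' : ℝ → ℝ} {a b : ℝ} (hab : a ≤ b)
    (hf : ∀ x ∈ Icc a b, HasDerivAt f (f' x) x) (hB : ∀ x, HasDerivAt B (B' x) x)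
    (bound : ∀ x ∈ Icc a b, B' x ≤ f' x) : B b - B a ≤ f b - f a := by
  have hm : MonotoneOn (fun x => f x - B x) (Icc a b) := by
    refine monotoneOn_of_hasDerivWithinAt_nonneg (convex_Icc a b) (f' := fun x => f' x - B' x)
      (fun x hx => ((hf x hx).sub (hB x)).continuousAt.continuousWithinAt)
      (fun x hx => ((hf x (interior_subset hx)).sub (hB x)).hasDerivWithinAt) fun x hx => ?_
    have := bound x (interior_subset hx)
    linarith
  have := hm (left_mem_Icc.2 hab) (right_mem_Icc.2 hab) hab
  simp only at this
  linarith

theorem hasDerivAt_const_mul_sq (C x : ℝ) :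
    HasDerivAt (fun t : ℝ => C * t ^ 2) (C * (2 * x)) x := by
  simpa using (hasDerivAt_pow 2 x).const_mul C

theorem hasDerivAt_const_mul_id (C x : ℝ) : HasDerivAt (fun t : ℝ => C * t) C x := by
  simpa using (hasDerivAt_id x).const_mul C

end MeanValue

/-- A preconnected set which meets both a set and its complement meets the frontier. -/
theorem IsPreconnected.exists_mem_frontier {α : Type*} [TopologicalSpace α] {s D : Set α}
    (hs : IsPreconnected s) {x y : α} (hx : x ∈ s) (hxD : x ∈ D) (hy : y ∈ s) (hyD : y ∉ D) :
    ∃ z ∈ s, z ∈ frontier D := by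
  by_contra! h
  have h1 : s ⊆ interior D ∪ (closure D)ᶜ := by
    intro z hz
    by_cases hzc : z ∈ closure D
    · left
      by_contra hzi
      exact h z hz ⟨hzc, hzi⟩
    · exact Or.inr hzc
  have hxi : x ∈ interior D := (h1 hx).resolve_right fun h' => h' (subset_closure hxD)
  have hyc : y ∈ (closure D)ᶜ := (h1 hy).resolve_left fun h' => hyD (interior_subset h')
  obtain ⟨z, -, hz1, hz2⟩ := hs _ _ isOpen_interior isClosed_closure.isOpen_compl h1
    ⟨x, hx, hxi⟩ ⟨y, hy, hyc⟩
  exact hz2 (subset_closure (interior_subset hz1))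

/-! ### Data and constants for the flow near the boundary. -/

/-- The Hamiltonian flow near the boundary of a potential well, cut off far away, together with
the constants that control it. -/
structure CollarFrame {n : ℕ} (H : Conf n × Conf n → ℝ) (D : Set (Conf n)) (E : ℝ) where
  /-- the Hamiltonian vector field, cut off outside a large ball -/
  X : Conf n × Conf n → Conf n × Conf n
  /-- its flow -/
  Φ : Conf n × Conf n → ℝ → Conf n × Conf n
  /-- upper bound for Lipschitz constants and norms -/
  K : ℝ
  /-- lower bound for the Hessian and for the gradient of the potential on the boundary -/
  c : ℝ
  /-- lower bound for the inward acceleration -/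
  κ : ℝ
  /-- small constant used for absorbing error terms -/
  ε : ℝ
  /-- width of the region around the boundary where the estimates hold -/
  r : ℝ
  /-- length of the time interval where the estimates hold -/
  τ : ℝ
  /-- radius of the ball where the vector field is not cut off -/
  R : ℝ
  one_le_K : 1 ≤ K
  c_pos : 0 < c
  c_le_one : c ≤ 1
  κ_eq : κ = c ^ 3 / 8
  ε_pos : 0 < ε
  -- Smallness is graded: `K` and `c` come from compactness, `κ` from `c`, then `ε` is small against
  -- `κ`, and `τ` is small against `ε * r`. Powers of `K` up to the third are absorbed by `ε`, up to
  -- the fifth by `τ`.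
  ε_le : 8 * K ^ 3 * ε ≤ κ
  r_pos : 0 < r
  r_le_one : r ≤ 1
  τ_pos : 0 < τ
  τ_le : K ^ 5 * τ ≤ ε * r / 2
  R_ge : 3 ≤ R
  X_lipschitz : ∀ z w, ‖X z - X w‖ ≤ K * ‖z - w‖
  X_bound : ∀ z, ‖X z‖ ≤ K
  X_eq : ∀ z, ‖z‖ ≤ R → X z = (gradP H z, -gradQ H z)
  X_zero : ∀ q : Conf n, (X (q, 0)).1 = 0
  flow_zero : ∀ z, Φ z 0 = z
  flow_deriv : ∀ z, ∀ t ∈ Ioo (-1 : ℝ) 1, HasDerivAt (Φ z) (X (Φ z t)) t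
  flow_lipschitz : ∀ z w, ∀ t ∈ Ico (0 : ℝ) 1, ‖Φ z t - Φ w t‖ ≤ K * ‖z - w‖
  taylor : ∀ z w : Conf n × Conf n, ‖z‖ ≤ R → ‖w‖ ≤ R →
    |H w - H z - (inner ℝ (gradQ H z) (w.1 - z.1) + inner ℝ (gradP H z) (w.2 - z.2))|
      ≤ K * ‖w - z‖ ^ 2
  coercive : ∀ q p : Conf n, ‖q‖ ≤ R → H (q, 0) + c * ‖p‖ ^ 2 ≤ H (q, p)
  gradP_coercive : ∀ q p : Conf n, ‖q‖ ≤ R → c * ‖p‖ ^ 2 ≤ inner ℝ (gradP H (q, p)) p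
  gradient_lower : ∀ Q : Conf n, Metric.infDist Q (frontier D) ≤ r → c ≤ ‖gradQ H (Q, 0)‖
  bounded : ∀ Q : Conf n, Metric.infDist Q (frontier D) ≤ r → ‖Q‖ ≤ R - 1
  differentiable : Differentiable ℝ H
  isOpen : IsOpen D
  isCompact_frontier : IsCompact (frontier D)
  frontier_nonempty : (frontier D).Nonempty
  potential_lt : ∀ q ∈ D, H (q, 0) < E
  potential_eq : ∀ q ∈ frontier D, H (q, 0) = E

/-! ### Estimates for trajectories that start at rest. -/

namespace CollarFrame

variable {n : ℕ} {H : Conf n × Conf n → ℝ} {D : Set (Conf n)} {E : ℝ} (F : CollarFrame H D E)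

/-- The position at time `t` of the trajectory that starts at rest at `Q`. -/
def q (Q : Conf n) (t : ℝ) : Conf n := (F.Φ (Q, 0) t).1

/-- The momentum at time `t` of the trajectory that starts at rest at `Q`. -/
def p (Q : Conf n) (t : ℝ) : Conf n := (F.Φ (Q, 0) t).2

/-- The velocity at time `t` of the trajectory that starts at rest at `Q`. -/
def dq (Q : Conf n) (t : ℝ) : Conf n := (F.X (F.Φ (Q, 0) t)).1

theorem K_pos : 0 < F.K := lt_of_lt_of_le one_pos F.one_le_K

theorem κ_pos : 0 < F.κ := by rw [F.κ_eq]; have := F.c_pos; positivity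

theorem κ_le : F.κ ≤ F.c / 8 := by
  rw [F.κ_eq]
  have h : F.c ^ 3 ≤ F.c ^ 1 := pow_le_pow_of_le_one F.c_pos.le F.c_le_one (by norm_num)
  linarith

theorem κ_le_eighth : F.κ ≤ 1 / 8 := by
  have := F.κ_le; have := F.c_le_one; linarith

theorem K_pow_mul_ε_le {k : ℕ} (hk : k ≤ 3) : F.K ^ k * F.ε ≤ F.κ / 8 := by
  have h : F.K ^ k ≤ F.K ^ 3 := pow_le_pow_right₀ F.one_le_K hk
  have := mul_le_mul_of_nonneg_right h F.ε_pos.le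
  linarith [F.ε_le]

theorem ε_le_κ : F.ε ≤ F.κ / 8 := by simpa using F.K_pow_mul_ε_le (k := 0) (by norm_num)

theorem ε_le_small : F.ε ≤ 1 / 64 := by
  have := F.ε_le_κ; have := F.κ_le_eighth; linarith

theorem K_pow_mul_τ_le {k : ℕ} (hk : k ≤ 5) : F.K ^ k * F.τ ≤ F.ε * F.r / 2 := by
  have h : F.K ^ k ≤ F.K ^ 5 := pow_le_pow_right₀ F.one_le_K hk
  exact (mul_le_mul_of_nonneg_right h F.τ_pos.le).trans F.τ_le

theorem K_pow_mul_τ_le_ε {k : ℕ} (hk : k ≤ 5) : F.K ^ k * F.τ ≤ F.ε / 2 := by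
  have := F.K_pow_mul_τ_le hk
  have := mul_le_mul_of_nonneg_left F.r_le_one F.ε_pos.le
  linarith

theorem τ_lt_one : F.τ < 1 := by
  have := F.K_pow_mul_τ_le_ε (k := 0) (by norm_num)
  have := F.ε_le_small
  simp only [pow_zero, one_mul] at *
  linarith

theorem mem_Ioo {t : ℝ} (ht : t ∈ Icc 0 F.τ) : t ∈ Ioo (-1 : ℝ) 1 :=
  ⟨by linarith [ht.1], by linarith [ht.2, F.τ_lt_one]⟩

theorem mem_Ico {t : ℝ} (ht : t ∈ Icc 0 F.τ) : t ∈ Ico (0 : ℝ) 1 :=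
  ⟨ht.1, by linarith [ht.2, F.τ_lt_one]⟩

theorem q_zero (Q : Conf n) : F.q Q 0 = Q := by rw [q, F.flow_zero]

theorem p_zero (Q : Conf n) : F.p Q 0 = 0 := by rw [p, F.flow_zero]

theorem hasDerivAt_q (Q : Conf n) {t : ℝ} (ht : t ∈ Ioo (-1 : ℝ) 1) :
    HasDerivAt (F.q Q) (F.dq Q t) t :=
  (ContinuousLinearMap.fst ℝ (Conf n) (Conf n)).hasFDerivAt.comp_hasDerivAt t
    (F.flow_deriv (Q, 0) t ht)

theorem hasDerivAt_p (Q : Conf n) {t : ℝ} (ht : t ∈ Ioo (-1 : ℝ) 1) :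
    HasDerivAt (F.p Q) (F.X (F.Φ (Q, 0) t)).2 t :=
  (ContinuousLinearMap.snd ℝ (Conf n) (Conf n)).hasFDerivAt.comp_hasDerivAt t
    (F.flow_deriv (Q, 0) t ht)

theorem norm_flow_sub_le (z : Conf n × Conf n) {s t : ℝ} (hs : 0 ≤ s) (hst : s ≤ t)
    (ht : t ≤ F.τ) : ‖F.Φ z t - F.Φ z s‖ ≤ F.K * (t - s) := by
  have := norm_sub_le_of_hasDerivAt_le (f := F.Φ z) (B := fun t => F.K * t) hst
    (fun x hx => F.flow_deriv z x (F.mem_Ioo ⟨hs.trans hx.1, hx.2.trans ht⟩))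
    (hasDerivAt_const_mul_id F.K) (fun x _ => F.X_bound _)
  simpa [mul_sub] using this

theorem norm_p_le (Q : Conf n) {t : ℝ} (ht : t ∈ Icc 0 F.τ) : ‖F.p Q t‖ ≤ F.K * t := by
  have h := F.norm_flow_sub_le (Q, 0) le_rfl ht.1 ht.2
  have h2 := (norm_snd_le _).trans h
  rw [F.flow_zero] at h2
  simpa [p] using h2

/-- The velocity vanishes at zero momentum, so it is at most `K‖p‖`, and `‖p‖ ≤ K t`. This is the
source of all displacements being quadratic in time. -/
theorem norm_dq_le (Q : Conf n) {t : ℝ} (ht : t ∈ Icc 0 F.τ) : ‖F.dq Q t‖ ≤ F.K ^ 2 * t := by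
  have h1 := (norm_fst_le _).trans (F.X_lipschitz (F.Φ (Q, 0) t) (F.q Q t, 0))
  rw [Prod.fst_sub, F.X_zero, sub_zero] at h1
  have h2 : F.Φ (Q, 0) t - (F.q Q t, 0) = (0, F.p Q t) := by
    ext1 <;> simp [q, p]
  rw [h2, Prod.norm_def] at h1
  simp only [norm_zero, norm_nonneg, sup_of_le_right] at h1
  have h3 := mul_le_mul_of_nonneg_left (F.norm_p_le Q ht) F.K_pos.le
  rw [dq]
  nlinarith

theorem norm_q_sub_le (Q : Conf n) {s t : ℝ} (hs : 0 ≤ s) (hst : s ≤ t) (ht : t ≤ F.τ) :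
    ‖F.q Q t - F.q Q s‖ ≤ F.K ^ 2 / 2 * (t ^ 2 - s ^ 2) := by
  have := norm_sub_le_of_hasDerivAt_le (f := F.q Q) (B := fun t => F.K ^ 2 / 2 * t ^ 2) hst
    (fun x hx => F.hasDerivAt_q Q (F.mem_Ioo ⟨hs.trans hx.1, hx.2.trans ht⟩))
    (hasDerivAt_const_mul_sq (F.K ^ 2 / 2))
    (fun x hx => (F.norm_dq_le Q ⟨hs.trans hx.1, hx.2.trans ht⟩).trans (by ring_nf; rfl))
  simpa [mul_sub] using this

theorem norm_q_sub_self_le (Q : Conf n) {t : ℝ} (ht : t ∈ Icc 0 F.τ) :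
    ‖F.q Q t - Q‖ ≤ F.K ^ 2 / 2 * t ^ 2 := by
  simpa [F.q_zero] using F.norm_q_sub_le Q le_rfl ht.1 ht.2

theorem norm_flow_diff_le (Q₁ Q₂ : Conf n) {t : ℝ} (ht : t ∈ Icc 0 F.τ) :
    ‖F.Φ (Q₁, 0) t - F.Φ (Q₂, 0) t‖ ≤ F.K * ‖Q₁ - Q₂‖ := by
  have := F.flow_lipschitz (Q₁, 0) (Q₂, 0) t (F.mem_Ico ht)
  simpa [Prod.norm_def] using this

theorem norm_dq_diff_le (Q₁ Q₂ : Conf n) {t : ℝ} (ht : t ∈ Icc 0 F.τ) :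
    ‖F.dq Q₁ t - F.dq Q₂ t‖ ≤ F.K ^ 2 * ‖Q₁ - Q₂‖ := by
  have h1 := (norm_fst_le _).trans (F.X_lipschitz (F.Φ (Q₁, 0) t) (F.Φ (Q₂, 0) t))
  have h2 := mul_le_mul_of_nonneg_left (F.norm_flow_diff_le Q₁ Q₂ ht) F.K_pos.le
  calc _ ≤ _ := h1
    _ ≤ _ := h2
    _ = _ := by ring

/-- At a fixed small time, `Q ↦ q Q t` is a small Lipschitz perturbation of the identity. -/
theorem norm_q_diff_le (Q₁ Q₂ : Conf n) {t : ℝ} (ht : t ∈ Icc 0 F.τ) :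
    ‖F.q Q₁ t - F.q Q₂ t - (Q₁ - Q₂)‖ ≤ F.K ^ 2 * t * ‖Q₁ - Q₂‖ := by
  have := norm_sub_le_of_hasDerivAt_le (f := fun t => F.q Q₁ t - F.q Q₂ t)
    (B := fun t => F.K ^ 2 * ‖Q₁ - Q₂‖ * t) ht.1
    (fun x hx => (F.hasDerivAt_q Q₁ (F.mem_Ioo ⟨hx.1, hx.2.trans ht.2⟩)).sub
      (F.hasDerivAt_q Q₂ (F.mem_Ioo ⟨hx.1, hx.2.trans ht.2⟩)))
    (hasDerivAt_const_mul_id _) (fun x hx => F.norm_dq_diff_le Q₁ Q₂ ⟨hx.1, hx.2.trans ht.2⟩)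
  simp only [F.q_zero, mul_zero, sub_zero] at this
  linarith

theorem norm_flow_le {Q : Conf n} (hQ : Metric.infDist Q (frontier D) ≤ F.r) {t : ℝ}
    (ht : t ∈ Icc 0 F.τ) : ‖F.Φ (Q, 0) t‖ ≤ F.R := by
  have h1 := F.norm_flow_sub_le (Q, 0) le_rfl ht.1 ht.2
  rw [F.flow_zero, sub_zero] at h1
  have h2 : ‖((Q, 0) : Conf n × Conf n)‖ ≤ F.R - 1 := by
    simpa [Prod.norm_def] using F.bounded Q hQ
  have h3 : F.K * t ≤ F.K * F.τ := mul_le_mul_of_nonneg_left ht.2 F.K_pos.le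
  have h4 := F.K_pow_mul_τ_le_ε (k := 1) (by norm_num)
  have h5 := F.ε_le_small
  rw [pow_one] at h4
  have h6 := norm_le_norm_add_norm_sub' (F.Φ (Q, 0) t) (Q, 0)
  linarith

theorem norm_q_le {Q : Conf n} (hQ : Metric.infDist Q (frontier D) ≤ F.r) {t : ℝ}
    (ht : t ∈ Icc 0 F.τ) : ‖F.q Q t‖ ≤ F.R := (norm_fst_le _).trans (F.norm_flow_le hQ ht)

theorem norm_rest_le {Q : Conf n} (hQ : ‖Q‖ ≤ F.R) :
    ‖((Q, 0) : Conf n × Conf n)‖ ≤ F.R := by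
  simpa [Prod.norm_def] using hQ

theorem X_snd_rest {Q : Conf n} (hQ : ‖Q‖ ≤ F.R) : (F.X (Q, 0)).2 = -gradQ H (Q, 0) := by
  rw [F.X_eq _ (F.norm_rest_le hQ)]

theorem norm_gradQ_le {Q : Conf n} (hQ : ‖Q‖ ≤ F.R) : ‖gradQ H (Q, 0)‖ ≤ F.K := by
  have := (norm_snd_le _).trans (F.X_bound (Q, 0))
  rwa [F.X_snd_rest hQ, norm_neg] at this

theorem norm_gradQ_sub_le {Q₁ Q₂ : Conf n} (h₁ : ‖Q₁‖ ≤ F.R) (h₂ : ‖Q₂‖ ≤ F.R) :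
    ‖gradQ H (Q₁, 0) - gradQ H (Q₂, 0)‖ ≤ F.K * ‖Q₁ - Q₂‖ := by
  have := (norm_snd_le _).trans (F.X_lipschitz (Q₁, 0) (Q₂, 0))
  rw [Prod.snd_sub, F.X_snd_rest h₁, F.X_snd_rest h₂] at this
  rw [neg_sub_neg, norm_sub_rev] at this
  simpa [Prod.norm_def] using this

theorem potential_taylor {x y : Conf n} (hx : ‖x‖ ≤ F.R) (hy : ‖y‖ ≤ F.R) :
    |H (y, 0) - H (x, 0) - inner ℝ (gradQ H (x, 0)) (y - x)| ≤ F.K * ‖y - x‖ ^ 2 := by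
  have := F.taylor (x, 0) (y, 0) (F.norm_rest_le hx) (F.norm_rest_le hy)
  simpa [Prod.norm_def] using this

theorem dq_eq {Q : Conf n} (hQ : Metric.infDist Q (frontier D) ≤ F.r) {t : ℝ}
    (ht : t ∈ Icc 0 F.τ) : F.dq Q t = gradP H (F.q Q t, F.p Q t) := by
  rw [dq, F.X_eq _ (F.norm_flow_le hQ ht)]; rfl

theorem norm_p_add_le {Q : Conf n} (hQ : Metric.infDist Q (frontier D) ≤ F.r) {t : ℝ}
    (ht : t ∈ Icc 0 F.τ) : ‖F.p Q t + t • gradQ H (Q, 0)‖ ≤ F.K ^ 2 * t ^ 2 := by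
  have hR : ‖Q‖ ≤ F.R := by linarith [F.bounded Q hQ]
  have := norm_sub_le_of_hasDerivAt_le (f := fun t => F.p Q t + t • gradQ H (Q, 0))
    (B := fun t => F.K ^ 2 / 2 * t ^ 2) ht.1
    (fun x hx => (F.hasDerivAt_p Q (F.mem_Ioo ⟨hx.1, hx.2.trans ht.2⟩)).add
      ((hasDerivAt_id x).smul_const _)) (hasDerivAt_const_mul_sq _) (fun x hx => by
        have h1 := (norm_snd_le _).trans (F.X_lipschitz (F.Φ (Q, 0) x) (Q, 0))
        rw [Prod.snd_sub, F.X_snd_rest hR, sub_neg_eq_add] at h1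
        have h2 := F.norm_flow_sub_le (Q, 0) le_rfl hx.1 (hx.2.trans ht.2)
        rw [F.flow_zero, sub_zero] at h2
        have h3 := mul_le_mul_of_nonneg_left h2 F.K_pos.le
        simp only [one_smul]
        linarith)
  simp only [F.p_zero, zero_smul, add_zero, sub_zero, ne_eq, OfNat.ofNat_ne_zero,
    not_false_eq_true, zero_pow, mul_zero] at this
  have h4 : 0 ≤ F.K ^ 2 * t ^ 2 := by positivity
  linarith

theorem norm_p_ge {Q : Conf n} (hQ : Metric.infDist Q (frontier D) ≤ F.r) {t : ℝ}
    (ht : t ∈ Icc 0 F.τ) : F.c / 2 * t ≤ ‖F.p Q t‖ := by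
  have h1 := F.norm_p_add_le hQ ht
  have h2 : F.K ^ 2 * t ≤ F.c / 2 := by
    have := F.K_pow_mul_τ_le_ε (k := 2) (by norm_num)
    have := mul_le_mul_of_nonneg_left ht.2 (by positivity : 0 ≤ F.K ^ 2)
    have := F.ε_le_κ; have := F.κ_le; have := F.c_pos
    linarith
  have h3 := mul_le_mul_of_nonneg_right h2 ht.1
  have h4 := mul_le_mul_of_nonneg_left (F.gradient_lower Q hQ) ht.1
  have h5 : ‖t • gradQ H (Q, 0)‖ = t * ‖gradQ H (Q, 0)‖ := by
    rw [norm_smul, Real.norm_of_nonneg ht.1]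
  have h6 : ‖t • gradQ H (Q, 0)‖ ≤ ‖F.p Q t + t • gradQ H (Q, 0)‖ + ‖F.p Q t‖ := by
    have := norm_sub_le (F.p Q t + t • gradQ H (Q, 0)) (F.p Q t)
    rwa [add_sub_cancel_left] at this
  nlinarith

/-- Combine `⟨p, ∂H/∂p⟩ ≥ c‖p‖²` with `‖p‖ ≥ (c/2) t`. The value `κ = c³/8` is chosen so that `c
(c/2)² = 2κ`. -/
theorem inner_p_dq_ge {Q : Conf n} (hQ : Metric.infDist Q (frontier D) ≤ F.r) {t : ℝ}
    (ht : t ∈ Icc 0 F.τ) : 2 * F.κ * t ^ 2 ≤ inner ℝ (F.p Q t) (F.dq Q t) := by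
  have h1 := F.gradP_coercive (F.q Q t) (F.p Q t) (F.norm_q_le hQ ht)
  rw [← F.dq_eq hQ ht, real_inner_comm] at h1
  have h2 := F.norm_p_ge hQ ht
  have h3 : (F.c / 2 * t) ^ 2 ≤ ‖F.p Q t‖ ^ 2 :=
    pow_le_pow_left₀ (mul_nonneg (by linarith [F.c_pos]) ht.1) h2 2
  have h4 := mul_le_mul_of_nonneg_left h3 F.c_pos.le
  rw [F.κ_eq]
  linarith

/-- The velocity points inwards, with a speed proportional to the time. -/
theorem inner_neg_gradQ_dq_ge {Q : Conf n} (hQ : Metric.infDist Q (frontier D) ≤ F.r) {t : ℝ}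
    (ht : t ∈ Icc 0 F.τ) : F.κ * t ≤ inner ℝ (-gradQ H (Q, 0)) (F.dq Q t) := by
  rcases ht.1.eq_or_lt with h0 | h0
  · have h1 := F.norm_dq_le Q ht
    rw [← h0, mul_zero] at h1 ⊢
    rw [norm_le_zero_iff.1 h1, inner_zero_right]
  have h1 := F.inner_p_dq_ge hQ ht
  have h2 := F.norm_p_add_le hQ ht
  have h3 := F.norm_dq_le Q ht
  -- Replacing `p` by `-t∇V(Q)` in `⟨p, q'⟩ ≥ 2κt²` costs at most `K⁴t³ ≤ κt²`. Dividing the rest by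
  -- `t` gives the claim.
  have h4 := (real_inner_le_norm (F.p Q t + t • gradQ H (Q, 0)) (F.dq Q t)).trans
    (mul_le_mul h2 h3 (norm_nonneg _) (by positivity))
  rw [inner_add_left, real_inner_smul_left] at h4
  rw [inner_neg_left]
  have h5 : F.K ^ 4 * t ≤ F.κ := by
    have := F.K_pow_mul_τ_le_ε (k := 4) (by norm_num)
    have := mul_le_mul_of_nonneg_left ht.2 (by positivity : 0 ≤ F.K ^ 4)
    have := F.ε_le_κ; have := F.κ_pos
    linarith
  have h6 : F.K ^ 2 * t ^ 2 * (F.K ^ 2 * t) ≤ F.κ * t ^ 2 := by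
    have := mul_le_mul_of_nonneg_right h5 (sq_nonneg t)
    linarith
  have h7 : t * (F.κ * t) ≤ t * -inner ℝ (gradQ H (Q, 0)) (F.dq Q t) := by linarith
  exact le_of_mul_le_mul_left h7 h0

theorem inner_neg_gradQ_q_sub_ge {Q : Conf n} (hQ : Metric.infDist Q (frontier D) ≤ F.r)
    {s t : ℝ} (hs : 0 ≤ s) (hst : s ≤ t) (ht : t ≤ F.τ) :
    F.κ / 2 * (t ^ 2 - s ^ 2) ≤ inner ℝ (-gradQ H (Q, 0)) (F.q Q t - F.q Q s) := by
  have := sub_le_sub_of_le_hasDerivAt (f := fun t => inner ℝ (-gradQ H (Q, 0)) (F.q Q t))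
    (f' := fun t => inner ℝ (-gradQ H (Q, 0)) (F.dq Q t))
    (B := fun t => F.κ / 2 * t ^ 2) hst
    (fun x hx => by
      simpa using (hasDerivAt_const x (-gradQ H (Q, 0))).inner ℝ
        (F.hasDerivAt_q Q (F.mem_Ioo ⟨hs.trans hx.1, hx.2.trans ht⟩)))
    (hasDerivAt_const_mul_sq (F.κ / 2))
    (fun x hx => by
      have := F.inner_neg_gradQ_dq_ge hQ ⟨hs.trans hx.1, hx.2.trans ht⟩
      linarith)
  rw [inner_sub_right]
  linarith

/-- The potential decreases along the trajectories that start at rest. -/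
theorem potential_q_le {Q : Conf n} (hQ : Metric.infDist Q (frontier D) ≤ F.r) {t : ℝ}
    (ht : t ∈ Icc 0 F.τ) : H (F.q Q t, 0) ≤ H (Q, 0) - F.κ / 4 * t ^ 2 := by
  have h1 := F.inner_neg_gradQ_q_sub_ge hQ le_rfl ht.1 ht.2
  have h2 := F.norm_q_sub_self_le Q ht
  have h3 := (abs_le.1 (F.potential_taylor (x := Q) (y := F.q Q t)
    (by linarith [F.bounded Q hQ]) (F.norm_q_le hQ ht))).2
  rw [F.q_zero, inner_neg_left] at h1
  have h4 : ‖F.q Q t - Q‖ ^ 2 ≤ (F.K ^ 2 / 2 * t ^ 2) ^ 2 :=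
    pow_le_pow_left₀ (norm_nonneg _) h2 2
  have h5 := mul_le_mul_of_nonneg_left h4 F.K_pos.le
  have h6 : F.K ^ 5 * t ≤ F.κ := by
    have := F.K_pow_mul_τ_le_ε (k := 5) (by norm_num)
    have := mul_le_mul_of_nonneg_left ht.2 (by have := F.K_pos; positivity : 0 ≤ F.K ^ 5)
    have := F.ε_le_κ; have := F.κ_pos
    linarith
  have h7 : F.K ^ 5 * t * t ≤ F.κ * 1 :=
    mul_le_mul h6 (ht.2.trans F.τ_lt_one.le) ht.1 F.κ_pos.le
  have h8 := mul_le_mul_of_nonneg_right h7 (sq_nonneg t)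
  nlinarith

theorem energy_eq {Q : Conf n} (hQ : Metric.infDist Q (frontier D) ≤ F.r) {t : ℝ}
    (ht : t ∈ Icc 0 F.τ) : H (F.q Q t, F.p Q t) = H (Q, 0) := by
  have := norm_sub_le_of_hasDerivAt_le (f := fun t => H (F.Φ (Q, 0) t)) (f' := fun _ => 0)
    (B := fun t => 0 * t) (B' := fun _ => 0) ht.1
    (fun x hx => by
      have hx' : x ∈ Icc 0 F.τ := ⟨hx.1, hx.2.trans ht.2⟩
      have h1 := (F.differentiable _).hasFDerivAt.comp_hasDerivAt x
        (F.flow_deriv (Q, 0) x (F.mem_Ioo hx'))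
      rw [fderiv_eq_inner_add_inner F.differentiable, F.X_eq _ (F.norm_flow_le hQ hx'),
        inner_neg_right, real_inner_comm, add_neg_cancel] at h1
      exact h1)
    (hasDerivAt_const_mul_id 0) (by simp)
  simp only [zero_mul, sub_self, norm_le_zero_iff, F.flow_zero] at this
  exact sub_eq_zero.1 this

theorem infDist_frontier_le {Q : Conf n} (hQ : Q ∈ frontier D) :
    Metric.infDist Q (frontier D) ≤ F.r := by
  rw [Metric.infDist_zero_of_mem hQ]; exact F.r_pos.le

/-! ### Injectivity with Lipschitz control of the inverse. -/

/-- The Lipschitz constant of the inverse of `(Q, T) ↦ q Q T` in terms of `Q` and `T²`. -/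
def A : ℝ := 4 * F.K ^ 3 / F.κ

theorem A_ge : 32 ≤ F.A := by
  rw [A, le_div_iff₀ F.κ_pos]
  have := F.κ_le_eighth
  have := one_le_pow₀ F.one_le_K (n := 3)
  linarith

theorem A_pos : 0 < F.A := by linarith [F.A_ge]

theorem inverse_lipschitz_of_le {Q₁ Q₂ : Conf n} (h₁ : Q₁ ∈ frontier D) (h₂ : Q₂ ∈ frontier D)
    {T₁ T₂ : ℝ} (hT₁ : 0 ≤ T₁) (hT : T₁ ≤ T₂) (hT₂ : T₂ ≤ F.τ) :
    ‖Q₁ - Q₂‖ ≤ F.A * ‖F.q Q₁ T₁ - F.q Q₂ T₂‖ ∧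
      T₂ ^ 2 - T₁ ^ 2 ≤ F.A * ‖F.q Q₁ T₁ - F.q Q₂ T₂‖ := by
  set d := F.q Q₁ T₁ - F.q Q₂ T₂ with hd
  set e := Q₁ - Q₂ with he
  have hT₁' : T₁ ∈ Icc 0 F.τ := ⟨hT₁, hT.trans hT₂⟩
  have hT₂' : T₂ ∈ Icc 0 F.τ := ⟨hT₁.trans hT, hT₂⟩
  have hK := F.K_pos
  have hε := F.ε_pos
  have hεs := F.ε_le_small
  have hτ1 := F.τ_lt_one
  have hKτ : F.K ^ 2 * F.τ ≤ F.ε / 2 := F.K_pow_mul_τ_le_ε (by norm_num)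
  have hA := F.A_ge
  by_cases hsmall : ‖e‖ ≤ F.ε
  · have hR₁ : ‖Q₁‖ ≤ F.R := by linarith [F.bounded Q₁ (F.infDist_frontier_le h₁)]
    have hR₂ : ‖Q₂‖ ≤ F.R := by linarith [F.bounded Q₂ (F.infDist_frontier_le h₂)]
    set m := F.q Q₂ T₂ - F.q Q₂ T₁ with hm
    set ρ := F.q Q₁ T₁ - F.q Q₂ T₁ - e with hρ
    set u := T₂ ^ 2 - T₁ ^ 2 with hu
    have hu0 : 0 ≤ u := sub_nonneg.2 (pow_le_pow_left₀ hT₁ hT 2)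
    have hρ_le : ‖ρ‖ ≤ F.ε * ‖e‖ := by
      refine (F.norm_q_diff_le Q₁ Q₂ hT₁').trans ?_
      refine mul_le_mul_of_nonneg_right ?_ (norm_nonneg _)
      have := mul_le_mul_of_nonneg_left hT₁'.2 (by positivity : 0 ≤ F.K ^ 2)
      linarith
    have hm_le : ‖m‖ ≤ F.K ^ 2 / 2 * u := F.norm_q_sub_le Q₂ hT₁ hT hT₂
    -- Here `m` is the motion from `T₁` to `T₂`, and `ρ` is the small error at fixed time. Pair the
    -- identity with `-∇V(Q₂)`: since `V(Q₁) = V(Q₂) = E`, the chord `e` is almost tangent and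
    -- contributes only `Kε‖e‖`, while `m` contributes at least `(κ/2) u`. So `u` is bounded by
    -- `‖d‖` and `ε‖e‖`, and `‖e‖` by `‖d‖` and `u`; the loop closes because `ε` is small. No chart
    -- of `∂D` is needed.
    have hdem : d = e + ρ - m := by rw [hd, hρ, hm]; abel
    have hin := F.inner_neg_gradQ_q_sub_ge (F.infDist_frontier_le h₂) hT₁ hT hT₂
    rw [← hm] at hin
    have hme : m = e + ρ - d := by rw [hdem]; abel
    have hG := F.norm_gradQ_le hR₂
    have h1 : inner ℝ (-gradQ H (Q₂, 0)) e ≤ F.K * (F.ε * ‖e‖) := by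
      rw [inner_neg_left]
      have := mul_le_mul_of_nonneg_left
        (mul_le_mul_of_nonneg_right hsmall (norm_nonneg e)) hK.le
      rw [← sq] at this
      have := F.potential_taylor hR₂ hR₁
      rw [F.potential_eq _ h₁, F.potential_eq _ h₂, sub_self, zero_sub, ← he, abs_neg] at this
      have := (abs_le.1 this).1
      linarith
    have h2 : inner ℝ (-gradQ H (Q₂, 0)) ρ ≤ F.K * (F.ε * ‖e‖) :=
      (real_inner_le_norm _ _).trans
        (mul_le_mul (by rwa [norm_neg]) hρ_le (norm_nonneg _) hK.le)
    have h3 : -inner ℝ (-gradQ H (Q₂, 0)) d ≤ F.K * ‖d‖ := by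
      rw [inner_neg_left, neg_neg]
      exact (real_inner_le_norm _ _).trans (mul_le_mul_of_nonneg_right hG (norm_nonneg _))
    rw [hme, inner_sub_right, inner_add_right] at hin
    have h4 : F.κ * u ≤ 4 * F.K * F.ε * ‖e‖ + 2 * F.K * ‖d‖ := by linarith
    have h5 : ‖e‖ ≤ ‖d‖ + F.ε * ‖e‖ + F.K ^ 2 / 2 * u := by
      have h6 : e = d - ρ + m := by rw [hdem]; abel
      have := norm_add_le (d - ρ) m
      rw [← h6] at this
      have := norm_sub_le d ρ
      linarith
    have hκ := F.κ_pos
    have hκ8 := F.κ_le_eighth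
    have hKε := F.ε_le
    have hK3 : 1 ≤ F.K ^ 3 := one_le_pow₀ F.one_le_K
    have hd0 := norm_nonneg d
    have he0 := norm_nonneg e
    have h7 : F.κ * ‖e‖ ≤ 4 * F.K ^ 3 * ‖d‖ := by
      have h8 := mul_le_mul_of_nonneg_left h5 hκ.le
      have h9 := mul_le_mul_of_nonneg_left h4 (by positivity : 0 ≤ F.K ^ 2 / 2)
      have h10 := mul_le_mul_of_nonneg_right hKε he0
      have h11 : F.κ * (F.ε * ‖e‖) ≤ F.κ * (1 / 64 * ‖e‖) := by gcongr
      have h12 : F.κ * ‖d‖ ≤ 1 / 8 * F.K ^ 3 * ‖d‖ := by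
        refine mul_le_mul_of_nonneg_right ?_ hd0
        linarith
      nlinarith
    have h13 : F.κ * u ≤ 4 * F.K ^ 3 * ‖d‖ := by
      have h14 : F.K ≤ F.K ^ 3 := le_self_pow₀ F.one_le_K (by norm_num)
      have h15 : F.K * ‖d‖ ≤ F.K ^ 3 * ‖d‖ := mul_le_mul_of_nonneg_right h14 hd0
      have h16 : 4 * F.K * F.ε * (F.κ * ‖e‖) ≤ 4 * F.K * F.ε * (4 * F.K ^ 3 * ‖d‖) :=
        mul_le_mul_of_nonneg_left h7 (by positivity)
      have h17 : F.ε * F.K ^ 3 * (F.K * ‖d‖) ≤ F.κ / 8 * (F.K * ‖d‖) :=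
        mul_le_mul_of_nonneg_right (by linarith) (by positivity)
      have h18 : F.κ * (4 * F.K * F.ε * ‖e‖) ≤ F.κ * (2 * F.K * ‖d‖) := by nlinarith
      have h19 := le_of_mul_le_mul_left h18 hκ
      linarith
    constructor
    · rw [A, div_mul_eq_mul_div, le_div_iff₀ hκ]; linarith
    · rw [A, div_mul_eq_mul_div, le_div_iff₀ hκ]; linarith
  -- For starting points more than `ε` apart, each trajectory moves at most `ε/4`, so the end points
  -- remain at distance at least `‖e‖/2`; any large `A` then works.
  · rw [not_le] at hsmall
    have h1 := F.norm_q_sub_self_le Q₁ hT₁'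
    have h2 := F.norm_q_sub_self_le Q₂ hT₂'
    have hb : ∀ t ∈ Icc 0 F.τ, F.K ^ 2 / 2 * t ^ 2 ≤ F.ε / 4 := by
      intro t ht
      have h3 : t ^ 2 ≤ F.τ * 1 := by
        rw [sq]; exact mul_le_mul ht.2 (ht.2.trans hτ1.le) ht.1 F.τ_pos.le
      have := mul_le_mul_of_nonneg_left h3 (by positivity : 0 ≤ F.K ^ 2 / 2)
      linarith
    have h3 := hb _ hT₁'
    have h4 := hb _ hT₂'
    have h5 : ‖e‖ ≤ ‖d‖ + ‖F.q Q₁ T₁ - Q₁‖ + ‖F.q Q₂ T₂ - Q₂‖ := by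
      have h6 : e = d - (F.q Q₁ T₁ - Q₁) + (F.q Q₂ T₂ - Q₂) := by rw [he, hd]; abel
      have := norm_add_le (d - (F.q Q₁ T₁ - Q₁)) (F.q Q₂ T₂ - Q₂)
      rw [← h6] at this
      have := norm_sub_le d (F.q Q₁ T₁ - Q₁)
      linarith
    have h7 : 32 * ‖d‖ ≤ F.A * ‖d‖ := mul_le_mul_of_nonneg_right hA (norm_nonneg _)
    have h8 : T₂ ^ 2 ≤ F.ε / 2 := by
      have h9 : T₂ ^ 2 ≤ F.τ * 1 := by
        rw [sq]; exact mul_le_mul hT₂ (hT₂.trans hτ1.le) hT₂'.1 F.τ_pos.le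
      have := F.K_pow_mul_τ_le_ε (k := 0) (by norm_num)
      simp only [pow_zero, one_mul] at this
      linarith
    constructor
    · linarith
    · nlinarith [sq_nonneg T₁]

theorem inverse_lipschitz {Q₁ Q₂ : Conf n} (h₁ : Q₁ ∈ frontier D) (h₂ : Q₂ ∈ frontier D)
    {T₁ T₂ : ℝ} (hT₁ : T₁ ∈ Icc 0 F.τ) (hT₂ : T₂ ∈ Icc 0 F.τ) :
    ‖Q₁ - Q₂‖ ≤ F.A * ‖F.q Q₁ T₁ - F.q Q₂ T₂‖ ∧
      |T₁ ^ 2 - T₂ ^ 2| ≤ F.A * ‖F.q Q₁ T₁ - F.q Q₂ T₂‖ := by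
  rcases le_total T₁ T₂ with h | h
  · have := F.inverse_lipschitz_of_le h₁ h₂ hT₁.1 h hT₂.2
    refine ⟨this.1, ?_⟩
    rw [abs_sub_comm, abs_of_nonneg (sub_nonneg.2 (pow_le_pow_left₀ hT₁.1 h 2))]
    exact this.2
  · have := F.inverse_lipschitz_of_le h₂ h₁ hT₂.1 h hT₁.2
    rw [norm_sub_rev, norm_sub_rev (F.q Q₁ T₁)]
    refine ⟨this.1, ?_⟩
    rw [abs_of_nonneg (sub_nonneg.2 (pow_le_pow_left₀ hT₂.1 h 2))]
    exact this.2

theorem eq_of_q_eq {Q₁ Q₂ : Conf n} (h₁ : Q₁ ∈ frontier D) (h₂ : Q₂ ∈ frontier D)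
    {T₁ T₂ : ℝ} (hT₁ : T₁ ∈ Icc 0 F.τ) (hT₂ : T₂ ∈ Icc 0 F.τ) (h : F.q Q₁ T₁ = F.q Q₂ T₂) :
    Q₁ = Q₂ ∧ T₁ = T₂ := by
  have := F.inverse_lipschitz h₁ h₂ hT₁ hT₂
  rw [h, sub_self, norm_zero, mul_zero] at this
  refine ⟨sub_eq_zero.1 (norm_le_zero_iff.1 this.1), ?_⟩
  have h3 := sub_eq_zero.1 (abs_nonpos_iff.1 this.2)
  exact (sq_eq_sq₀ hT₁.1 hT₂.1).1 h3

/-! ### The collar, and property 1. -/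

/-- Width of the collar that is filled by the trajectories of duration at most `τ`. -/
def δ : ℝ := F.κ * F.τ ^ 2 * F.r / (16 * F.K)

theorem δ_pos : 0 < F.δ := by
  have := F.κ_pos; have := F.τ_pos; have := F.r_pos; have := F.K_pos
  rw [δ]; positivity

theorem δ_mul_K : 16 * F.K * F.δ = F.κ * F.τ ^ 2 * F.r := by
  have := F.K_pos
  rw [δ]; field_simp

theorem δ_mul_K_le : 16 * F.K * F.δ ≤ F.κ * F.τ ^ 2 := by
  rw [δ_mul_K]
  exact mul_le_of_le_one_right (by have := F.κ_pos; positivity) F.r_le_one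

theorem δ_le : F.δ ≤ F.r / 2 := by
  have h1 := F.δ_mul_K
  have h2 : 16 * 1 * F.δ ≤ 16 * F.K * F.δ := by
    have := F.one_le_K; have := F.δ_pos; gcongr
  have h3 : F.κ * F.τ ^ 2 ≤ 1 / 8 * 1 :=
    mul_le_mul F.κ_le_eighth (pow_le_one₀ F.τ_pos.le F.τ_lt_one.le) (sq_nonneg _) (by norm_num)
  have h4 := mul_le_mul_of_nonneg_right h3 F.r_pos.le
  linarith [F.r_pos]

/-- Compare with the nearest boundary point. For `δ ≤ F.δ` the loss `2Kδ` is at most `κτ²/8`,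
whereas `potential_q_le` gives a drop of `κτ²/4` after time `τ`. This gap is what the size of `F.δ`
is for. -/
theorem potential_ge {x : Conf n} {δ : ℝ} (hx : Metric.infDist x (frontier D) ≤ δ)
    (hδ : δ ≤ F.r) : E - 2 * F.K * δ ≤ H (x, 0) := by
  obtain ⟨Z, hZ, hxZ⟩ := F.isCompact_frontier.exists_infDist_eq_dist F.frontier_nonempty x
  have hR₁ : ‖Z‖ ≤ F.R := by linarith [F.bounded Z (F.infDist_frontier_le hZ)]
  have hR₂ : ‖x‖ ≤ F.R := by linarith [F.bounded x (hx.trans hδ)]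
  have h1 := (abs_le.1 (F.potential_taylor hR₁ hR₂)).1
  rw [F.potential_eq Z hZ] at h1
  have h2 := neg_le_of_abs_le (abs_real_inner_le_norm (gradQ H (Z, 0)) (x - Z))
  have h3 := mul_le_mul_of_nonneg_right (F.norm_gradQ_le hR₁) (norm_nonneg (x - Z))
  rw [hxZ, dist_eq_norm] at hx
  have h4 : ‖x - Z‖ ^ 2 ≤ ‖x - Z‖ := by
    rw [sq]; exact mul_le_of_le_one_left (norm_nonneg _) (by linarith [F.r_le_one])
  have h5 := mul_le_mul_of_nonneg_left h4 F.K_pos.le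
  have h6 := mul_le_mul_of_nonneg_left hx F.K_pos.le
  linarith

/-- The trajectories that start at rest at the boundary fill a collar. -/
theorem exists_q_eq {y : Conf n} (hy : y ∈ D) (hyδ : Metric.infDist y (frontier D) ≤ F.δ) :
    ∃ Q ∈ frontier D, ∃ T ∈ Ioc 0 F.τ, F.q Q T = y := by
  have hKt : ∀ t ∈ Icc 0 F.τ, F.K ^ 2 * t ≤ 1 / 2 := by
    intro t ht
    have h1 : F.K ^ 2 * F.τ ≤ F.ε / 2 := F.K_pow_mul_τ_le_ε (by norm_num)
    have h2 := mul_le_mul_of_nonneg_left ht.2 (by positivity : 0 ≤ F.K ^ 2)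
    linarith [F.ε_le_small]
  have hex : ∀ t ∈ Icc 0 F.τ, ∃ Q, F.q Q t = y := by
    intro t ht
    -- A fixed point of this map is a starting point from which `y` is reached at time `t`. It need
    -- not lie on `∂D`.
    have hc : ContractingWith (1 / 2) (fun Q => y - (F.q Q t - Q)) := by
      refine ⟨by rw [← NNReal.coe_lt_coe]; norm_num, LipschitzWith.of_dist_le_mul fun Q₁ Q₂ => ?_⟩
      rw [dist_eq_norm, dist_eq_norm]
      have h1 := F.norm_q_diff_le Q₁ Q₂ ht
      have h2 : y - (F.q Q₁ t - Q₁) - (y - (F.q Q₂ t - Q₂))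
          = -(F.q Q₁ t - F.q Q₂ t - (Q₁ - Q₂)) := by abel
      rw [h2, norm_neg]
      refine h1.trans (mul_le_mul_of_nonneg_right ?_ (norm_nonneg _))
      simpa using hKt t ht
    refine ⟨hc.fixedPoint, ?_⟩
    have h3 := hc.fixedPoint_isFixedPt
    rw [Function.IsFixedPt] at h3
    rw [← sub_eq_zero]
    have h4 : y - F.q hc.fixedPoint t + hc.fixedPoint = hc.fixedPoint := by
      rw [← sub_add] at h3; exact h3
    rw [add_eq_right] at h4
    rw [← neg_sub, h4, neg_zero]
  choose! Qt hQt using hex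
  have hcont : ContinuousOn Qt (Icc 0 F.τ) := by
    have : LipschitzOnWith (Real.toNNReal (2 * F.K)) Qt (Icc 0 F.τ) := by
      refine LipschitzOnWith.of_dist_le_mul fun s hs t ht => ?_
      rw [Real.coe_toNNReal _ (by linarith [F.K_pos]), dist_eq_norm, Real.dist_eq]
      wlog hst : s ≤ t generalizing s t
      · rw [norm_sub_rev, abs_sub_comm]; exact this t ht s hs (le_of_not_ge hst)
      have h1 := F.norm_q_diff_le (Qt s) (Qt t) ht
      have h2 := mul_le_mul_of_nonneg_right (hKt t ht) (norm_nonneg (Qt s - Qt t))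
      have h3 := (norm_fst_le _).trans (F.norm_flow_sub_le (Qt s, 0) hs.1 hst ht.2)
      rw [Prod.fst_sub] at h3
      change ‖F.q (Qt s) t - F.q (Qt s) s‖ ≤ _ at h3
      rw [hQt s hs] at h3
      rw [hQt t ht] at h1
      have h4 := norm_sub_norm_le (Qt s - Qt t) (F.q (Qt s) t - y)
      rw [norm_sub_rev (Qt s - Qt t) (F.q (Qt s) t - y)] at h4
      rw [abs_of_nonpos (by linarith)]
      linarith
    exact this.continuousOn
  have hτ : F.τ ∈ Icc 0 F.τ := ⟨F.τ_pos.le, le_rfl⟩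
  have h0 : (0 : ℝ) ∈ Icc 0 F.τ := ⟨le_rfl, F.τ_pos.le⟩
  have hQ0 : Qt 0 = y := by simpa only [F.q_zero] using hQt 0 h0
  -- Otherwise the potential at the start would be below `E`, and the drop over time `τ` would put
  -- `V(y)` below the lower bound valid in the collar.
  have hQτ : Qt F.τ ∉ D := by
    intro hmem
    have h1 := F.norm_q_sub_self_le (Qt F.τ) hτ
    rw [hQt _ hτ] at h1
    have h2 : Metric.infDist (Qt F.τ) (frontier D) ≤ F.r := by
      have h3 := Metric.infDist_le_infDist_add_dist (s := frontier D) (x := Qt F.τ) (y := y)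
      rw [dist_comm, dist_eq_norm] at h3
      have h4 : F.K ^ 2 * F.τ ≤ F.ε * F.r / 2 := F.K_pow_mul_τ_le (by norm_num)
      have h5 := mul_le_mul h4 F.τ_lt_one.le F.τ_pos.le
        (by have := F.ε_pos; have := F.r_pos; positivity)
      have h6 := mul_le_mul_of_nonneg_right F.ε_le_small F.r_pos.le
      have := F.δ_le
      have := F.r_pos
      linarith
    have h7 := F.potential_q_le h2 hτ
    rw [hQt _ hτ] at h7
    have h8 := F.potential_ge hyδ (by linarith [F.δ_le, F.r_pos])
    have h9 := F.δ_mul_K_le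
    have h10 := F.potential_lt _ hmem
    have : 0 < F.κ * F.τ ^ 2 := by have := F.κ_pos; have := F.τ_pos; positivity
    linarith
  -- The path of starting points runs from `y ∈ D` at time `0` to a point outside `D`, so it crosses
  -- `∂D`; the crossing time is the duration sought.
  obtain ⟨z, ⟨t, ht, rfl⟩, hz⟩ := (isPreconnected_Icc.image Qt hcont).exists_mem_frontier
    (mem_image_of_mem Qt h0) (hQ0 ▸ hy) (mem_image_of_mem Qt hτ) hQτ
  refine ⟨Qt t, hz, t, ⟨lt_of_le_of_ne ht.1 fun h => ?_, ht.2⟩, hQt t ht⟩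
  rw [← h, hQ0] at hz
  exact (F.isOpen.inter_frontier_eq ▸ (⟨hy, hz⟩ : y ∈ D ∩ frontier D) : y ∈ (∅ : Set (Conf n)))

/-- For positive times the potential is strictly below `E`, so the trajectory cannot meet `∂D`
again. -/
theorem q_mem_of_le {Q : Conf n} (hQ : Q ∈ frontier D) {s t : ℝ} (hs : 0 < s) (hst : s ≤ t)
    (ht : t ≤ F.τ) (h : F.q Q t ∈ D) : F.q Q s ∈ D := by
  by_contra hsD
  have hcont : ContinuousOn (F.q Q) (Icc s t) := fun x hx =>
    (F.hasDerivAt_q Q (F.mem_Ioo ⟨hs.le.trans hx.1, hx.2.trans ht⟩)).continuousAt.continuousWithinAt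
  obtain ⟨z, ⟨x, hx, rfl⟩, hz⟩ := (isPreconnected_Icc.image _ hcont).exists_mem_frontier
    (mem_image_of_mem _ (right_mem_Icc.2 hst)) h (mem_image_of_mem _ (left_mem_Icc.2 hst)) hsD
  have h1 := F.potential_q_le (F.infDist_frontier_le hQ) ⟨hs.le.trans hx.1, hx.2.trans ht⟩
  rw [F.potential_eq _ hz, F.potential_eq _ hQ] at h1
  have : 0 < F.κ * x ^ 2 := by
    have := F.κ_pos; have := hs.trans_le hx.1; positivity
  linarith

/-- The distance to the boundary increases along the trajectories that start at rest there. -/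
theorem infDist_q_mono {Q : Conf n} (hQ : Q ∈ frontier D) {s t : ℝ} (hs : 0 ≤ s) (hst : s ≤ t)
    (ht : t ≤ F.τ) (h : F.q Q t ∈ D) :
    Metric.infDist (F.q Q s) (frontier D) ≤ Metric.infDist (F.q Q t) (frontier D) := by
  rcases hs.eq_or_lt with rfl | hs'
  · rw [F.q_zero, Metric.infDist_zero_of_mem hQ]; exact Metric.infDist_nonneg
  have hsD := F.q_mem_of_le hQ hs' hst ht h
  obtain ⟨Z, hZ, hxZ⟩ := F.isCompact_frontier.exists_infDist_eq_dist F.frontier_nonempty (F.q Q t)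
  set m := F.q Q t - F.q Q s with hm
  set u := t ^ 2 - s ^ 2 with hu
  have hu0 : 0 ≤ u := sub_nonneg.2 (pow_le_pow_left₀ hs hst 2)
  have hK := F.K_pos
  have hm_le : ‖m‖ ≤ F.K ^ 2 / 2 * u := F.norm_q_sub_le Q hs hst ht
  have ht' : t ∈ Icc 0 F.τ := ⟨hs.trans hst, ht⟩
  have hin := F.inner_neg_gradQ_q_sub_ge (F.infDist_frontier_le hQ) hs hst ht
  rw [← hm, ← hu] at hin
  have htt : t ^ 2 ≤ F.τ := by
    have : t ^ 2 ≤ F.τ * 1 := by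
      rw [sq]; exact mul_le_mul ht (ht.trans F.τ_lt_one.le) ht'.1 F.τ_pos.le
    linarith
  have hQZ : ‖Q - Z‖ ≤ F.K ^ 2 * F.τ := by
    have h1 := F.norm_q_sub_self_le Q ht'
    have h2 : dist (F.q Q t) Z ≤ dist (F.q Q t) Q := hxZ ▸ Metric.infDist_le_dist_of_mem hQ
    rw [dist_eq_norm, dist_eq_norm] at h2
    have h3 := norm_sub_le_norm_sub_add_norm_sub Q (F.q Q t) Z
    rw [norm_sub_rev Q (F.q Q t)] at h3
    have := mul_le_mul_of_nonneg_left htt (by positivity : 0 ≤ F.K ^ 2)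
    linarith
  have hmτ : ‖m‖ ≤ F.K ^ 2 * F.τ / 2 := by
    have h1 : u ≤ F.τ := by have := sq_nonneg s; linarith
    have := mul_le_mul_of_nonneg_left h1 (by positivity : 0 ≤ F.K ^ 2)
    linarith
  have hRQ := F.bounded Q (F.infDist_frontier_le hQ)
  have hRZ := F.bounded Z (F.infDist_frontier_le hZ)
  have hKτ : F.K ^ 2 * F.τ ≤ F.ε / 2 := F.K_pow_mul_τ_le_ε (by norm_num)
  have hRm : ‖Z - m‖ ≤ F.R := by
    have := norm_sub_le Z m
    linarith [F.ε_le_small]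
  -- Going back by `m` from `Z` raises the potential above `E`: `∇V(Z)` is close to `∇V(Q)`, and
  -- `-⟨∇V(Q), m⟩ ≥ (κ/2) u` beats the error terms. The segment from `q Q s` to `Z - m` then meets
  -- `∂D`, and its length is the distance from `q Q t` to `Z`.
  have hZm : Z - m ∉ D := by
    intro hmem
    have h1 := F.potential_lt _ hmem
    have h2 := (abs_le.1 (F.potential_taylor (x := Z) (y := Z - m) (by linarith) hRm)).1
    rw [F.potential_eq _ hZ, sub_sub_cancel_left, inner_neg_right, norm_neg] at h2
    have h3 := (real_inner_le_norm (gradQ H (Z, 0) - gradQ H (Q, 0)) m).trans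
      (mul_le_mul_of_nonneg_right (F.norm_gradQ_sub_le (Q₁ := Z) (Q₂ := Q) (by linarith)
        (by linarith)) (norm_nonneg m))
    rw [inner_sub_left, norm_sub_rev Z] at h3
    rw [inner_neg_left] at hin
    have h4 : F.K * (‖Q - Z‖ + ‖m‖) * ‖m‖ ≤ F.κ / 2 * u := by
      have h5 : F.K * (‖Q - Z‖ + ‖m‖) * ‖m‖ ≤
          F.K * (F.K ^ 2 * F.τ * 2) * (F.K ^ 2 / 2 * u) := by
        have : ‖Q - Z‖ + ‖m‖ ≤ F.K ^ 2 * F.τ * 2 := by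
          have : 0 ≤ F.K ^ 2 * F.τ := by have := F.τ_pos; positivity
          linarith
        have := F.τ_pos
        gcongr
      have h6 : F.K ^ 5 * F.τ ≤ F.κ / 2 := by
        have := F.K_pow_mul_τ_le_ε (k := 5) (by norm_num)
        have := F.ε_le_κ; have := F.κ_pos
        linarith
      have := mul_le_mul_of_nonneg_right h6 hu0
      linarith
    linarith
  obtain ⟨w, hw, hwF⟩ := (convex_segment (𝕜 := ℝ) (F.q Q s) (Z - m)).isPreconnected.exists_mem_frontier
    (left_mem_segment ℝ _ _) hsD (right_mem_segment ℝ _ _) hZm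
  calc Metric.infDist (F.q Q s) (frontier D) ≤ dist (F.q Q s) w := Metric.infDist_le_dist_of_mem hwF
    _ ≤ dist (F.q Q s) (Z - m) := by
        have := dist_add_dist_of_mem_segment hw
        have := dist_nonneg (x := w) (y := Z - m)
        linarith
    _ = dist (F.q Q t) Z := by
        rw [dist_eq_norm, dist_eq_norm, hm]; congr 1; abel
    _ = _ := hxZ.symm

theorem isCollarSolution {Q : Conf n} (hQ : Q ∈ frontier D) {T δ : ℝ} (hT : T ∈ Ioc 0 F.τ)
    (hD : F.q Q T ∈ D) (hδ : Metric.infDist (F.q Q T) (frontier D) ≤ δ) :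
    IsCollarSolution H D E δ (F.q Q T) T (F.q Q) (F.p Q) where
  pos := hT.1
  solution := fun t ht => by
    have ht' : t ∈ Icc 0 F.τ := ⟨ht.1, ht.2.trans hT.2⟩
    have hX := F.X_eq _ (F.norm_flow_le (F.infDist_frontier_le hQ) ht')
    have h1 := (F.hasDerivAt_q Q (F.mem_Ioo ht')).hasDerivWithinAt (s := Icc 0 T)
    have h2 := (F.hasDerivAt_p Q (F.mem_Ioo ht')).hasDerivWithinAt (s := Icc 0 T)
    rw [dq, hX] at h1
    rw [hX] at h2
    exact ⟨h1, h2⟩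
  energy := fun t ht => by
    rw [F.energy_eq (F.infDist_frontier_le hQ) ⟨ht.1, ht.2.trans hT.2⟩, F.potential_eq Q hQ]
  start := by rwa [F.q_zero]
  arrive := rfl
  near := fun t ht => (F.infDist_q_mono hQ ht.1 ht.2 hT.2 hD).trans hδ

/-- Coercivity and energy `E` give `p 0 = 0` on `∂D` and `‖p‖ ≤ 1` in the collar. The cut-off is
thus invisible to the solution, and uniqueness for the Lipschitz field `X` applies. -/
theorem eq_flow_of_isCollarSolution {δ T : ℝ} {y : Conf n} {q p : ℝ → Conf n}
    (hδ : δ ≤ F.δ) (h : IsCollarSolution H D E δ y T q p) :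
    T ≤ F.τ ∧ EqOn q (F.q (q 0)) (Icc 0 T) ∧ EqOn p (F.p (q 0)) (Icc 0 T) := by
  have hδr : δ ≤ F.r := by linarith [F.δ_le, F.r_pos]
  have hRq : ∀ t ∈ Icc 0 T, ‖q t‖ ≤ F.R := fun t ht => by
    linarith [F.bounded _ ((h.near t ht).trans hδr)]
  have hV : ∀ t ∈ Icc 0 T, E - F.κ * F.τ ^ 2 / 8 ≤ H (q t, 0) := fun t ht => by
    have h1 := F.potential_ge (h.near t ht) hδr
    have h2 := mul_le_mul_of_nonneg_left hδ F.K_pos.le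
    linarith [F.δ_mul_K_le]
  have hR : ∀ t ∈ Icc 0 T, ‖(q t, p t)‖ ≤ F.R := fun t ht => by
    have h1 := F.coercive (q t) (p t) (hRq t ht)
    rw [h.energy t ht] at h1
    have h2 : F.κ * F.τ ^ 2 ≤ F.c * 1 := mul_le_mul (by linarith [F.κ_le, F.c_pos])
      (pow_le_one₀ F.τ_pos.le F.τ_lt_one.le) (sq_nonneg _) F.c_pos.le
    have h3 : F.c * ‖p t‖ ^ 2 ≤ F.c * 1 := by linarith [hV t ht, F.c_pos]
    have h4 : ‖p t‖ ≤ 1 := by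
      have := le_of_mul_le_mul_left h3 F.c_pos
      exact (sq_le_one_iff₀ (norm_nonneg _)).1 this
    rw [Prod.norm_def]
    exact max_le (hRq t ht) (by simp only; linarith [F.R_ge])
  have hT0 := h.pos
  have h0 : (0 : ℝ) ∈ Icc 0 T := ⟨le_rfl, hT0.le⟩
  have hp0 : p 0 = 0 := by
    have h1 := F.coercive (q 0) (p 0) (hRq 0 h0)
    rw [h.energy 0 h0, F.potential_eq _ h.start] at h1
    have h2 : F.c * ‖p 0‖ ^ 2 ≤ F.c * 0 := by linarith
    have h3 := le_of_mul_le_mul_left h2 F.c_pos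
    have h4 : ‖p 0‖ ^ 2 = 0 := le_antisymm h3 (sq_nonneg _)
    simpa using h4
  have hLip : LipschitzWith (Real.toNNReal F.K) F.X := LipschitzWith.of_dist_le_mul fun z w => by
    rw [Real.coe_toNNReal _ F.K_pos.le, dist_eq_norm, dist_eq_norm]
    exact F.X_lipschitz z w
  have hsol : ∀ t ∈ Icc 0 T, HasDerivWithinAt (fun t => (q t, p t)) (F.X (q t, p t)) (Icc 0 T) t :=
    fun t ht => by
      rw [F.X_eq _ (hR t ht)]
      exact (h.solution t ht).1.prodMk (h.solution t ht).2
  have huniq : ∀ b, b ≤ T → b ≤ F.τ → EqOn (fun t => (q t, p t)) (F.Φ (q 0, 0)) (Icc 0 b) := by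
    intro b hbT hbτ
    refine ODE_solution_unique (v := fun _ => F.X) (fun _ => hLip) (fun t ht => ?_)
      (fun t ht => ?_) (fun t ht => ?_) (fun t ht => ?_) ?_
    · exact ((hsol t ⟨ht.1, ht.2.trans hbT⟩).continuousWithinAt).mono (Icc_subset_Icc_right hbT)
    · exact (hsol t ⟨ht.1, ht.2.le.trans hbT⟩).mono_of_mem_nhdsWithin
        (Icc_mem_nhdsGE_of_mem ⟨ht.1, ht.2.trans_le hbT⟩)
    · exact (F.flow_deriv _ t (F.mem_Ioo ⟨ht.1, ht.2.trans hbτ⟩)).continuousAt.continuousWithinAt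
    · exact (F.flow_deriv _ t (F.mem_Ioo ⟨ht.1, ht.2.le.trans hbτ⟩)).hasDerivWithinAt
    · simp [F.flow_zero, hp0]
  -- A longer solution would agree with the flow up to time `τ`, where the potential is too low for
  -- a point of the collar.
  have hTτ : T ≤ F.τ := by
    by_contra hlt
    rw [not_le] at hlt
    have hτ : F.τ ∈ Icc 0 F.τ := ⟨F.τ_pos.le, le_rfl⟩
    have h1 : q F.τ = F.q (q 0) F.τ := congrArg Prod.fst (huniq F.τ hlt.le le_rfl hτ)
    have h2 := F.potential_q_le (F.infDist_frontier_le h.start) hτ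
    rw [← h1, F.potential_eq _ h.start] at h2
    have h3 := hV F.τ ⟨F.τ_pos.le, hlt.le⟩
    have : 0 < F.κ * F.τ ^ 2 := by have := F.κ_pos; have := F.τ_pos; positivity
    linarith
  have := huniq T le_rfl hTτ
  exact ⟨hTτ, fun t ht => congrArg Prod.fst (this ht), fun t ht => congrArg Prod.snd (this ht)⟩

theorem collarProperty {δ : ℝ} (hδ : δ ≤ F.δ) : CollarProperty H D E δ := by
  intro y hy hyδ
  obtain ⟨Q, hQ, T, hT, rfl⟩ := F.exists_q_eq hy (hyδ.trans hδ)
  refine ⟨T, F.q Q, F.p Q, F.isCollarSolution hQ hT hy hyδ, fun T' q' p' h => ?_⟩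
  obtain ⟨hT', hq', hp'⟩ := F.eq_flow_of_isCollarSolution hδ h
  have h1 : F.q (q' 0) T' = F.q Q T := by
    rw [← h.arrive]; exact (hq' ⟨h.pos.le, le_rfl⟩).symm
  obtain ⟨h2, h3⟩ := F.eq_of_q_eq h.start hQ ⟨h.pos.le, hT'⟩ ⟨hT.1.le, hT.2⟩ h1
  rw [h2, h3] at hq' hp'
  exact ⟨h3, hq', hp'⟩

end CollarFrame

theorem hasDerivAt_const_mul_cube (C x : ℝ) :
    HasDerivAt (fun t : ℝ => C * t ^ 3) (C * (3 * x ^ 2)) x := by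
  simpa using (hasDerivAt_pow 3 x).const_mul C

/-! ### The action of a trajectory and its first-order expansion. -/

namespace CollarFrame

variable {n : ℕ} {H : Conf n × Conf n → ℝ} {D : Set (Conf n)} {E : ℝ} (F : CollarFrame H D E)

/-- The action `∫ p dq` of the trajectory that starts at rest at `Q`. -/
def a (Q : Conf n) (t : ℝ) : ℝ := ∫ s in (0 : ℝ)..t, inner ℝ (F.p Q s) (F.dq Q s)

theorem a_zero (Q : Conf n) : F.a Q 0 = 0 := by rw [a, intervalIntegral.integral_same]

theorem continuous_X : Continuous F.X := by
  have hLip : LipschitzWith (Real.toNNReal F.K) F.X := LipschitzWith.of_dist_le_mul fun z w => by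
    rw [Real.coe_toNNReal _ F.K_pos.le, dist_eq_norm, dist_eq_norm]
    exact F.X_lipschitz z w
  exact hLip.continuous

theorem continuousOn_inner_p_dq (Q : Conf n) :
    ContinuousOn (fun s => inner ℝ (F.p Q s) (F.dq Q s)) (Ioo (-1) 1) := by
  have h1 : ContinuousOn (F.Φ (Q, 0)) (Ioo (-1) 1) := fun t ht =>
    (F.flow_deriv (Q, 0) t ht).continuousAt.continuousWithinAt
  have h2 : ContinuousOn (F.p Q) (Ioo (-1) 1) := continuous_snd.comp_continuousOn h1
  have h3 : ContinuousOn (F.dq Q) (Ioo (-1) 1) :=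
    (continuous_fst.comp F.continuous_X).comp_continuousOn h1
  exact h2.inner h3

theorem hasDerivAt_a (Q : Conf n) {t : ℝ} (ht : t ∈ Icc 0 F.τ) :
    HasDerivAt (F.a Q) (inner ℝ (F.p Q t) (F.dq Q t)) t := by
  have hc := F.continuousOn_inner_p_dq Q
  have ht' := F.mem_Ioo ht
  refine intervalIntegral.integral_hasDerivAt_right
    (ContinuousOn.intervalIntegrable (hc.mono fun x hx => ?_))
    (hc.stronglyMeasurableAtFilter isOpen_Ioo t ht') (hc.continuousAt (isOpen_Ioo.mem_nhds ht'))
  rw [uIcc_of_le ht.1] at hx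
  exact F.mem_Ioo ⟨hx.1, hx.2.trans ht.2⟩

theorem a_sub_ge {Q : Conf n} (hQ : Q ∈ frontier D) {s t : ℝ} (hs : 0 ≤ s) (hst : s ≤ t)
    (ht : t ≤ F.τ) : 2 * F.κ / 3 * (t ^ 3 - s ^ 3) ≤ F.a Q t - F.a Q s := by
  have := sub_le_sub_of_le_hasDerivAt (f := F.a Q) (B := fun t => 2 * F.κ / 3 * t ^ 3) hst
    (fun x hx => F.hasDerivAt_a Q ⟨hs.trans hx.1, hx.2.trans ht⟩)
    (hasDerivAt_const_mul_cube _) (fun x hx => by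
      have := F.inner_p_dq_ge (F.infDist_frontier_le hQ) ⟨hs.trans hx.1, hx.2.trans ht⟩
      linarith)
  linarith

theorem abs_a_sub_le (Q : Conf n) {s t : ℝ} (hs : 0 ≤ s) (hst : s ≤ t)
    (ht : t ≤ F.τ) : |F.a Q t - F.a Q s| ≤ F.K ^ 3 / 3 * (t ^ 3 - s ^ 3) := by
  have := norm_sub_le_of_hasDerivAt_le (f := F.a Q) (B := fun t => F.K ^ 3 / 3 * t ^ 3) hst
    (fun x hx => F.hasDerivAt_a Q ⟨hs.trans hx.1, hx.2.trans ht⟩)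
    (hasDerivAt_const_mul_cube _) (fun x hx => by
      have hx' : x ∈ Icc 0 F.τ := ⟨hs.trans hx.1, hx.2.trans ht⟩
      have h1 := norm_inner_le_norm (𝕜 := ℝ) (F.p Q x) (F.dq Q x)
      have h2 := mul_le_mul (F.norm_p_le Q hx') (F.norm_dq_le Q hx') (norm_nonneg _)
        (mul_nonneg F.K_pos.le hx'.1)
      linarith)
  rw [Real.norm_eq_abs] at this
  linarith

theorem a_le (Q : Conf n) {t : ℝ} (ht : t ∈ Icc 0 F.τ) : F.a Q t ≤ F.K ^ 3 / 3 * t ^ 3 := by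
  have := le_of_abs_le (F.abs_a_sub_le Q le_rfl ht.1 ht.2)
  simpa [F.a_zero] using this

theorem a_ge {Q : Conf n} (hQ : Q ∈ frontier D) {t : ℝ} (ht : t ∈ Icc 0 F.τ) :
    2 * F.κ / 3 * t ^ 3 ≤ F.a Q t := by
  have := F.a_sub_ge hQ le_rfl ht.1 ht.2
  simpa [F.a_zero] using this

theorem a_nonneg {Q : Conf n} (hQ : Q ∈ frontier D) {t : ℝ} (ht : t ∈ Icc 0 F.τ) :
    0 ≤ F.a Q t := by
  have h1 := F.a_ge hQ ht
  have h2 : 0 ≤ 2 * F.κ / 3 * t ^ 3 := by have := F.κ_pos; have := ht.1; positivity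
  linarith

theorem a_strictMonoOn {Q : Conf n} (hQ : Q ∈ frontier D) : StrictMonoOn (F.a Q) (Icc 0 F.τ) := by
  intro s hs t ht hst
  have h1 := F.a_sub_ge hQ hs.1 hst.le ht.2
  have h2 : s ^ 3 < t ^ 3 := pow_lt_pow_left₀ hst hs.1 (by norm_num)
  have := mul_pos (by have := F.κ_pos; positivity : 0 < 2 * F.κ / 3) (sub_pos.2 h2)
  linarith

theorem norm_p_sub_le (Q : Conf n) {s t : ℝ} (hs : 0 ≤ s) (hst : s ≤ t) (ht : t ≤ F.τ) :
    ‖F.p Q t - F.p Q s‖ ≤ F.K * (t - s) :=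
  (norm_snd_le _).trans (F.norm_flow_sub_le (Q, 0) hs hst ht)

theorem norm_p_diff_le (Q₁ Q₂ : Conf n) {t : ℝ} (ht : t ∈ Icc 0 F.τ) :
    ‖F.p Q₁ t - F.p Q₂ t‖ ≤ F.K * ‖Q₁ - Q₂‖ :=
  (norm_snd_le _).trans (F.norm_flow_diff_le Q₁ Q₂ ht)

theorem abs_a_diff_le (Q₁ Q₂ : Conf n) {t : ℝ} (ht : t ∈ Icc 0 F.τ) :
    |F.a Q₁ t - F.a Q₂ t| ≤ 2 * F.K ^ 3 * ‖Q₁ - Q₂‖ := by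
  have hK := F.K_pos
  have := norm_sub_le_of_hasDerivAt_le (f := fun t => F.a Q₁ t - F.a Q₂ t)
    (B := fun t => 2 * F.K ^ 3 * ‖Q₁ - Q₂‖ * t) ht.1
    (fun x hx => (F.hasDerivAt_a Q₁ ⟨hx.1, hx.2.trans ht.2⟩).sub
      (F.hasDerivAt_a Q₂ ⟨hx.1, hx.2.trans ht.2⟩))
    (hasDerivAt_const_mul_id _) (fun x hx => by
      have hx' : x ∈ Icc 0 F.τ := ⟨hx.1, hx.2.trans ht.2⟩
      have hx1 : x ≤ 1 := hx'.2.trans F.τ_lt_one.le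
      have e0 := norm_nonneg (Q₁ - Q₂)
      have h1 : inner ℝ (F.p Q₁ x) (F.dq Q₁ x) - inner ℝ (F.p Q₂ x) (F.dq Q₂ x)
          = inner ℝ (F.p Q₁ x) (F.dq Q₁ x - F.dq Q₂ x)
            + inner ℝ (F.p Q₁ x - F.p Q₂ x) (F.dq Q₂ x) := by
        rw [inner_sub_right, inner_sub_left]; ring
      rw [h1]
      have h2 := (norm_inner_le_norm (𝕜 := ℝ) (F.p Q₁ x) (F.dq Q₁ x - F.dq Q₂ x)).trans
        (mul_le_mul (F.norm_p_le Q₁ hx') (F.norm_dq_diff_le Q₁ Q₂ hx') (norm_nonneg _)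
          (mul_nonneg hK.le hx'.1))
      have h3 := (norm_inner_le_norm (𝕜 := ℝ) (F.p Q₁ x - F.p Q₂ x) (F.dq Q₂ x)).trans
        (mul_le_mul (F.norm_p_diff_le Q₁ Q₂ hx') (F.norm_dq_le Q₂ hx') (norm_nonneg _)
          (mul_nonneg hK.le e0))
      have h4 := norm_add_le (inner ℝ (F.p Q₁ x) (F.dq Q₁ x - F.dq Q₂ x))
        (inner ℝ (F.p Q₁ x - F.p Q₂ x) (F.dq Q₂ x))
      have h5 : F.K ^ 3 * ‖Q₁ - Q₂‖ * x ≤ F.K ^ 3 * ‖Q₁ - Q₂‖ * 1 :=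
        mul_le_mul_of_nonneg_left hx1 (by positivity)
      linarith)
  simp only [F.a_zero, sub_zero, mul_zero, Real.norm_eq_abs] at this
  have h5 : 2 * F.K ^ 3 * ‖Q₁ - Q₂‖ * t ≤ 2 * F.K ^ 3 * ‖Q₁ - Q₂‖ * 1 :=
    mul_le_mul_of_nonneg_left (ht.2.trans F.τ_lt_one.le) (by positivity)
  linarith

/-- `inverse_lipschitz` controls `T²` and not `T`, so the action has to be Lipschitz in `T²`. -/
theorem abs_a_sub_le_sq (Q : Conf n) {s t : ℝ} (hs : s ∈ Icc 0 F.τ) (ht : t ∈ Icc 0 F.τ) :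
    |F.a Q t - F.a Q s| ≤ F.K ^ 3 * |t ^ 2 - s ^ 2| := by
  wlog hst : s ≤ t generalizing s t
  · rw [abs_sub_comm, abs_sub_comm (t ^ 2)]
    exact this ht hs (le_of_not_ge hst)
  refine (F.abs_a_sub_le Q hs.1 hst ht.2).trans ?_
  rw [abs_of_nonneg (sub_nonneg.2 (pow_le_pow_left₀ hs.1 hst 2))]
  have h1 : t ^ 3 - s ^ 3 ≤ 3 * (t ^ 2 - s ^ 2) := by
    have ht1 : t ≤ 1 := ht.2.trans F.τ_lt_one.le
    have h2 : t ^ 2 + t * s + s ^ 2 ≤ 3 * (t + s) := by nlinarith [hs.1, ht.1]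
    have := mul_le_mul_of_nonneg_left h2 (sub_nonneg.2 hst)
    nlinarith
  have := mul_le_mul_of_nonneg_left h1 (by have := F.K_pos; positivity : 0 ≤ F.K ^ 3 / 3)
  linarith

theorem abs_a_sub_a_le {Q₁ Q₂ : Conf n} (h₁ : Q₁ ∈ frontier D) (h₂ : Q₂ ∈ frontier D)
    {T₁ T₂ : ℝ} (hT₁ : T₁ ∈ Icc 0 F.τ) (hT₂ : T₂ ∈ Icc 0 F.τ) :
    |F.a Q₁ T₁ - F.a Q₂ T₂| ≤ 3 * F.K ^ 3 * F.A * ‖F.q Q₁ T₁ - F.q Q₂ T₂‖ := by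
  obtain ⟨h3, h4⟩ := F.inverse_lipschitz h₁ h₂ hT₁ hT₂
  have h5 := F.abs_a_diff_le Q₁ Q₂ hT₁
  have h6 := F.abs_a_sub_le_sq Q₂ hT₂ hT₁
  have hK3 : 0 ≤ F.K ^ 3 := by have := F.K_pos; positivity
  have h7 := mul_le_mul_of_nonneg_left h3 hK3
  have h8 := mul_le_mul_of_nonneg_left h4 hK3
  have h9 := abs_sub_le (F.a Q₁ T₁) (F.a Q₂ T₁) (F.a Q₂ T₂)
  linarith

/-- The time derivative of the left side is the linear part of `H` between two points of equal
energy plus a product of two differences, hence of second order in `Q₁ - Q₂`. The boundary term at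
time `0` vanishes because `p = 0` there. The flow itself is only used through its Lipschitz
constant. -/
theorem a_taylor_fixed_time {Q₁ Q₂ : Conf n} (h₁ : Q₁ ∈ frontier D) (h₂ : Q₂ ∈ frontier D)
    {t : ℝ} (ht : t ∈ Icc 0 F.τ) :
    |F.a Q₂ t - F.a Q₁ t - inner ℝ (F.p Q₁ t) (F.q Q₂ t - F.q Q₁ t)|
      ≤ 2 * F.K ^ 3 * ‖Q₁ - Q₂‖ ^ 2 := by
  have hK := F.K_pos
  have := norm_sub_le_of_hasDerivAt_le
    (f := fun t => F.a Q₂ t - F.a Q₁ t - inner ℝ (F.p Q₁ t) (F.q Q₂ t - F.q Q₁ t))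
    (B := fun t => 2 * F.K ^ 3 * ‖Q₁ - Q₂‖ ^ 2 * t) ht.1
    (fun x hx => by
      have hx' : x ∈ Icc 0 F.τ := ⟨hx.1, hx.2.trans ht.2⟩
      have hx2 := F.mem_Ioo hx'
      exact ((F.hasDerivAt_a Q₂ hx').sub (F.hasDerivAt_a Q₁ hx')).sub
        ((F.hasDerivAt_p Q₁ hx2).inner ℝ ((F.hasDerivAt_q Q₂ hx2).sub (F.hasDerivAt_q Q₁ hx2))))
    (hasDerivAt_const_mul_id _) (fun x hx => by
      have hx' : x ∈ Icc 0 F.τ := ⟨hx.1, hx.2.trans ht.2⟩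
      have hi₁ := F.infDist_frontier_le h₁
      have hi₂ := F.infDist_frontier_le h₂
      have h3 := F.taylor (F.Φ (Q₁, 0) x) (F.Φ (Q₂, 0) x) (F.norm_flow_le hi₁ hx')
        (F.norm_flow_le hi₂ hx')
      have h4 : H (F.Φ (Q₂, 0) x) = H (F.Φ (Q₁, 0) x) := by
        have e1 := F.energy_eq hi₁ hx'
        have e2 := F.energy_eq hi₂ hx'
        rw [F.potential_eq _ h₁] at e1
        rw [F.potential_eq _ h₂] at e2
        exact e2.trans e1.symm
      have hX := F.X_eq _ (F.norm_flow_le hi₁ hx')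
      have h5 : gradP H (F.Φ (Q₁, 0) x) = F.dq Q₁ x := by rw [dq, hX]
      rw [h4, sub_self, zero_sub, abs_neg, h5] at h3
      change |inner ℝ (gradQ H (F.Φ (Q₁, 0) x)) (F.q Q₂ x - F.q Q₁ x)
        + inner ℝ (F.dq Q₁ x) (F.p Q₂ x - F.p Q₁ x)| ≤ _ at h3
      rw [hX]
      have h6 : inner ℝ (F.p Q₂ x) (F.dq Q₂ x) - inner ℝ (F.p Q₁ x) (F.dq Q₁ x)
          - (inner ℝ (F.p Q₁ x) (F.dq Q₂ x - F.dq Q₁ x)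
            + inner ℝ (-gradQ H (F.Φ (Q₁, 0) x)) (F.q Q₂ x - F.q Q₁ x))
          = (inner ℝ (gradQ H (F.Φ (Q₁, 0) x)) (F.q Q₂ x - F.q Q₁ x)
            + inner ℝ (F.dq Q₁ x) (F.p Q₂ x - F.p Q₁ x))
            + inner ℝ (F.p Q₂ x - F.p Q₁ x) (F.dq Q₂ x - F.dq Q₁ x) := by
        rw [real_inner_comm (F.p Q₂ x - F.p Q₁ x) (F.dq Q₁ x), inner_neg_left]
        simp only [inner_sub_left, inner_sub_right]
        ring
      simp only
      rw [h6]
      have h7 := F.norm_flow_diff_le Q₂ Q₁ hx'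
      have h8 := pow_le_pow_left₀ (norm_nonneg _) h7 2
      have h9 := (norm_inner_le_norm (𝕜 := ℝ) (F.p Q₂ x - F.p Q₁ x) (F.dq Q₂ x - F.dq Q₁ x)).trans
        (mul_le_mul (F.norm_p_diff_le Q₂ Q₁ hx') (F.norm_dq_diff_le Q₂ Q₁ hx') (norm_nonneg _)
          (by positivity))
      refine (norm_add_le _ _).trans ?_
      rw [Real.norm_eq_abs, norm_sub_rev Q₁]
      have h10 := mul_le_mul_of_nonneg_left h8 hK.le
      linarith)
  simp only [F.a_zero, F.p_zero, inner_zero_left, sub_zero, mul_zero, Real.norm_eq_abs] at this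
  have h5 : 2 * F.K ^ 3 * ‖Q₁ - Q₂‖ ^ 2 * t ≤ 2 * F.K ^ 3 * ‖Q₁ - Q₂‖ ^ 2 * 1 :=
    mul_le_mul_of_nonneg_left (ht.2.trans F.τ_lt_one.le) (by positivity)
  linarith

/-- The left side integrates `⟨p Q₂ t - p Q₁ T₁, q'⟩`, whose first factor is small by Lipschitz
continuity. -/
theorem a_taylor_fixed_start {Q₁ Q₂ : Conf n}
    {T₁ T₂ : ℝ} (hT₁ : T₁ ∈ Icc 0 F.τ) (hT₂ : T₂ ∈ Icc 0 F.τ) :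
    |F.a Q₂ T₂ - F.a Q₂ T₁ - inner ℝ (F.p Q₁ T₁) (F.q Q₂ T₂ - F.q Q₂ T₁)|
      ≤ F.K ^ 2 * (|T₂ - T₁| + ‖Q₁ - Q₂‖) * |T₂ - T₁| := by
  have hsub : ∀ x ∈ uIcc T₁ T₂, x ∈ Icc 0 F.τ := fun x hx =>
    (ordConnected_Icc.uIcc_subset hT₁ hT₂) hx
  have hK := F.K_pos
  have := (convex_uIcc T₁ T₂).norm_image_sub_le_of_norm_hasDerivWithin_le
    (f := fun t => F.a Q₂ t - inner ℝ (F.p Q₁ T₁) (F.q Q₂ t))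
    (f' := fun t => inner ℝ (F.p Q₂ t) (F.dq Q₂ t) - inner ℝ (F.p Q₁ T₁) (F.dq Q₂ t))
    (C := F.K ^ 2 * (|T₂ - T₁| + ‖Q₁ - Q₂‖))
    (fun x hx => by
      have h1 := (hasDerivAt_const x (F.p Q₁ T₁)).inner ℝ
        (F.hasDerivAt_q Q₂ (F.mem_Ioo (hsub x hx)))
      rw [inner_zero_left, add_zero] at h1
      exact ((F.hasDerivAt_a Q₂ (hsub x hx)).sub h1).hasDerivWithinAt)
    (fun x hx => by
      rw [← inner_sub_left]
      have h1 : ‖F.p Q₂ x - F.p Q₁ T₁‖ ≤ F.K * (|T₂ - T₁| + ‖Q₁ - Q₂‖) := by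
        have h2 := F.norm_p_diff_le Q₂ Q₁ hT₁
        rw [norm_sub_rev Q₂] at h2
        have h3 : ‖F.p Q₂ x - F.p Q₂ T₁‖ ≤ F.K * |T₂ - T₁| := by
          have h4 : |x - T₁| ≤ |T₂ - T₁| := abs_sub_left_of_mem_uIcc hx
          refine le_trans ?_ (mul_le_mul_of_nonneg_left h4 hK.le)
          rcases le_total T₁ x with h | h
          · rw [abs_of_nonneg (sub_nonneg.2 h)]
            exact F.norm_p_sub_le Q₂ hT₁.1 h (hsub x hx).2
          · rw [norm_sub_rev, abs_sub_comm, abs_of_nonneg (sub_nonneg.2 h)]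
            exact F.norm_p_sub_le Q₂ (hsub x hx).1 h hT₁.2
        have h5 := norm_sub_le_norm_sub_add_norm_sub (F.p Q₂ x) (F.p Q₂ T₁) (F.p Q₁ T₁)
        linarith
      have h6 : ‖F.dq Q₂ x‖ ≤ F.K := (norm_fst_le _).trans (F.X_bound _)
      refine (norm_inner_le_norm _ _).trans ((mul_le_mul h1 h6 (norm_nonneg _)
        (by positivity)).trans (le_of_eq ?_))
      ring)
    left_mem_uIcc right_mem_uIcc
  rw [Real.norm_eq_abs, Real.norm_eq_abs] at this
  rw [inner_sub_right]
  convert this using 2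
  ring

/-- The action has the momentum as its gradient with respect to the end point. -/
theorem exists_a_taylor {Q₁ : Conf n} (h₁ : Q₁ ∈ frontier D) {T₁ : ℝ} (hT₁ : T₁ ∈ Ioc 0 F.τ) :
    ∃ C : ℝ, ∀ Q₂ ∈ frontier D, ∀ T₂ ∈ Icc 0 F.τ,
      |F.a Q₂ T₂ - F.a Q₁ T₁ - inner ℝ (F.p Q₁ T₁) (F.q Q₂ T₂ - F.q Q₁ T₁)|
        ≤ C * ‖F.q Q₂ T₂ - F.q Q₁ T₁‖ ^ 2 := by
  have hK := F.K_pos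
  have hA := F.A_pos
  have hT0 := hT₁.1
  have hT₁' : T₁ ∈ Icc 0 F.τ := ⟨hT₁.1.le, hT₁.2⟩
  refine ⟨2 * F.K ^ 3 * F.A ^ 2 + F.K ^ 2 * (F.A / T₁ + F.A) * (F.A / T₁),
    fun Q₂ h₂ T₂ hT₂ => ?_⟩
  set d := ‖F.q Q₂ T₂ - F.q Q₁ T₁‖ with hd
  have hd0 : 0 ≤ d := norm_nonneg _
  obtain ⟨h3, h4⟩ := F.inverse_lipschitz h₁ h₂ hT₁' hT₂
  rw [norm_sub_rev (F.q Q₁ T₁), ← hd] at h3 h4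
  -- Passing from `T²` to `T` divides by `T₁ + T₂ ≥ T₁`; the constant therefore degenerates at the
  -- boundary, which is harmless for differentiability inside `D`.
  have h5 : |T₂ - T₁| ≤ F.A / T₁ * d := by
    rw [div_mul_eq_mul_div, le_div_iff₀ hT0]
    refine le_trans ?_ h4
    have h6 : T₁ ^ 2 - T₂ ^ 2 = -((T₂ - T₁) * (T₂ + T₁)) := by ring
    rw [h6, abs_neg, abs_mul, abs_of_nonneg (by linarith [hT₂.1] : 0 ≤ T₂ + T₁)]
    exact mul_le_mul_of_nonneg_left (by linarith [hT₂.1]) (abs_nonneg _)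
  have h6 := F.a_taylor_fixed_time h₁ h₂ hT₁'
  have h7 := F.a_taylor_fixed_start (Q₁ := Q₁) (Q₂ := Q₂) hT₁' hT₂
  have h8 : ‖Q₁ - Q₂‖ ^ 2 ≤ (F.A * d) ^ 2 := pow_le_pow_left₀ (norm_nonneg _) h3 2
  have h9 : F.K ^ 2 * (|T₂ - T₁| + ‖Q₁ - Q₂‖) * |T₂ - T₁| ≤
      F.K ^ 2 * (F.A / T₁ * d + F.A * d) * (F.A / T₁ * d) := by
    gcongr
  have h10 : F.a Q₂ T₂ - F.a Q₁ T₁ - inner ℝ (F.p Q₁ T₁) (F.q Q₂ T₂ - F.q Q₁ T₁)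
      = (F.a Q₂ T₁ - F.a Q₁ T₁ - inner ℝ (F.p Q₁ T₁) (F.q Q₂ T₁ - F.q Q₁ T₁))
        + (F.a Q₂ T₂ - F.a Q₂ T₁ - inner ℝ (F.p Q₁ T₁) (F.q Q₂ T₂ - F.q Q₂ T₁)) := by
    simp only [inner_sub_right]; ring
  rw [h10]
  refine (abs_add_le _ _).trans ?_
  have h11 := mul_le_mul_of_nonneg_left h8 (by positivity : 0 ≤ 2 * F.K ^ 3)
  calc _ ≤ _ := add_le_add (h6.trans h11) (h7.trans h9)
    _ = _ := by ring

/-! ### The truncated action `S` as a solution of `H(y, dS) = E`. -/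

/-- Starting point and duration of the trajectory from the boundary to `y`. -/
def coords (y : Conf n) : Conf n × ℝ :=
  Classical.epsilon fun z => z.1 ∈ frontier D ∧ z.2 ∈ Icc 0 F.τ ∧ F.q z.1 z.2 = y

theorem coords_spec {y : Conf n} (hy : y ∈ closure D)
    (hyδ : Metric.infDist y (frontier D) ≤ F.δ) :
    (F.coords y).1 ∈ frontier D ∧ (F.coords y).2 ∈ Icc 0 F.τ ∧
      F.q (F.coords y).1 (F.coords y).2 = y := by
  have hex : ∃ z : Conf n × ℝ, z.1 ∈ frontier D ∧ z.2 ∈ Icc 0 F.τ ∧ F.q z.1 z.2 = y := by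
    by_cases h : y ∈ D
    · obtain ⟨Q, hQ, T, hT, h⟩ := F.exists_q_eq h hyδ
      exact ⟨(Q, T), hQ, ⟨hT.1.le, hT.2⟩, h⟩
    · exact ⟨(y, 0), ⟨hy, fun h' => h (interior_subset h')⟩, ⟨le_rfl, F.τ_pos.le⟩, F.q_zero y⟩
  exact Classical.epsilon_spec hex

theorem coords_q {Q : Conf n} (hQ : Q ∈ frontier D) {T : ℝ} (hT : T ∈ Icc 0 F.τ)
    (h : F.q Q T ∈ closure D) (hδ : Metric.infDist (F.q Q T) (frontier D) ≤ F.δ) :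
    F.coords (F.q Q T) = (Q, T) := by
  obtain ⟨h1, h2, h3⟩ := F.coords_spec h hδ
  obtain ⟨h4, h5⟩ := F.eq_of_q_eq h1 hQ h2 hT h3
  exact Prod.ext h4 h5

/-- A value of the action that is only reached at distance less than `δ / 2`. -/
def w : ℝ := 2 * F.κ / 3 * (Real.sqrt F.δ / F.K) ^ 3

theorem w_pos : 0 < F.w := by
  have := F.κ_pos; have := Real.sqrt_pos.2 F.δ_pos; have := F.K_pos
  rw [w]; positivity

/-- The action as a function of the end point, truncated outside the collar. -/
def S (y : Conf n) : ℝ :=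
  if Metric.infDist y (frontier D) ≤ F.δ then min (F.a (F.coords y).1 (F.coords y).2) F.w else F.w

theorem S_le (y : Conf n) : F.S y ≤ F.w := by
  rw [S]; split_ifs
  · exact min_le_right _ _
  · exact le_rfl

theorem S_nonneg {y : Conf n} (hy : y ∈ closure D) : 0 ≤ F.S y := by
  rw [S]; split_ifs with h
  · obtain ⟨h1, h2, -⟩ := F.coords_spec hy h
    exact le_min (F.a_nonneg h1 h2) F.w_pos.le
  · exact F.w_pos.le

/-- The action is at least `(2κ/3) T³`, so a value below `w` forces `T < √δ/K`, and the trajectory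
has moved at most `K²T²/2 < δ/2`. -/
theorem infDist_lt_of_a_lt {Q : Conf n} (hQ : Q ∈ frontier D) {T : ℝ} (hT : T ∈ Icc 0 F.τ)
    (h : F.a Q T < F.w) : Metric.infDist (F.q Q T) (frontier D) < F.δ / 2 := by
  have hK := F.K_pos
  have h1 := F.a_ge hQ hT
  rw [w] at h
  have h2 : T ^ 3 < (Real.sqrt F.δ / F.K) ^ 3 :=
    lt_of_mul_lt_mul_left (h1.trans_lt h) (by have := F.κ_pos; positivity)
  have h3 : T < Real.sqrt F.δ / F.K := lt_of_pow_lt_pow_left₀ 3 (by positivity) h2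
  have h4 : T ^ 2 < (Real.sqrt F.δ / F.K) ^ 2 := pow_lt_pow_left₀ h3 hT.1 (by norm_num)
  rw [div_pow, Real.sq_sqrt F.δ_pos.le, lt_div_iff₀ (by positivity)] at h4
  have h5 := F.norm_q_sub_self_le Q hT
  have h6 := Metric.infDist_le_dist_of_mem (x := F.q Q T) hQ
  rw [dist_eq_norm] at h6
  linarith

theorem of_S_lt {y : Conf n} (hy : y ∈ closure D) (h : F.S y < F.w) :
    Metric.infDist y (frontier D) < F.δ / 2 ∧ F.S y = F.a (F.coords y).1 (F.coords y).2 ∧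
      (F.coords y).1 ∈ frontier D ∧ (F.coords y).2 ∈ Icc 0 F.τ ∧
      F.q (F.coords y).1 (F.coords y).2 = y := by
  have hd : Metric.infDist y (frontier D) ≤ F.δ := by
    by_contra hd
    rw [S, if_neg hd] at h
    exact lt_irrefl _ h
  obtain ⟨h1, h2, h3⟩ := F.coords_spec hy hd
  have hS : F.S y = min (F.a (F.coords y).1 (F.coords y).2) F.w := by rw [S, if_pos hd]
  rw [hS] at h ⊢
  have h4 : F.a (F.coords y).1 (F.coords y).2 < F.w := by
    rcases min_lt_iff.1 h with h | h
    · exact h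
    · exact absurd h (lt_irrefl _)
  have h5 := F.infDist_lt_of_a_lt h1 h2 h4
  rw [h3] at h5
  exact ⟨h5, min_eq_left h4.le, h1, h2, h3⟩

theorem S_frontier {y : Conf n} (hy : y ∈ frontier D) : F.S y = 0 := by
  have hd : Metric.infDist y (frontier D) ≤ F.δ := by
    rw [Metric.infDist_zero_of_mem hy]; exact F.δ_pos.le
  have h0 : (0 : ℝ) ∈ Icc 0 F.τ := ⟨le_rfl, F.τ_pos.le⟩
  have h1 := F.coords_q hy h0 (by rw [F.q_zero]; exact frontier_subset_closure hy)
    (by rwa [F.q_zero])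
  rw [F.q_zero] at h1
  rw [S, if_pos hd, h1, F.a_zero]
  exact min_eq_left F.w_pos.le

/-- Lipschitz continuity up to `∂D` makes `S` absolutely continuous along admissible curves. If `S x
< w` and `y` lies outside the collar, the points are at least `δ/2` apart, so a difference of at
most `w` is affordable. -/
theorem exists_lipschitzOnWith_S : ∃ C, LipschitzOnWith C F.S (closure D) := by
  have hK := F.K_pos
  have hA := F.A_pos
  have hw := F.w_pos
  have hδ := F.δ_pos
  set B := 3 * F.K ^ 3 * F.A + 2 * F.w / F.δ with hB
  have hB0 : 0 ≤ B := by positivity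
  refine ⟨B.toNNReal, LipschitzOnWith.of_dist_le_mul fun x hx y hy => ?_⟩
  rw [Real.coe_toNNReal _ hB0, Real.dist_eq]
  wlog hxy : F.S x ≤ F.S y generalizing x y
  · rw [abs_sub_comm, dist_comm]
    exact this y hy x hx (le_of_not_ge hxy)
  rcases (F.S_le x).eq_or_lt with h | h
  · rw [le_antisymm hxy (h ▸ F.S_le y), sub_self, abs_zero]; positivity
  obtain ⟨h1, h2, h3, h4, h5⟩ := F.of_S_lt hx h
  rw [abs_sub_comm, abs_of_nonneg (sub_nonneg.2 hxy)]
  by_cases hd : Metric.infDist y (frontier D) ≤ F.δ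
  · obtain ⟨h6, h7, h8⟩ := F.coords_spec hy hd
    have h9 : F.S y ≤ F.a (F.coords y).1 (F.coords y).2 := by
      rw [S, if_pos hd]; exact min_le_left _ _
    have h10 := le_of_abs_le (F.abs_a_sub_a_le h6 h3 h7 h4)
    rw [h5, h8, ← dist_eq_norm, dist_comm] at h10
    have h11 : 3 * F.K ^ 3 * F.A * dist x y ≤ B * dist x y :=
      mul_le_mul_of_nonneg_right (by rw [hB]; linarith [div_pos (mul_pos two_pos hw) hδ])
        dist_nonneg
    linarith
  · rw [not_le] at hd
    have h6 := Metric.infDist_le_infDist_add_dist (s := frontier D) (x := y) (y := x)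
    rw [dist_comm] at h6
    have h7 : 2 * F.w / F.δ * dist x y ≤ B * dist x y :=
      mul_le_mul_of_nonneg_right (by rw [hB]; linarith [mul_pos (pow_pos hK 3) hA]) dist_nonneg
    have h8 : F.w ≤ 2 * F.w / F.δ * dist x y := by
      rw [div_mul_eq_mul_div, le_div_iff₀ hδ]
      nlinarith
    linarith [F.S_le y, F.S_nonneg hx]

/-- The momentum at `y` of the trajectory from the boundary to `y`. -/
def P (y : Conf n) : Conf n := F.p (F.coords y).1 (F.coords y).2

theorem coords_snd_pos {y : Conf n} (hy : y ∈ D) (h : F.S y < F.w) : 0 < (F.coords y).2 := by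
  obtain ⟨-, -, h3, h4, h5⟩ := F.of_S_lt (subset_closure hy) h
  refine lt_of_le_of_ne h4.1 fun h0 => ?_
  rw [← h0, F.q_zero] at h5
  rw [h5] at h3
  exact (F.isOpen.inter_frontier_eq ▸ (⟨hy, h3⟩ : y ∈ D ∩ frontier D) : y ∈ (∅ : Set (Conf n)))

/-- Continuity keeps nearby points below the truncation level, where `exists_a_taylor` is a
quadratic error estimate. -/
theorem hasFDerivAt_S {y : Conf n} (hy : y ∈ D) (h : F.S y < F.w) :
    HasFDerivAt F.S (innerSL ℝ (F.P y)) y := by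
  obtain ⟨-, h2, h3, h4, h5⟩ := F.of_S_lt (subset_closure hy) h
  obtain ⟨C, hC⟩ := F.exists_a_taylor h3 ⟨F.coords_snd_pos hy h, h4.2⟩
  obtain ⟨B, hB⟩ := F.exists_lipschitzOnWith_S
  have hDnhds : D ∈ 𝓝 y := F.isOpen.mem_nhds hy
  have hcont : ContinuousAt F.S y :=
    (hB.continuousOn.mono subset_closure).continuousAt hDnhds
  rw [hasFDerivAt_iff_isLittleO]
  have h6 : (fun x => F.S x - F.S y - innerSL ℝ (F.P y) (x - y)) =O[𝓝 y]
      fun x => ‖x - y‖ ^ 2 := by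
    refine Asymptotics.IsBigO.of_bound C ?_
    filter_upwards [hDnhds, hcont.eventually_lt continuousAt_const h] with x hx hxS
    obtain ⟨-, h7, h8, h9, h10⟩ := F.of_S_lt (subset_closure hx) hxS
    have h11 := hC _ h8 _ h9
    rw [h5, h10] at h11
    rw [h2, h7, innerSL_apply_apply, Real.norm_eq_abs, Real.norm_of_nonneg (sq_nonneg _)]
    exact h11
  exact h6.trans_isLittleO (Asymptotics.isLittleO_pow_sub_sub y (by norm_num))

theorem energy_P {y : Conf n} (hy : y ∈ D) (h : F.S y < F.w) : H (y, F.P y) = E := by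
  obtain ⟨-, -, h3, h4, h5⟩ := F.of_S_lt (subset_closure hy) h
  have h6 := F.energy_eq (F.infDist_frontier_le h3) h4
  rwa [h5, F.potential_eq _ h3] at h6

/-- Distance to the boundary below which the truncation of the action is not effective. -/
def δ' : ℝ := min F.δ (F.κ * F.w / (8 * F.K ^ 4))

theorem δ'_pos : 0 < F.δ' := by
  have := F.κ_pos; have := F.w_pos; have := F.K_pos
  exact lt_min F.δ_pos (by positivity)

theorem δ'_le : F.δ' ≤ F.δ := min_le_left _ _

theorem S_pos {y : Conf n} (hy : y ∈ D) : 0 < F.S y := by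
  rcases (F.S_le y).eq_or_lt with h | h
  · rw [h]; exact F.w_pos
  obtain ⟨-, h2, h3, h4, -⟩ := F.of_S_lt (subset_closure hy) h
  rw [h2]
  refine lt_of_lt_of_le ?_ (F.a_ge h3 h4)
  have := F.coords_snd_pos hy h
  have := F.κ_pos
  positivity

/-- Near `∂D` the potential is close to `E`; by `potential_q_le` the duration is then short, and so
the action is small. -/
theorem S_lt {y : Conf n} (hy : y ∈ D) (hd : Metric.infDist y (frontier D) ≤ F.δ') :
    F.S y < F.w := by
  have hK := F.K_pos
  obtain ⟨h1, h2, h3⟩ := F.coords_spec (subset_closure hy) (hd.trans F.δ'_le)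
  rw [S, if_pos (hd.trans F.δ'_le)]
  refine (min_le_left _ _).trans_lt ?_
  have h4 := F.a_le (F.coords y).1 h2
  have h5 := F.potential_q_le (F.infDist_frontier_le h1) h2
  rw [h3, F.potential_eq _ h1] at h5
  have h6 := F.potential_ge hd (F.δ'_le.trans (by linarith [F.δ_le, F.r_pos]))
  set T := (F.coords y).2
  have h7 : F.κ * T ^ 2 ≤ 8 * F.K * F.δ' := by linarith
  have h8 : F.δ' ≤ F.κ * F.w / (8 * F.K ^ 4) := min_le_right _ _
  rw [le_div_iff₀ (by positivity)] at h8
  have h9 : T ^ 3 ≤ T ^ 2 := pow_le_pow_of_le_one h2.1 (h2.2.trans F.τ_lt_one.le) (by norm_num)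
  have h10 : F.κ * (F.K ^ 3 * T ^ 2) ≤ F.κ * F.w := by
    have := mul_le_mul_of_nonneg_left h7 (by positivity : 0 ≤ F.K ^ 3)
    linarith
  have h11 := le_of_mul_le_mul_left h10 F.κ_pos
  have h12 := mul_le_mul_of_nonneg_left h9 (by positivity : 0 ≤ F.K ^ 3)
  linarith [F.w_pos]

theorem lipschitz_coords {x y : Conf n} (hx : x ∈ closure D) (hxS : F.S x < F.w)
    (hy : y ∈ closure D) (hyS : F.S y < F.w) :
    ‖(F.coords x).1 - (F.coords y).1‖ ≤ F.A * ‖x - y‖ := by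
  obtain ⟨-, -, h1, h2, h3⟩ := F.of_S_lt hx hxS
  obtain ⟨-, -, h4, h5, h6⟩ := F.of_S_lt hy hyS
  have := (F.inverse_lipschitz h1 h4 h2 h5).1
  rwa [h3, h6] at this

end CollarFrame

/-! ### Existence of the flow and of the constants. -/

/-- A bounded Lipschitz vector field has a flow on `(-1, 1)`. -/
theorem exists_flow_of_lipschitzWith {G : Type*} [NormedAddCommGroup G] [NormedSpace ℝ G]
    [CompleteSpace G] {X : G → G} {L M : NNReal} (hL : LipschitzWith L X) (hM : ∀ z, ‖X z‖ ≤ M) :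
    ∃ Φ : G → ℝ → G, (∀ z, Φ z 0 = z) ∧
      (∀ z, ∀ t ∈ Ioo (-1 : ℝ) 1, HasDerivAt (Φ z) (X (Φ z t)) t) ∧
      ∀ z w, ∀ t ∈ Ico (0 : ℝ) 1, ‖Φ z t - Φ w t‖ ≤ Real.exp L * ‖z - w‖ := by
  have hex : ∀ z, ∃ α : ℝ → G, α 0 = z ∧ ∀ t ∈ Icc (-1 : ℝ) 1,
      HasDerivWithinAt α (X (α t)) (Icc (-1) 1) t := by
    intro z
    -- With speed at most `M`, a ball of radius `M` suffices for unit time.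
    have hP : IsPicardLindelof (fun _ => X) (tmin := -1) (tmax := 1)
        (⟨0, by norm_num, by norm_num⟩ : Icc (-1 : ℝ) 1) z M 0 M L :=
      IsPicardLindelof.of_time_independent (fun x _ => hM x) hL.lipschitzOnWith (by simp)
    exact hP.exists_eq_forall_mem_Icc_hasDerivWithinAt₀
  choose Φ hΦ0 hΦ using hex
  have hd : ∀ z, ∀ t ∈ Ioo (-1 : ℝ) 1, HasDerivAt (Φ z) (X (Φ z t)) t := fun z t ht =>
    (hΦ z t (Ioo_subset_Icc_self ht)).hasDerivAt (Icc_mem_nhds ht.1 ht.2)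
  refine ⟨Φ, hΦ0, hd, fun z w t ht => ?_⟩
  have h1 : ∀ s ∈ Icc 0 t, s ∈ Ioo (-1 : ℝ) 1 := fun s hs =>
    ⟨by linarith [hs.1], hs.2.trans_lt ht.2⟩
  have := dist_le_of_trajectories_ODE (v := fun _ => X) (f := Φ z) (g := Φ w) (a := 0) (b := t)
    (δ := dist z w) (fun _ => hL)
    (fun s hs => (hd z s (h1 s hs)).continuousAt.continuousWithinAt)
    (fun s hs => (hd z s (h1 s (Ico_subset_Icc_self hs))).hasDerivWithinAt)
    (fun s hs => (hd w s (h1 s hs)).continuousAt.continuousWithinAt)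
    (fun s hs => (hd w s (h1 s (Ico_subset_Icc_self hs))).hasDerivWithinAt)
    (by rw [hΦ0, hΦ0]) t ⟨ht.1, le_rfl⟩
  rw [dist_eq_norm, dist_eq_norm, mul_comm] at this
  refine this.trans (mul_le_mul_of_nonneg_right (Real.exp_le_exp.2 ?_) (norm_nonneg _))
  have := mul_le_mul_of_nonneg_left ht.2.le L.2
  simpa using this

/-- Second order Taylor estimate for a function with Lipschitz derivative. -/
theorem norm_sub_sub_fderiv_le {G : Type*} [NormedAddCommGroup G] [NormedSpace ℝ G]
    {f : G → ℝ} (hf : Differentiable ℝ f) {s : Set G} (hs : Convex ℝ s) {L : NNReal}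
    (hL : LipschitzOnWith L (fderiv ℝ f) s) {z w : G} (hz : z ∈ s) (hw : w ∈ s) :
    |f w - f z - fderiv ℝ f z (w - z)| ≤ L * ‖w - z‖ ^ 2 := by
  have := (hs.inter (convex_closedBall z ‖w - z‖)).norm_image_sub_le_of_norm_hasFDerivWithin_le'
    (f := f) (f' := fderiv ℝ f) (φ := fderiv ℝ f z) (C := L * ‖w - z‖) (x := z) (y := w)
    (fun x _ => (hf x).hasFDerivAt.hasFDerivWithinAt)
    (fun x hx => by
      have h1 := hL.dist_le_mul x hx.1 z hz
      rw [dist_eq_norm] at h1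
      exact h1.trans (mul_le_mul_of_nonneg_left hx.2 L.2))
    ⟨hz, by simp⟩ ⟨hw, by simp [dist_eq_norm]⟩
  rw [Real.norm_eq_abs] at this
  linarith

/-- By connectedness an empty frontier would force `D` to be the whole space, which is not compact
in positive dimension. -/
theorem frontier_nonempty_of_isCompact_closure {n : ℕ} (hn : 0 < n) {D : Set (Conf n)}
    (hD : D.Nonempty) (hc : IsCompact (closure D)) : (frontier D).Nonempty := by
  rw [nonempty_frontier_iff]
  refine ⟨hD, fun h => ?_⟩
  have : Nonempty (Fin n) := ⟨⟨0, hn⟩⟩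
  have : Nontrivial (Conf n) := inferInstance
  have : NoncompactSpace (Conf n) := NormedSpace.noncompactSpace ℝ _
  rw [h, closure_univ] at hc
  exact noncompact_univ _ hc

theorem exists_collarFrame {n : ℕ} (hn : 0 < n) {H : Conf n × Conf n → ℝ}
    (hH : IsClassicalHamiltonian H) {D : Set (Conf n)} {E : ℝ} (hD : IsPotentialWell H D E)
    (hc : IsCompact (closure D)) (hne : D.Nonempty) : Nonempty (CollarFrame H D E) := by
  have hdiff : Differentiable ℝ H := hH.contDiff.differentiable (by simp)
  have hFc : IsCompact (frontier D) := hc.of_isClosed_subset isClosed_frontier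
    frontier_subset_closure
  have hFne := frontier_nonempty_of_isCompact_closure hn hne hc
  obtain ⟨R₀, hR₀⟩ := hc.isBounded.exists_norm_le
  set R := max R₀ 0 + 3 with hR
  have hR3 : 3 ≤ R := by rw [hR]; linarith [le_max_right R₀ 0]
  have hbdd : ∀ Q : Conf n, Metric.infDist Q (frontier D) ≤ 1 → ‖Q‖ ≤ R - 1 := by
    intro Q hQ
    obtain ⟨Z, hZ, hQZ⟩ := hFc.exists_infDist_eq_dist hFne Q
    rw [hQZ, dist_eq_norm] at hQ
    have h1 := hR₀ Z (frontier_subset_closure hZ)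
    have h2 := norm_le_norm_add_norm_sub' Q Z
    have h3 := le_max_left R₀ 0
    rw [hR]; linarith
  -- The cut-off makes the field compactly supported and `C¹`, hence globally bounded and Lipschitz.
  let χ : ContDiffBump (0 : Conf n × Conf n) := ⟨R, R + 1, by linarith, by linarith⟩
  set X : Conf n × Conf n → Conf n × Conf n := fun z => χ z • (gradP H z, -gradQ H z) with hX
  have hXc : ContDiff ℝ 1 X := χ.contDiff.smul
    ((contDiff_gradP hH.contDiff).prodMk (contDiff_gradQ hH.contDiff).neg)
  have hXs : HasCompactSupport X := χ.hasCompactSupport.smul_right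
  have hXeq : ∀ z, ‖z‖ ≤ R → X z = (gradP H z, -gradQ H z) := fun z hz => by
    have : χ z = 1 := χ.one_of_mem_closedBall (by simpa [χ] using hz)
    rw [hX]; simp only [this, one_smul]
  obtain ⟨L₁, hL₁⟩ := hXc.lipschitzWith_of_hasCompactSupport hXs (by simp)
  obtain ⟨M, hM⟩ := hXs.exists_bound_of_continuous hXc.continuous
  obtain ⟨Φ, hΦ0, hΦd, hΦl⟩ := exists_flow_of_lipschitzWith (M := M.toNNReal) hL₁
    (fun z => (hM z).trans (Real.le_coe_toNNReal M))
  obtain ⟨L₂, hL₂⟩ := (hH.contDiff.fderiv_right (m := 1) (by norm_num)).contDiffOn.exists_lipschitzOnWith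
    (by simp) (convex_closedBall (0 : Conf n × Conf n) R) (isCompact_closedBall _ _)
  obtain ⟨ν, hνc, hν0, hν⟩ := hH.posDef
  obtain ⟨x₀, -, hx₀⟩ := (isCompact_closedBall (0 : Conf n) R).exists_isMinOn
    ⟨0, by simp; linarith⟩ hνc.continuousOn
  have hgc : Continuous fun Q : Conf n => ‖gradQ H (Q, 0)‖ :=
    ((contDiff_gradQ hH.contDiff).continuous.comp (by fun_prop)).norm
  obtain ⟨Q₀, hQ₀, hg⟩ := hFc.exists_isMinOn hFne hgc.continuousOn
  have hg0 : 0 < ‖gradQ H (Q₀, 0)‖ := norm_pos_iff.2 (hD.gradient_ne_zero Q₀ hQ₀)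
  set g := ‖gradQ H (Q₀, 0)‖ with hgdef
  set K : ℝ := 1 + L₁ + |M| + Real.exp L₁ + L₂ with hK
  have hL₁0 : (0 : ℝ) ≤ L₁ := L₁.2
  have hL₂0 : (0 : ℝ) ≤ L₂ := L₂.2
  have hM0 := abs_nonneg M
  have hexp := Real.exp_pos L₁
  have hK1 : 1 ≤ K := by rw [hK]; linarith
  have hK0 : 0 < K := by linarith
  set c : ℝ := min 1 (min (ν x₀ / 2) (g / 2)) with hcdef
  have hc0 : 0 < c := lt_min one_pos (lt_min (half_pos (hν0 _)) (half_pos hg0))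
  have hcν : ∀ q : Conf n, ‖q‖ ≤ R → c ≤ ν q / 2 := fun q hq => by
    have h1 : ν x₀ ≤ ν q := hx₀ (by simpa using hq)
    have h2 : c ≤ ν x₀ / 2 := (min_le_right _ _).trans (min_le_left _ _)
    linarith
  -- The gradient of `V` is at least `g` on `∂D` and varies by at most `K r ≤ g/2` within distance
  -- `r`.
  set r : ℝ := min 1 (g / (2 * K)) with hr
  have hr0 : 0 < r := lt_min one_pos (by positivity)
  have hr1 : r ≤ 1 := min_le_left _ _
  set κ : ℝ := c ^ 3 / 8 with hκ
  have hκ0 : 0 < κ := by positivity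
  set ε : ℝ := κ / (8 * K ^ 3) with hε
  have hε0 : 0 < ε := by positivity
  have hXlip : ∀ z w, ‖X z - X w‖ ≤ K * ‖z - w‖ := fun z w => by
    have h1 := hL₁.dist_le_mul z w
    rw [dist_eq_norm, dist_eq_norm] at h1
    exact h1.trans (mul_le_mul_of_nonneg_right (by rw [hK]; linarith) (norm_nonneg _))
  have hquad : ∀ q p p' : Conf n, ‖q‖ ≤ R →
      H (q, p) + inner ℝ (gradP H (q, p)) (p' - p) + c * ‖p' - p‖ ^ 2 ≤ H (q, p') := by
    intro q p p' hq
    have h1 := quadratic_lower_bound hH.contDiff (hν q) p p'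
    have h2 := mul_le_mul_of_nonneg_right (hcν q hq) (sq_nonneg ‖p' - p‖)
    linarith
  refine ⟨{
    X := X, Φ := Φ, K := K, c := c, κ := κ, ε := ε, r := r, τ := ε * r / (2 * K ^ 5), R := R
    one_le_K := hK1, c_pos := hc0, c_le_one := min_le_left _ _, κ_eq := rfl, ε_pos := hε0
    ε_le := le_of_eq (by rw [hε]; field_simp)
    r_pos := hr0, r_le_one := hr1
    τ_pos := by positivity
    τ_le := le_of_eq (by field_simp)
    R_ge := hR3
    X_lipschitz := hXlip
    X_bound := fun z => (hM z).trans ((le_abs_self M).trans (by rw [hK]; linarith))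
    X_eq := hXeq
    X_zero := fun q => by simp [hX, gradP_zero hdiff hH.even q]
    flow_zero := hΦ0
    flow_deriv := hΦd
    flow_lipschitz := fun z w t ht => (hΦl z w t ht).trans
      (mul_le_mul_of_nonneg_right (by rw [hK]; linarith) (norm_nonneg _))
    taylor := fun z w hz hw => by
      have h1 := norm_sub_sub_fderiv_le hdiff (convex_closedBall (0 : Conf n × Conf n) R) hL₂
        (z := z) (w := w) (by simpa using hz) (by simpa using hw)
      rw [fderiv_eq_inner_add_inner hdiff] at h1
      exact h1.trans (mul_le_mul_of_nonneg_right (by rw [hK]; linarith) (sq_nonneg _))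
    coercive := fun q p hq => by
      have h1 := hquad q 0 p hq
      rwa [gradP_zero hdiff hH.even, inner_zero_left, add_zero, sub_zero] at h1
    gradP_coercive := fun q p hq => by
      have h1 := hquad q p 0 hq
      have h2 := hquad q 0 p hq
      rw [gradP_zero hdiff hH.even, inner_zero_left, add_zero, sub_zero] at h2
      rw [zero_sub, inner_neg_right, norm_neg] at h1
      have : 0 ≤ c * ‖p‖ ^ 2 := by positivity
      linarith
    gradient_lower := fun Q hQ => by
      obtain ⟨Z, hZ, hQZ⟩ := hFc.exists_infDist_eq_dist hFne Q
      have h0 : Metric.infDist Z (frontier D) ≤ 1 := by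
        rw [Metric.infDist_zero_of_mem hZ]; exact zero_le_one
      have h1 : g ≤ ‖gradQ H (Z, 0)‖ := hg hZ
      have h2 := (norm_snd_le _).trans (hXlip (Z, 0) (Q, 0))
      have hR₁ : ‖((Z, 0) : Conf n × Conf n)‖ ≤ R := by
        simp only [Prod.norm_def, norm_zero, norm_nonneg, sup_of_le_left]
        linarith [hbdd Z h0]
      have hR₂ : ‖((Q, 0) : Conf n × Conf n)‖ ≤ R := by
        simp only [Prod.norm_def, norm_zero, norm_nonneg, sup_of_le_left]
        linarith [hbdd Q (hQ.trans hr1)]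
      rw [Prod.snd_sub, hXeq _ hR₁, hXeq _ hR₂] at h2
      simp only [Prod.mk_sub_mk, sub_self, Prod.norm_def, norm_zero, norm_nonneg,
        sup_of_le_left] at h2
      rw [neg_sub_neg] at h2
      rw [hQZ, dist_comm, dist_eq_norm] at hQ
      have h3 : K * ‖Z - Q‖ ≤ g / 2 := by
        have h4 : r ≤ g / (2 * K) := min_le_right _ _
        have h5 := mul_le_mul_of_nonneg_left (hQ.trans h4) hK0.le
        have h6 : K * (g / (2 * K)) = g / 2 := by field_simp
        linarith
      have h7 : c ≤ g / 2 := (min_le_right _ _).trans (min_le_right _ _)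
      have h8 := norm_le_norm_add_norm_sub (gradQ H (Q, 0)) (gradQ H (Z, 0))
      linarith
    bounded := fun Q hQ => hbdd Q (hQ.trans hr1)
    differentiable := hdiff
    isOpen := hD.isOpen
    isCompact_frontier := hFc
    frontier_nonempty := hFne
    potential_lt := hD.lt_of_mem
    potential_eq := hD.eq_of_mem_frontier }⟩

/-! ### The Legendre transform `G`: bounds, equality case, measurability. -/

section Finsler

variable {n : ℕ} {H : Conf n × Conf n → ℝ} {D : Set (Conf n)} {E : ℝ} {q : Conf n}

theorem IsClassicalHamiltonian.continuous (hH : IsClassicalHamiltonian H) : Continuous H :=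
  hH.contDiff.continuous

theorem IsClassicalHamiltonian.differentiable (hH : IsClassicalHamiltonian H) :
    Differentiable ℝ H := hH.contDiff.differentiable (by simp)

theorem IsClassicalHamiltonian.add_inner_le (hH : IsClassicalHamiltonian H) (q p p' : Conf n) :
    H (q, p) + inner ℝ (gradP H (q, p)) (p' - p) ≤ H (q, p') := by
  obtain ⟨ν, -, hν0, hν⟩ := hH.posDef
  have h1 := quadratic_lower_bound hH.contDiff (hν q) p p'
  have : 0 ≤ ν q / 2 * ‖p' - p‖ ^ 2 := by have := hν0 q; positivity
  linarith

theorem convex_energy_sublevel (hH : IsClassicalHamiltonian H) (E : ℝ) (q : Conf n) :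
    Convex ℝ {p : Conf n | H (q, p) ≤ E} := by
  intro x hx y hy a b ha hb hab
  rw [mem_ofPred_eq] at hx hy ⊢
  have h1 := mul_le_mul_of_nonneg_left ((hH.add_inner_le q (a • x + b • y) x).trans hx) ha
  have h2 := mul_le_mul_of_nonneg_left ((hH.add_inner_le q (a • x + b • y) y).trans hy) hb
  set g := gradP H (q, a • x + b • y)
  set h := H (q, a • x + b • y)
  simp only [inner_sub_right, inner_add_right, real_inner_smul_right] at h1 h2
  have h3 : b = 1 - a := by linarith
  subst h3
  linarith

theorem energy_sublevel_mem_nhds (hH : IsClassicalHamiltonian H) (hq : H (q, 0) < E) :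
    {p : Conf n | H (q, p) ≤ E} ∈ 𝓝 0 := by
  have hc : Continuous fun p : Conf n => H (q, p) := hH.continuous.comp (by fun_prop)
  filter_upwards [hc.continuousAt.eventually_lt continuousAt_const hq] with p hp
  exact hp.le

theorem exists_energy_sublevel_bound (hH : IsClassicalHamiltonian H) (E : ℝ)
    (hc : IsCompact (closure D)) :
    ∃ ρ : ℝ, 0 < ρ ∧ ∀ q ∈ D, ∀ p : Conf n, H (q, p) ≤ E → ‖p‖ ≤ ρ := by
  obtain ⟨ν, hνc, hν0, hν⟩ := hH.posDef
  have hcont : Continuous fun q : Conf n => 2 * (E - H (q, 0)) / ν q :=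
    (continuous_const.mul (continuous_const.sub (hH.continuous.comp (by fun_prop)))).div hνc
      fun q => (hν0 q).ne'
  obtain ⟨C, hC⟩ := (hc.image hcont).isBounded.exists_norm_le
  refine ⟨1 + |C|, by positivity, fun q hq p hp => ?_⟩
  have h1 := quadratic_lower_bound hH.contDiff (hν q) 0 p
  rw [gradP_zero hH.differentiable hH.even, inner_zero_left, add_zero, sub_zero] at h1
  have h2 := hC _ (mem_image_of_mem _ (subset_closure hq))
  have h3 : ‖p‖ ^ 2 ≤ 2 * (E - H (q, 0)) / ν q := by
    rw [le_div_iff₀ (hν0 q)]; linarith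
  have h4 : ‖p‖ ^ 2 ≤ |C| := h3.trans ((Real.le_norm_self _).trans (h2.trans (le_abs_self C)))
  nlinarith [norm_nonneg p, abs_nonneg C]

theorem gauge_smul_le {p : Conf n} (hp : H (q, p) ≤ E) {k : ℝ} (hk : 0 ≤ k) :
    gauge {p' : Conf n | H (q, p') ≤ E} (k • p) ≤ k :=
  gauge_le_of_mem hk (smul_mem_smul_set hp)

theorem norm_div_le_gauge (hH : IsClassicalHamiltonian H) (hq : H (q, 0) < E) {ρ : ℝ}
    (hρ0 : 0 < ρ) (hρ : ∀ p : Conf n, H (q, p) ≤ E → ‖p‖ ≤ ρ) (p : Conf n) :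
    ‖p‖ / ρ ≤ gauge {p' : Conf n | H (q, p') ≤ E} p :=
  le_gauge_of_subset_closedBall (absorbent_nhds_zero (energy_sublevel_mem_nhds hH hq)) hρ0.le
    fun p hp => by simpa using hρ p hp

theorem inner_sub_jacobiU_le (hH : IsClassicalHamiltonian H) (hq : H (q, 0) < E) {ρ : ℝ}
    (hρ0 : 0 < ρ) (hρ : ∀ p : Conf n, H (q, p) ≤ E → ‖p‖ ≤ ρ) (v p : Conf n) :
    inner ℝ v p - jacobiU H E q p ≤ ρ ^ 2 / 4 * ‖v‖ ^ 2 := by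
  have h1 := norm_div_le_gauge hH hq hρ0 hρ p
  have h2 := real_inner_le_norm v p
  rw [jacobiU]
  set g := gauge {p' : Conf n | H (q, p') ≤ E} p
  rw [div_le_iff₀ hρ0] at h1
  have h3 := mul_le_mul_of_nonneg_left h1 (norm_nonneg v)
  nlinarith [sq_nonneg (ρ * ‖v‖ / 2 - g)]

theorem jacobiG_of_mem (hq : q ∈ D) (v : Conf n) :
    jacobiG H D E q v = ⨆ p : Conf n, (inner ℝ v p - jacobiU H E q p) := by
  rw [jacobiG, if_pos hq]

theorem jacobiG_le (hH : IsClassicalHamiltonian H) (hqD : q ∈ D) (hq : H (q, 0) < E) {ρ : ℝ}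
    (hρ0 : 0 < ρ) (hρ : ∀ p : Conf n, H (q, p) ≤ E → ‖p‖ ≤ ρ) (v : Conf n) :
    jacobiG H D E q v ≤ ρ ^ 2 / 4 * ‖v‖ ^ 2 := by
  rw [jacobiG_of_mem hqD]
  exact ciSup_le fun p => inner_sub_jacobiU_le hH hq hρ0 hρ v p

theorem le_jacobiG (hH : IsClassicalHamiltonian H) (hqD : q ∈ D) (hq : H (q, 0) < E) {ρ : ℝ}
    (hρ0 : 0 < ρ) (hρ : ∀ p : Conf n, H (q, p) ≤ E → ‖p‖ ≤ ρ) (v p : Conf n) :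
    inner ℝ v p - jacobiU H E q p ≤ jacobiG H D E q v := by
  rw [jacobiG_of_mem hqD]
  exact le_ciSup (f := fun p => inner ℝ v p - jacobiU H E q p)
    ⟨_, forall_mem_range.2 fun p => inner_sub_jacobiU_le hH hq hρ0 hρ v p⟩ p

/-- Test the supremum at `k • p`, where homogeneity gives `U ≤ k²`. -/
theorem inner_smul_sub_sq_le_jacobiG (hH : IsClassicalHamiltonian H) (hqD : q ∈ D)
    (hq : H (q, 0) < E) {ρ : ℝ} (hρ0 : 0 < ρ) (hρ : ∀ p : Conf n, H (q, p) ≤ E → ‖p‖ ≤ ρ)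
    {p : Conf n} (hp : H (q, p) ≤ E) {k : ℝ} (hk : 0 ≤ k) (v : Conf n) :
    k * inner ℝ v p - k ^ 2 ≤ jacobiG H D E q v := by
  have h1 := le_jacobiG hH hqD hq hρ0 hρ v (k • p)
  have h2 : jacobiU H E q (k • p) ≤ k ^ 2 := by
    rw [jacobiU]
    exact pow_le_pow_left₀ (gauge_nonneg _) (gauge_smul_le hp hk) 2
  rw [real_inner_smul_right] at h1
  linarith

theorem jacobiG_nonneg (hH : IsClassicalHamiltonian H) (hqD : q ∈ D) (hq : H (q, 0) < E) {ρ : ℝ}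
    (hρ0 : 0 < ρ) (hρ : ∀ p : Conf n, H (q, p) ≤ E → ‖p‖ ≤ ρ) (v : Conf n) :
    0 ≤ jacobiG H D E q v := by
  simpa using inner_smul_sub_sq_le_jacobiG hH hqD hq hρ0 hρ hq.le le_rfl v

theorem sub_le_inner_gradP (hH : IsClassicalHamiltonian H) (q P : Conf n) :
    H (q, P) - H (q, 0) ≤ inner ℝ P (gradP H (q, P)) := by
  have h1 := hH.add_inner_le q P 0
  rw [zero_sub, inner_neg_right, real_inner_comm] at h1
  linarith

/-- A linear form that is maximal on `{H(q,·) ≤ E}` at a boundary point `P` is proportional to the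
gradient of `H(q,·)` at `P`. -/
theorem eq_smul_gradP_of_isMax (hH : IsClassicalHamiltonian H) {P u : Conf n}
    (hP : H (q, P) = E) (hq : H (q, 0) < E)
    (hmax : ∀ p : Conf n, H (q, p) ≤ E → inner ℝ u p ≤ inner ℝ u P) :
    u = (inner ℝ u P / inner ℝ P (gradP H (q, P))) • gradP H (q, P) := by
  set h := gradP H (q, P) with hh
  have hPh : 0 < inner ℝ P h := by
    have := sub_le_inner_gradP hH q P
    rw [hP] at this
    linarith
  have hh0 : h ≠ 0 := fun h0 => by rw [h0, inner_zero_right] at hPh; exact lt_irrefl _ hPh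
  have hhh : 0 < ‖h‖ ^ 2 := by have := norm_pos_iff.2 hh0; positivity
  -- A direction with `⟨h, ξ⟩ < 0` enters the sublevel set, so `u` cannot increase along it.
  have key : ∀ ξ : Conf n, inner ℝ h ξ < 0 → inner ℝ u ξ ≤ 0 := by
    intro ξ hξ
    have hd : HasDerivAt (fun t : ℝ => H (q, P + t • ξ)) (inner ℝ h ξ) 0 := by
      have h1 := hasFDerivAt_partial_right hH.differentiable (q, P)
      have h2 : HasDerivAt (fun t : ℝ => P + t • ξ) ξ 0 := by
        simpa using ((hasDerivAt_id (0 : ℝ)).smul_const ξ).const_add P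
      have h3 : HasFDerivAt (fun p' : Conf n => H (q, p'))
          ((fderiv ℝ H (q, P)).comp (ContinuousLinearMap.inr ℝ _ _)) (P + (0 : ℝ) • ξ) := by
        simpa using h1
      have h4 := h3.comp_hasDerivAt (0 : ℝ) h2
      rw [hh, inner_gradP hH.differentiable]
      exact h4
    have h5 := hd.tendsto_slope_zero_right
    have h6 : ∀ᶠ t in 𝓝[>] (0 : ℝ), t⁻¹ • (H (q, P + (0 + t) • ξ) - H (q, P + (0 : ℝ) • ξ)) < 0 :=
      h5.eventually_lt_const hξ
    obtain ⟨t, ht, ht0⟩ := (h6.and self_mem_nhdsWithin).exists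
    rw [zero_add, zero_smul, add_zero, hP, smul_eq_mul] at ht
    have h7 : H (q, P + t • ξ) ≤ E := by
      by_contra hcon
      have := mul_pos (inv_pos.2 ht0) (sub_pos.2 (not_le.1 hcon))
      linarith
    have h8 := hmax _ h7
    rw [inner_add_right, real_inner_smul_right] at h8
    by_contra hcon
    have := mul_pos ht0 (not_le.1 hcon)
    linarith
  set lam := inner ℝ u h / ‖h‖ ^ 2 with hlam
  set ξ₀ := u - lam • h with hξ₀
  have horth : inner ℝ h ξ₀ = 0 := by
    rw [hξ₀, inner_sub_right, real_inner_smul_right, real_inner_self_eq_norm_sq, hlam,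
      real_inner_comm]
    field_simp
    ring
  -- The component `ξ₀` of `u` orthogonal to `h` is only on the boundary of that half-space; it is
  -- pushed inside by a small multiple of `-h`.
  have h1 : inner ℝ u ξ₀ ≤ 0 := by
    refine le_of_forall_pos_le_add fun e he => ?_
    have hpos : 0 < e / (1 + |inner ℝ u h|) := by positivity
    have h2 := key (ξ₀ - (e / (1 + |inner ℝ u h|)) • h) (by
      rw [inner_sub_right, horth, real_inner_smul_right, real_inner_self_eq_norm_sq]
      have := mul_pos hpos hhh
      linarith)
    rw [inner_sub_right, real_inner_smul_right] at h2
    have h3 : e / (1 + |inner ℝ u h|) * inner ℝ u h ≤ e := by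
      rw [div_mul_eq_mul_div, div_le_iff₀ (by positivity)]
      have := le_abs_self (inner ℝ u h)
      nlinarith
    linarith
  have h2 : inner ℝ u ξ₀ = ‖ξ₀‖ ^ 2 := by
    rw [← real_inner_self_eq_norm_sq]
    nth_rw 2 [hξ₀]
    rw [inner_sub_left, real_inner_smul_left, horth, mul_zero, sub_zero]
  have h3 : ξ₀ = 0 := by
    rw [h2] at h1
    simpa using le_antisymm h1 (sq_nonneg _)
  have h4 : u = lam • h := sub_eq_zero.1 h3
  have h5 : inner ℝ u P / inner ℝ P h = lam := by
    rw [h4, real_inner_smul_left, real_inner_comm, mul_div_assoc, div_self hPh.ne', mul_one]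
  rw [h5]; exact h4

/-- Two first-order conditions. Among the multiples `μ(-P)` the optimum is at `μ = k`, which fixes
`⟨P, v⟩`. Among the vectors `-k p` with `H(q,p) ≤ E` the optimum is at `p = P`, so `-v` is normal to
the energy surface at `P`. -/
theorem eq_of_jacobiG_eq (hH : IsClassicalHamiltonian H) (hqD : q ∈ D) (hq : H (q, 0) < E) {ρ : ℝ}
    (hρ0 : 0 < ρ) (hρ : ∀ p : Conf n, H (q, p) ≤ E → ‖p‖ ≤ ρ) {P v : Conf n} {k : ℝ}
    (hP : H (q, P) = E) (hk : 0 < k) (hG : jacobiG H D E q v = -(k * inner ℝ P v) - k ^ 2) :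
    inner ℝ P v = -(2 * k) ∧
      v = -((2 * k / inner ℝ P (gradP H (q, P))) • gradP H (q, P)) := by
  set x := -inner ℝ P v with hx
  have hneg : ∀ {p : Conf n}, H (q, p) ≤ E → H (q, -p) ≤ E := fun {p} hp => by rwa [hH.even]
  have h1 : ∀ μ : ℝ, 0 ≤ μ → μ * x - μ ^ 2 ≤ k * x - k ^ 2 := by
    intro μ hμ
    have := inner_smul_sub_sq_le_jacobiG hH hqD hq hρ0 hρ (hneg hP.le) hμ v
    rw [hG, inner_neg_right, real_inner_comm] at this
    linarith
  have hx0 : 0 < x := by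
    have := h1 0 le_rfl
    by_contra hcon
    have := mul_nonneg hk.le (neg_nonneg.2 (not_lt.1 hcon))
    nlinarith
  have h2 := h1 (x / 2) (by linarith)
  have h3 : x = 2 * k := by
    have : (x - 2 * k) ^ 2 ≤ 0 := by nlinarith
    have := pow_eq_zero_iff (two_ne_zero) |>.1 (le_antisymm this (sq_nonneg _))
    linarith
  have hPv : inner ℝ P v = -(2 * k) := by linarith
  refine ⟨hPv, ?_⟩
  have h4 : ∀ p : Conf n, H (q, p) ≤ E → inner ℝ (-v) p ≤ inner ℝ (-v) P := by
    intro p hp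
    have h5 := inner_smul_sub_sq_le_jacobiG hH hqD hq hρ0 hρ (hneg hp) hk.le v
    rw [hG, hPv, inner_neg_right] at h5
    rw [inner_neg_left, inner_neg_left, real_inner_comm P v, hPv]
    have h6 : k * -inner ℝ v p ≤ k * (2 * k) := by linarith
    have := le_of_mul_le_mul_left h6 hk
    linarith
  have h5 := eq_smul_gradP_of_isMax hH hP hq h4
  rw [inner_neg_left, real_inner_comm P v, hPv, neg_neg] at h5
  rw [← h5, neg_neg]

/-- The sublevel set lies on one side of its tangent plane at `P`, and by evenness of the opposite
one. So `⟨v, p⟩ ≤ 2k g` with `g` the gauge of `p`, and `2k g - g² ≤ k²`. -/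
theorem jacobiG_le_sq (hH : IsClassicalHamiltonian H) (hqD : q ∈ D) (hq : H (q, 0) < E)
    {P : Conf n} {k : ℝ} (hP : H (q, P) = E) (hk : 0 ≤ k) :
    jacobiG H D E q (-((2 * k / inner ℝ P (gradP H (q, P))) • gradP H (q, P))) ≤ k ^ 2 := by
  set h := gradP H (q, P) with hh
  have hPh : 0 < inner ℝ P h := by
    have := sub_le_inner_gradP hH q P
    rw [hP] at this
    linarith
  rw [jacobiG_of_mem hqD]
  refine ciSup_le fun p => ?_
  have h1 : inner ℝ (-((2 * k / inner ℝ P h) • h)) p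
      ≤ 2 * k * gauge {p' : Conf n | H (q, p') ≤ E} p := by
    refine le_of_forall_pos_le_add fun e he => ?_
    obtain ⟨b, hb, hb', x, hx, hbx⟩ := exists_lt_of_gauge_lt
      (absorbent_nhds_zero (energy_sublevel_mem_nhds hH hq))
      (lt_add_of_pos_right (gauge {p' : Conf n | H (q, p') ≤ E} p)
        (by positivity : 0 < e / (2 * k + 1)))
    rw [mem_ofPred_eq] at hx
    have h2 : inner ℝ (-h) x ≤ inner ℝ P h := by
      have h3 := hH.add_inner_le q P (-x)
      rw [hH.even, hP, inner_sub_right, inner_neg_right, ← hh, real_inner_comm P h] at h3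
      rw [inner_neg_left]
      linarith
    have h3 : inner ℝ (-((2 * k / inner ℝ P h) • h)) x ≤ 2 * k := by
      rw [← smul_neg, real_inner_smul_left, div_mul_eq_mul_div, div_le_iff₀ hPh]
      exact mul_le_mul_of_nonneg_left h2 (by linarith)
    simp only at hbx
    rw [← hbx, real_inner_smul_right]
    rw [hbx]
    have h4 := mul_le_mul_of_nonneg_left h3 hb.le
    have h5 := mul_le_mul_of_nonneg_right hb'.le (by linarith : 0 ≤ 2 * k)
    have h6 : e / (2 * k + 1) * (2 * k) ≤ e := by
      rw [div_mul_eq_mul_div, div_le_iff₀ (by positivity)]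
      nlinarith
    linarith
  rw [jacobiU]
  nlinarith [sq_nonneg (gauge {p' : Conf n | H (q, p') ≤ E} p - k)]

open Classical in
theorem measurable_jacobiG (hH : IsClassicalHamiltonian H) (hD : IsOpen D)
    (hlt : ∀ q ∈ D, H (q, 0) < E) :
    Measurable fun x : Conf n × Conf n => jacobiG H D E x.1 x.2 := by
  have hDm : MeasurableSet {x : Conf n × Conf n | x.1 ∈ D} := hD.measurableSet.preimage measurable_fst
  have hgm : ∀ p : Conf n, Measurable fun q : Conf n =>
      if q ∈ D then gauge {p' : Conf n | H (q, p') ≤ E} p else 0 := by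
    intro p
    refine measurable_of_Iic fun r => ?_
    rcases lt_or_ge r 0 with hr | hr
    · convert MeasurableSet.empty using 1
      refine eq_empty_of_forall_notMem fun q hq => ?_
      rw [mem_preimage, mem_Iic] at hq
      split_ifs at hq
      · exact absurd ((gauge_nonneg _).trans hq) (not_le.2 hr)
      · exact absurd hq (not_le.2 hr)
    -- Approaching `r` from above by `r + 1/(m+1)` keeps the divisor positive when `r = 0`.
    · have hset : ((fun q : Conf n => if q ∈ D then gauge {p' : Conf n | H (q, p') ≤ E} p else 0) ⁻¹'
          Iic r) = Dᶜ ∪ (D ∩ {q | ∀ m : ℕ, H (q, (r + 1 / ((m : ℝ) + 1))⁻¹ • p) ≤ E}) := by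
        ext q
        rw [mem_preimage, mem_Iic]
        by_cases hq : q ∈ D
        · rw [if_pos hq]
          simp only [mem_union, mem_compl_iff, hq, not_true_eq_false, mem_inter_iff, true_and,
            false_or, mem_ofPred_eq]
          have hgc := energy_sublevel_mem_nhds hH (hlt q hq)
          have hcl : IsClosed {p' : Conf n | H (q, p') ≤ E} :=
            isClosed_le (hH.continuous.comp (by fun_prop)) continuous_const
          have hiff : ∀ b : ℝ, 0 < b → (gauge {p' : Conf n | H (q, p') ≤ E} p ≤ b ↔
              H (q, b⁻¹ • p) ≤ E) := by
            intro b hb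
            have h1 := gauge_le_one_iff_mem_closure (convex_energy_sublevel hH E q) hgc
              (x := b⁻¹ • p)
            rw [hcl.closure_eq, gauge_smul_of_nonneg (inv_nonneg.2 hb.le), smul_eq_mul,
              inv_mul_le_iff₀ hb, mul_one] at h1
            exact h1
          constructor
          · intro h m
            have hm : 0 < 1 / ((m : ℝ) + 1) := Nat.one_div_pos_of_nat
            exact (hiff _ (by linarith)).1 (by linarith)
          · intro h
            refine le_of_forall_pos_le_add fun e he => ?_
            obtain ⟨m, hm⟩ := exists_nat_one_div_lt he
            have hm' : 0 < 1 / ((m : ℝ) + 1) := Nat.one_div_pos_of_nat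
            exact ((hiff _ (by linarith)).2 (h m)).trans (by linarith)
        · rw [if_neg hq]
          simp [hq, hr]
      rw [hset]
      refine hD.measurableSet.compl.union (hD.measurableSet.inter ?_)
      rw [ofPred_forall]
      refine MeasurableSet.iInter fun m => ?_
      exact (isClosed_le (hH.continuous.comp (by fun_prop)) continuous_const).measurableSet
  have hfm : ∀ i : ℕ, Measurable fun x : Conf n × Conf n => if x.1 ∈ D then
      inner ℝ x.2 (TopologicalSpace.denseSeq (Conf n) i)
        - jacobiU H E x.1 (TopologicalSpace.denseSeq (Conf n) i) else 0 := by
    intro i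
    have h1 : Measurable fun x : Conf n × Conf n => if x.1 ∈ D then
        inner ℝ x.2 (TopologicalSpace.denseSeq (Conf n) i) else 0 :=
      Measurable.ite hDm (by fun_prop) measurable_const
    convert h1.sub (((hgm (TopologicalSpace.denseSeq (Conf n) i)).comp measurable_fst).pow_const 2)
      using 1
    ext x
    by_cases hx : x.1 ∈ D
    · simp [hx, jacobiU]
    · simp [hx]
  -- By continuity in `p`, the supremum may be taken over a countable dense set.
  convert Measurable.iSup hfm using 1
  ext x
  by_cases hx : x.1 ∈ D
  · rw [jacobiG_of_mem hx]
    simp only [hx, if_true]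
    have hcont : Continuous fun p => inner ℝ x.2 p - jacobiU H E x.1 p :=
      (by fun_prop : Continuous fun p : Conf n => inner ℝ x.2 p).sub
        ((continuous_gauge (convex_energy_sublevel hH E x.1)
          (energy_sublevel_mem_nhds hH (hlt x.1 hx))).pow 2)
    have h1 := (TopologicalSpace.denseRange_denseSeq (Conf n)).ciSup' hcont
    rw [iSup_range' (fun p => inner ℝ x.2 p - jacobiU H E x.1 p)] at h1
    exact h1.symm
  · simp [jacobiG, hx]

end Finsler

/-! ### Absolute continuity and integrability along curves. -/

theorem AbsolutelyContinuousOnInterval.of_dist_le {X Y : Type*} [PseudoMetricSpace X]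
    [PseudoMetricSpace Y] {f : ℝ → X} {g : ℝ → Y} {a b C : ℝ} (hC : 0 ≤ C)
    (hf : AbsolutelyContinuousOnInterval f a b)
    (h : ∀ x ∈ uIcc a b, ∀ y ∈ uIcc a b, dist (g x) (g y) ≤ C * dist (f x) (f y)) :
    AbsolutelyContinuousOnInterval g a b := by
  rw [absolutelyContinuousOnInterval_iff] at hf ⊢
  intro ε hε
  obtain ⟨δ, hδ, hδ'⟩ := hf (ε / (C + 1)) (by positivity)
  refine ⟨δ, hδ, fun I hI hlen => ?_⟩
  have h1 := hδ' I hI hlen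
  rw [lt_div_iff₀ (by positivity)] at h1
  have h2 : ∑ i ∈ Finset.range I.1, dist (g (I.2 i).1) (g (I.2 i).2)
      ≤ C * ∑ i ∈ Finset.range I.1, dist (f (I.2 i).1) (f (I.2 i).2) := by
    rw [Finset.mul_sum]
    exact Finset.sum_le_sum fun i hi => h _ (hI.1 i hi).1 _ (hI.1 i hi).2
  have h3 : 0 ≤ ∑ i ∈ Finset.range I.1, dist (f (I.2 i).1) (f (I.2 i).2) :=
    Finset.sum_nonneg fun _ _ => dist_nonneg
  linarith

theorem LipschitzOnWith.comp_absolutelyContinuousOnInterval {X Y : Type*} [PseudoMetricSpace X]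
    [PseudoMetricSpace Y] {f : ℝ → X} {g : X → Y} {s : Set X} {a b : ℝ} {C : NNReal}
    (hg : LipschitzOnWith C g s) (hf : AbsolutelyContinuousOnInterval f a b)
    (hs : MapsTo f (uIcc a b) s) : AbsolutelyContinuousOnInterval (fun t => g (f t)) a b :=
  hf.of_dist_le C.2 fun _ hx _ hy => hg.dist_le_mul _ (hs hx) _ (hs hy)

section Curves

variable {n : ℕ} {H : Conf n × Conf n → ℝ} {D : Set (Conf n)} {E : ℝ} {y : Conf n}
  {γ : ℝ → Conf n}

theorem curvesToBoundary_ae_hasDerivAt (hγ : γ ∈ curvesToBoundary D y) :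
    ∀ᵐ s, s ∈ uIcc (0 : ℝ) 1 → HasDerivAt γ (deriv γ s) s := by
  filter_upwards [hγ.1.absCont.boundedVariationOn.ae_differentiableAt_of_mem_uIcc] with s hs h
  exact (hs h).hasDerivAt

/-- The bound `G ≤ (ρ²/4)‖v‖²` dominates the integrand. This rules out the default value `0` of the
integral of a non-integrable function. -/
theorem intervalIntegrable_jacobiG (hH : IsClassicalHamiltonian H) (hD : IsPotentialWell H D E)
    (hc : IsCompact (closure D)) (hγ : γ ∈ curvesToBoundary D y) :
    IntervalIntegrable (fun s => jacobiG H D E (γ s) (deriv γ s)) volume 0 1 := by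
  obtain ⟨ρ, hρ0, hρ⟩ := exists_energy_sublevel_bound (D := D) hH E hc
  rw [intervalIntegrable_iff_integrableOn_Ioo_of_le zero_le_one]
  have h1 : Integrable (fun s => ρ ^ 2 / 4 * ‖deriv γ s‖ ^ 2) (volume.restrict (Ioo (0 : ℝ) 1)) :=
    hγ.1.memLp_deriv.norm.integrable_sq.const_mul _
  have hγm : AEMeasurable γ (volume.restrict (Ioo (0 : ℝ) 1)) := by
    have hcont := hγ.1.absCont.continuousOn
    rw [uIcc_of_le zero_le_one] at hcont
    exact (hcont.mono Ioo_subset_Icc_self).aemeasurable measurableSet_Ioo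
  refine Integrable.mono' h1 ?_ ?_
  · exact ((measurable_jacobiG hH hD.isOpen hD.lt_of_mem).comp_aemeasurable
      (hγm.prodMk (measurable_deriv γ).aemeasurable)).aestronglyMeasurable
  · refine (ae_restrict_iff' measurableSet_Ioo).2 (Eventually.of_forall fun s hs => ?_)
    have hsD := hγ.2.2.1 s ⟨hs.1.le, hs.2⟩
    have hlt := hD.lt_of_mem _ hsD
    rw [Real.norm_of_nonneg (jacobiG_nonneg hH hsD hlt hρ0 (hρ _ hsD) _)]
    exact jacobiG_le hH hsD hlt hρ0 (hρ _ hsD) _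

end Curves

/-! ### Calibration and rigidity. -/

namespace CollarFrame

variable {n : ℕ} {H : Conf n × Conf n → ℝ} {D : Set (Conf n)} {E : ℝ} (F : CollarFrame H D E)
  {y : Conf n} {γ : ℝ → Conf n}

theorem absCont_S (hγ : γ ∈ curvesToBoundary D y) :
    AbsolutelyContinuousOnInterval (fun s => F.S (γ s)) 0 1 := by
  obtain ⟨C, hC⟩ := F.exists_lipschitzOnWith_S
  refine hC.comp_absolutelyContinuousOnInterval hγ.1.absCont ?_
  rw [uIcc_of_le zero_le_one]
  exact hγ.1.mapsTo

/-- The pointwise calibration inequality. -/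
theorem calibration_nonneg (hH : IsClassicalHamiltonian H) {ρ : ℝ} (hρ0 : 0 < ρ)
    (hρ : ∀ q ∈ D, ∀ p : Conf n, H (q, p) ≤ E → ‖p‖ ≤ ρ)
    (hγ : γ ∈ curvesToBoundary D y) {k : ℝ} (hk : 0 ≤ k) {s : ℝ} (hs : s ∈ Ioo (0 : ℝ) 1)
    (hd : HasDerivAt γ (deriv γ s) s) :
    0 ≤ jacobiG H D E (γ s) (deriv γ s) + k * deriv (fun s => F.S (γ s)) s + k ^ 2 := by
  have hsD := hγ.2.2.1 s ⟨hs.1.le, hs.2⟩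
  have hlt := F.potential_lt _ hsD
  rcases (F.S_le (γ s)).lt_or_eq with h | h
  · have h1 := ((F.hasFDerivAt_S hsD h).comp_hasDerivAt s hd).deriv
    rw [innerSL_apply_apply] at h1
    have h2 : H (γ s, -F.P (γ s)) ≤ E := by rw [hH.even]; exact (F.energy_P hsD h).le
    have h3 := inner_smul_sub_sq_le_jacobiG hH hsD hlt hρ0 (hρ _ hsD) h2 hk (deriv γ s)
    rw [inner_neg_right, real_inner_comm] at h3
    change deriv (fun s => F.S (γ s)) s = _ at h1
    rw [h1]
    linarith
  -- At the level `w` the truncated action is maximal along `γ`, so `deriv` is `0` there, whether or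
  -- not `S` is differentiable at the point.
  · have h1 : IsLocalMax (fun s => F.S (γ s)) s := Eventually.of_forall fun x => by
      simp only [h]; exact F.S_le _
    rw [h1.deriv_eq_zero]
    have := jacobiG_nonneg hH hsD hlt hρ0 (hρ _ hsD) (deriv γ s)
    have := sq_nonneg k
    linarith

/-- The equality case of the calibration inequality. -/
theorem hasDerivAt_of_calibration_eq (hH : IsClassicalHamiltonian H) {ρ : ℝ} (hρ0 : 0 < ρ)
    (hρ : ∀ q ∈ D, ∀ p : Conf n, H (q, p) ≤ E → ‖p‖ ≤ ρ)
    (hγ : γ ∈ curvesToBoundary D y) {k : ℝ} (hk : 0 < k) {s : ℝ} (hs : s ∈ Ioo (0 : ℝ) 1)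
    (hd : HasDerivAt γ (deriv γ s) s)
    (h0 : jacobiG H D E (γ s) (deriv γ s) + k * deriv (fun s => F.S (γ s)) s + k ^ 2 = 0) :
    HasDerivAt (fun s => F.S (γ s)) (-(2 * k)) s ∧ ∃ lam : ℝ,
      HasDerivAt γ (-(lam • gradP H (γ s, F.P (γ s)))) s := by
  have hsD := hγ.2.2.1 s ⟨hs.1.le, hs.2⟩
  have hlt := F.potential_lt _ hsD
  rcases (F.S_le (γ s)).lt_or_eq with h | h
  · have h1 : HasDerivAt (fun s => F.S (γ s)) _ s := (F.hasFDerivAt_S hsD h).comp_hasDerivAt s hd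
    rw [innerSL_apply_apply] at h1
    rw [h1.deriv] at h0
    obtain ⟨h2, h3⟩ := eq_of_jacobiG_eq hH hsD hlt hρ0 (hρ _ hsD) (v := deriv γ s)
      (F.energy_P hsD h) hk (by linarith)
    rw [h2] at h1
    exact ⟨h1, _, h3 ▸ hd⟩
  · have h1 : IsLocalMax (fun s => F.S (γ s)) s := Eventually.of_forall fun x => by
      simp only [h]; exact F.S_le _
    rw [h1.deriv_eq_zero] at h0
    have := jacobiG_nonneg hH hsD hlt hρ0 (hρ _ hsD) (deriv γ s)
    have := pow_pos hk 2
    linarith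

/-- The middle term integrates to `k (S(γ 1) - S(γ 0)) = -k S(y)`, since `S` vanishes on `∂D`. -/
theorem integral_calibration (hH : IsClassicalHamiltonian H) (hD : IsPotentialWell H D E)
    (hc : IsCompact (closure D)) (hγ : γ ∈ curvesToBoundary D y) (k : ℝ) :
    IntervalIntegrable (fun s => jacobiG H D E (γ s) (deriv γ s)
        + k * deriv (fun s => F.S (γ s)) s + k ^ 2) volume 0 1 ∧
      ∫ s in (0 : ℝ)..1, (jacobiG H D E (γ s) (deriv γ s)
        + k * deriv (fun s => F.S (γ s)) s + k ^ 2) = jacobiEnergy H D E γ - k * F.S y + k ^ 2 := by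
  have h1 := intervalIntegrable_jacobiG hH hD hc hγ
  have hAC := F.absCont_S hγ
  have h2 := hAC.intervalIntegrable_deriv.const_mul k
  refine ⟨(h1.add h2).add intervalIntegrable_const, ?_⟩
  rw [intervalIntegral.integral_add (h1.add h2) intervalIntegrable_const,
    intervalIntegral.integral_add h1 h2, intervalIntegral.integral_const_mul,
    hAC.integral_deriv_eq_sub, F.S_frontier hγ.2.2.2, hγ.2.1, jacobiEnergy]
  simp
  ring

theorem calibration_nonneg_ae (hH : IsClassicalHamiltonian H) (hc : IsCompact (closure D))
    (hγ : γ ∈ curvesToBoundary D y) {k : ℝ} (hk : 0 ≤ k) :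
    0 ≤ᵐ[volume.restrict (Ioc (0 : ℝ) 1)] fun s => jacobiG H D E (γ s) (deriv γ s)
        + k * deriv (fun s => F.S (γ s)) s + k ^ 2 := by
  obtain ⟨ρ, hρ0, hρ⟩ := exists_energy_sublevel_bound (D := D) hH E hc
  rw [← restrict_Ioo_eq_restrict_Ioc]
  refine (ae_restrict_iff' measurableSet_Ioo).2 ?_
  filter_upwards [curvesToBoundary_ae_hasDerivAt hγ] with s hd hs
  exact F.calibration_nonneg hH hρ0 hρ hγ hk hs
    (hd (by rw [uIcc_of_le zero_le_one]; exact Ioo_subset_Icc_self hs))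

theorem le_jacobiEnergy (hH : IsClassicalHamiltonian H) (hD : IsPotentialWell H D E)
    (hc : IsCompact (closure D)) (hγ : γ ∈ curvesToBoundary D y) {k : ℝ} (hk : 0 ≤ k) :
    k * F.S y - k ^ 2 ≤ jacobiEnergy H D E γ := by
  obtain ⟨-, h2⟩ := F.integral_calibration hH hD hc hγ k
  have h3 := intervalIntegral.integral_nonneg_of_ae_restrict (μ := volume) zero_le_one
    (f := fun s => jacobiG H D E (γ s) (deriv γ s)
        + k * deriv (fun s => F.S (γ s)) s + k ^ 2)
    (by rw [← restrict_Ioc_eq_restrict_Icc]; exact F.calibration_nonneg_ae hH hc hγ hk)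
  rw [h2] at h3
  linarith

theorem ae_hasDerivAt_of_jacobiEnergy_le (hH : IsClassicalHamiltonian H)
    (hD : IsPotentialWell H D E) (hc : IsCompact (closure D)) (hγ : γ ∈ curvesToBoundary D y)
    {k : ℝ} (hk : 0 < k) (hJ : jacobiEnergy H D E γ ≤ k * F.S y - k ^ 2) :
    ∀ᵐ s, s ∈ uIcc (0 : ℝ) 1 → s ∈ Ioo (0 : ℝ) 1 ∧
      HasDerivAt (fun s => F.S (γ s)) (-(2 * k)) s ∧ ∃ lam : ℝ,
        HasDerivAt γ (-(lam • gradP H (γ s, F.P (γ s)))) s := by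
  obtain ⟨ρ, hρ0, hρ⟩ := exists_energy_sublevel_bound (D := D) hH E hc
  obtain ⟨h1, h2⟩ := F.integral_calibration hH hD hc hγ k
  have h3 := F.calibration_nonneg_ae hH hc hγ hk.le
  have h4 := le_antisymm (hJ) (F.le_jacobiEnergy hH hD hc hγ hk.le)
  rw [h4, intervalIntegral.integral_of_le zero_le_one] at h2
  have h5 := (integral_eq_zero_iff_of_nonneg_ae h3 h1.1).1 (by rw [h2]; ring)
  rw [← restrict_Ioo_eq_restrict_Ioc] at h5
  have h6 := (ae_restrict_iff' measurableSet_Ioo).1 h5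
  have hne : ∀ a : ℝ, ∀ᵐ s : ℝ, s ≠ a := fun a => by
    rw [ae_iff]; simp
  filter_upwards [h6, curvesToBoundary_ae_hasDerivAt hγ, hne 0, hne 1] with s hs hd hs0 hs1 hsI
  have hsI' := hsI
  rw [uIcc_of_le zero_le_one] at hsI'
  have hs' : s ∈ Ioo (0 : ℝ) 1 := ⟨lt_of_le_of_ne hsI'.1 (Ne.symm hs0), lt_of_le_of_ne hsI'.2 hs1⟩
  exact ⟨hs', F.hasDerivAt_of_calibration_eq hH hρ0 hρ hγ hk hs' (hd hsI) (hs hs')⟩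

/-- Strictness leaves room to vary the time in both directions inside `[0, τ]`. -/
theorem coords_snd_lt {x : Conf n} (hx : x ∈ closure D) (h : F.S x < F.w) :
    (F.coords x).2 < F.τ := by
  obtain ⟨-, h2, h3, h4, -⟩ := F.of_S_lt hx h
  have hK := F.K_pos
  have h5 := F.a_ge h3 h4
  rw [← h2] at h5
  rw [w] at h
  have h6 : (F.coords x).2 ^ 3 < (Real.sqrt F.δ / F.K) ^ 3 :=
    lt_of_mul_lt_mul_left (h5.trans_lt h) (by have := F.κ_pos; positivity)
  refine (lt_of_pow_lt_pow_left₀ 3 (by positivity) h6).trans_le ?_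
  rw [div_le_iff₀ hK]
  refine Real.sqrt_le_iff.2 ⟨mul_nonneg F.τ_pos.le hK.le, ?_⟩
  have h7 := F.δ_mul_K_le
  have h8 : 16 * 1 * F.δ ≤ 16 * F.K * F.δ := by
    have := F.one_le_K; have := F.δ_pos; gcongr
  have h9 : F.κ * F.τ ^ 2 ≤ 1 / 8 * F.τ ^ 2 :=
    mul_le_mul_of_nonneg_right F.κ_le_eighth (sq_nonneg _)
  have h10 : F.τ ^ 2 * 1 ≤ F.τ ^ 2 * F.K ^ 2 :=
    mul_le_mul_of_nonneg_left (one_le_pow₀ F.one_le_K) (sq_nonneg _)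
  nlinarith [sq_nonneg F.τ]

/-- A curve whose velocity is parallel to the trajectories has a stationary starting point. -/
theorem hasDerivAt_coords_zero (hγD : ∀ s ∈ Ico (0 : ℝ) 1, γ s ∈ D)
    (hS : ∀ s ∈ Icc (0 : ℝ) 1, F.S (γ s) < F.w) {s lam : ℝ} (hs : s ∈ Ioo (0 : ℝ) 1)
    (hd : HasDerivAt γ (-(lam • gradP H (γ s, F.P (γ s)))) s) :
    HasDerivAt (fun s => (F.coords (γ s)).1) 0 s := by
  have hsD := hγD s ⟨hs.1.le, hs.2⟩
  have hsS := hS s ⟨hs.1.le, hs.2.le⟩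
  obtain ⟨-, -, h1, h2, h3⟩ := F.of_S_lt (subset_closure hsD) hsS
  have hT0 := F.coords_snd_pos hsD hsS
  have hTτ := F.coords_snd_lt (subset_closure hsD) hsS
  set Q := (F.coords (γ s)).1 with hQ
  set T := (F.coords (γ s)).2 with hT
  have h4 : gradP H (γ s, F.P (γ s)) = F.dq Q T := by
    rw [F.dq_eq (F.infDist_frontier_le h1) h2, h3, P]
  rw [h4] at hd
  have hlin : HasDerivAt (fun x : ℝ => T - lam * (x - s)) (-lam) s := by
    simpa using (((hasDerivAt_id s).sub_const s).const_mul lam).const_sub T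
  -- This comparison curve has a constant starting point and agrees with `γ` to first order at `s`.
  -- By `inverse_lipschitz` the starting point of `γ` then changes only by `o(x - s)`.
  have hη : HasDerivAt (fun x : ℝ => F.q Q (T - lam * (x - s))) (-lam • F.dq Q T) s := by
    refine HasDerivAt.scomp_of_eq s (F.hasDerivAt_q Q (F.mem_Ioo h2)) hlin (by simp)
  rw [neg_smul] at hη
  have hdiff := hd.sub hη
  rw [sub_self, hasDerivAt_iff_isLittleO] at hdiff
  rw [hasDerivAt_iff_isLittleO]
  simp only [smul_zero, sub_zero] at hdiff ⊢
  refine Asymptotics.IsBigO.trans_isLittleO ?_ hdiff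
  refine Asymptotics.IsBigO.of_bound F.A ?_
  have hev : ∀ᶠ x in 𝓝 s, T - lam * (x - s) ∈ Ioo 0 F.τ :=
    hlin.continuousAt.eventually_mem (isOpen_Ioo.mem_nhds (by simpa using ⟨hT0, hTτ⟩))
  filter_upwards [hev, isOpen_Ioo.mem_nhds hs] with x hx hxs
  have hxD := hγD x ⟨hxs.1.le, hxs.2⟩
  obtain ⟨-, -, h5, h6, h7⟩ := F.of_S_lt (subset_closure hxD) (hS x ⟨hxs.1.le, hxs.2.le⟩)
  have := (F.inverse_lipschitz h5 h1 h6 ⟨hx.1.le, hx.2.le⟩).1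
  rw [h7] at this
  have hz : γ s - F.q Q (T - lam * (s - s)) = 0 := by rw [sub_self, mul_zero, sub_zero, h3, sub_self]
  simpa only [Pi.sub_apply, hz, sub_zero] using this

/-- Curves of minimal energy follow the trajectory from the boundary, with `S` decreasing at
constant speed. -/
theorem rigidity (hH : IsClassicalHamiltonian H) (hD : IsPotentialWell H D E)
    (hc : IsCompact (closure D)) (hy : y ∈ D) (hyS : F.S y < F.w) (hγ : γ ∈ curvesToBoundary D y)
    (hJ : jacobiEnergy H D E γ ≤ F.S y ^ 2 / 4) {s : ℝ} (hs : s ∈ Icc (0 : ℝ) 1) :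
    ∃ T ∈ Icc 0 F.τ, F.a (F.coords y).1 T = F.S y * (1 - s) ∧ γ s = F.q (F.coords y).1 T := by
  have hS0 := F.S_pos hy
  have hae := F.ae_hasDerivAt_of_jacobiEnergy_le hH hD hc hγ (k := F.S y / 2) (by linarith)
    (by linarith)
  have h01 : uIcc (0 : ℝ) 1 = Icc 0 1 := uIcc_of_le zero_le_one
  have hclos : ∀ s ∈ Icc (0 : ℝ) 1, γ s ∈ closure D := fun s hs => hγ.1.mapsTo hs
  have hlinAC : AbsolutelyContinuousOnInterval (fun s : ℝ => F.S y * s) 0 1 :=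
    ((contDiff_const.mul contDiff_id).contDiffOn (n := 1)).absolutelyContinuousOnInterval
  -- With `k = S(y)/2` the slope of `S ∘ γ` is `-S(y)` almost everywhere, and absolute continuity
  -- makes `S ∘ γ` affine.
  have hSγ : ∀ s ∈ Icc (0 : ℝ) 1, F.S (γ s) = F.S y * (1 - s) := by
    obtain ⟨C, hC⟩ := ((F.absCont_S hγ).add hlinAC).const_of_ae_hasDerivAt_zero (by
      filter_upwards [hae] with s hs hsI
      have h1 := (hs hsI).2.1.add (hasDerivAt_const_mul_id (F.S y) s)
      convert h1 using 1
      ring)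
    intro s hs
    have h1 := hC s (h01 ▸ hs)
    have h2 := hC 0 (h01 ▸ left_mem_Icc.2 zero_le_one)
    simp only [Pi.add_apply, hγ.2.1, mul_zero, add_zero] at h1 h2
    rw [← h2] at h1
    linarith
  have hlt : ∀ s ∈ Icc (0 : ℝ) 1, F.S (γ s) < F.w := fun s hs => by
    rw [hSγ s hs]
    have := mul_nonneg hS0.le hs.1
    linarith
  have hQ : ∀ s ∈ Icc (0 : ℝ) 1, (F.coords (γ s)).1 = (F.coords y).1 := by
    have hLip : LipschitzOnWith F.A.toNNReal (fun x => (F.coords x).1)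
        {x | x ∈ closure D ∧ F.S x < F.w} :=
      LipschitzOnWith.of_dist_le_mul fun x hx z hz => by
        rw [Real.coe_toNNReal _ F.A_pos.le, dist_eq_norm, dist_eq_norm]
        exact F.lipschitz_coords hx.1 hx.2 hz.1 hz.2
    obtain ⟨C, hC⟩ := (hLip.comp_absolutelyContinuousOnInterval hγ.1.absCont
      (fun s hs => ⟨hclos s (h01 ▸ hs), hlt s (h01 ▸ hs)⟩)).const_of_ae_hasDerivAt_zero (by
        filter_upwards [hae] with s hs hsI
        obtain ⟨h1, -, lam, h2⟩ := hs hsI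
        exact F.hasDerivAt_coords_zero hγ.2.2.1 hlt h1 h2)
    intro s hs
    have h1 := hC s (h01 ▸ hs)
    have h2 := hC 0 (h01 ▸ left_mem_Icc.2 zero_le_one)
    rw [hγ.2.1] at h2
    rw [h1, h2]
  obtain ⟨-, h1, h2, h3, h4⟩ := F.of_S_lt (hclos s hs) (hlt s hs)
  refine ⟨(F.coords (γ s)).2, h3, ?_, ?_⟩
  · rw [← hQ s hs, ← h1, hSγ s hs]
  · rw [← hQ s hs, h4]

end CollarFrame

/-! ### Construction of a curve attaining the bound. -/

/-- A continuous monotone function on `[a,b]` that is differentiable in the interior is absolutely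
continuous. -/
theorem MonotoneOn.absolutelyContinuousOnInterval_of_hasDerivAt {f f' : ℝ → ℝ} {a b : ℝ}
    (hab : a ≤ b) (hf : MonotoneOn f (Icc a b)) (hc : ContinuousOn f (Icc a b))
    (hd : ∀ x ∈ Ioo a b, HasDerivAt f (f' x) x) :
    IntervalIntegrable f' volume a b ∧ AbsolutelyContinuousOnInterval f a b := by
  have hint : IntervalIntegrable f' volume a b := by
    have h := hf
    rw [← uIcc_of_le hab] at h
    have h1 := h.intervalIntegrable_deriv
    rw [intervalIntegrable_iff_integrableOn_Ioo_of_le hab] at h1 ⊢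
    exact h1.congr_fun (fun x hx => (hd x hx).deriv) measurableSet_Ioo
  refine ⟨hint, ?_⟩
  refine (hint.absolutelyContinuousOnInterval_intervalIntegral left_mem_uIcc).of_dist_le
    zero_le_one fun x hx y hy => ?_
  have key : ∀ z ∈ uIcc a b, ∫ v in a..z, f' v = f z - f a := fun z hz => by
    rw [uIcc_of_le hab] at hz
    refine intervalIntegral.integral_eq_sub_of_hasDerivAt_of_le hz.1
      (hc.mono (Icc_subset_Icc_right hz.2)) (fun v hv => hd v ⟨hv.1, hv.2.trans_le hz.2⟩) ?_
    refine hint.mono_set ?_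
    rw [uIcc_of_le hab, uIcc_of_le hz.1]
    exact Icc_subset_Icc_right hz.2
  simp only [key x hx, key y hy]
  rw [one_mul, Real.dist_eq, Real.dist_eq, sub_sub_sub_cancel_right]

namespace CollarFrame

variable {n : ℕ} {H : Conf n × Conf n → ℝ} {D : Set (Conf n)} {E : ℝ} (F : CollarFrame H D E)
  {y : Conf n}

/-- The parametrisation of a trajectory, from time `T` down to time `0`, in which the action `a`
decreases at constant speed. -/
theorem exists_action_parametrization {Q : Conf n} (hQ : Q ∈ frontier D) {T : ℝ} (hT0 : 0 < T)
    (hT : T ≤ F.τ) : ∃ θ : ℝ → ℝ, θ 0 = T ∧ θ 1 = 0 ∧ AntitoneOn θ (Icc 0 1) ∧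
      ContinuousOn θ (Icc 0 1) ∧ (∀ s ∈ Icc (0 : ℝ) 1, θ s ∈ Icc 0 T) ∧
      (∀ s ∈ Ico (0 : ℝ) 1, 0 < θ s) ∧
      ∀ s ∈ Ioo (0 : ℝ) 1, HasDerivAt θ
        (-(F.a Q T / inner ℝ (F.p Q (θ s)) (F.dq Q (θ s)))) s := by
  have hτ : ∀ t ∈ Icc 0 T, t ∈ Icc 0 F.τ := fun t ht => ⟨ht.1, ht.2.trans hT⟩
  have hκ := F.κ_pos
  have hmono := F.a_strictMonoOn hQ
  have hT' : T ∈ Icc 0 F.τ := ⟨hT0.le, hT⟩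
  have h0' : (0 : ℝ) ∈ Icc 0 F.τ := ⟨le_rfl, F.τ_pos.le⟩
  have hc0 : 0 < F.a Q T := by
    have := hmono h0' hT' hT0
    rwa [F.a_zero] at this
  set c := F.a Q T with hc
  have hcont : ContinuousOn (F.a Q) (Icc 0 T) := fun t ht =>
    (F.hasDerivAt_a Q (hτ t ht)).continuousAt.continuousWithinAt
  have hex : ∀ s ∈ Icc (0 : ℝ) 1, ∃ t ∈ Icc 0 T, F.a Q t = c * (1 - s) := fun s hs => by
    refine intermediate_value_Icc hT0.le hcont ?_
    rw [F.a_zero]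
    exact ⟨mul_nonneg hc0.le (by linarith [hs.2]), by nlinarith [hs.1]⟩
  choose! θ hθ hθa using hex
  have hθ' : ∀ s ∈ Icc (0 : ℝ) 1, θ s ∈ Icc 0 F.τ := fun s hs => hτ _ (hθ s hs)
  have h0 : (0 : ℝ) ∈ Icc (0 : ℝ) 1 := ⟨le_rfl, zero_le_one⟩
  have h1 : (1 : ℝ) ∈ Icc (0 : ℝ) 1 := ⟨zero_le_one, le_rfl⟩
  have hanti : AntitoneOn θ (Icc 0 1) := fun s hs t ht hst => by
    rw [← hmono.le_iff_le (hθ' t ht) (hθ' s hs), hθa s hs, hθa t ht]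
    gcongr
  -- The action grows like the cube of the time, so `θ` is Hölder of exponent `1/3` and its
  -- derivative may blow up at `s = 1`.
  have hcube : ∀ s ∈ Icc (0 : ℝ) 1, ∀ t ∈ Icc (0 : ℝ) 1, s ≤ t →
      2 * F.κ / 3 * (θ s - θ t) ^ 3 ≤ c * (t - s) := fun s hs t ht hst => by
    have h2 := F.a_sub_ge hQ (hθ t ht).1 (hanti hs ht hst) (hθ' s hs).2
    rw [hθa s hs, hθa t ht] at h2
    have h3 : (θ s - θ t) ^ 3 ≤ θ s ^ 3 - θ t ^ 3 := by
      have h4 := mul_nonneg (mul_nonneg (hθ t ht).1 (hθ s hs).1) (sub_nonneg.2 (hanti hs ht hst))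
      nlinarith
    have h5 := mul_le_mul_of_nonneg_left h3 (by positivity : 0 ≤ 2 * F.κ / 3)
    linarith
  have hθc : ContinuousOn θ (Icc 0 1) := by
    rw [Metric.continuousOn_iff]
    intro s hs ε hε
    refine ⟨2 * F.κ / 3 * ε ^ 3 / c, by positivity, fun t ht hst => ?_⟩
    rw [lt_div_iff₀ hc0] at hst
    rw [Real.dist_eq] at hst ⊢
    have h2 : 2 * F.κ / 3 * |θ t - θ s| ^ 3 ≤ |t - s| * c := by
      rcases le_total s t with h | h
      · rw [abs_of_nonneg (sub_nonneg.2 h), abs_sub_comm,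
          abs_of_nonneg (sub_nonneg.2 (hanti hs ht h)), mul_comm _ c]
        exact hcube s hs t ht h
      · rw [abs_sub_comm t, abs_of_nonneg (sub_nonneg.2 h),
          abs_of_nonneg (sub_nonneg.2 (hanti ht hs h)), mul_comm _ c]
        exact hcube t ht s hs h
    exact lt_of_pow_lt_pow_left₀ 3 hε.le
      (lt_of_mul_lt_mul_left (h2.trans_lt hst) (by positivity))
  have hpos : ∀ s ∈ Ico (0 : ℝ) 1, 0 < θ s := fun s hs => by
    have hs' : s ∈ Icc (0 : ℝ) 1 := ⟨hs.1, hs.2.le⟩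
    rw [← hmono.lt_iff_lt h0' (hθ' s hs'), hθa s hs', F.a_zero]
    exact mul_pos hc0 (by linarith [hs.2])
  refine ⟨θ, ?_, ?_, hanti, hθc, hθ, hpos, fun s hs => ?_⟩
  · exact hmono.injOn (hθ' 0 h0) hT' (by rw [hθa 0 h0, sub_zero, mul_one])
  · exact hmono.injOn (hθ' 1 h1) h0' (by rw [hθa 1 h1, sub_self, mul_zero, F.a_zero])
  · have hs' : s ∈ Icc (0 : ℝ) 1 := ⟨hs.1.le, hs.2.le⟩
    have h2 := F.inner_p_dq_ge (F.infDist_frontier_le hQ) (hθ' s hs')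
    have h3 : 0 < inner ℝ (F.p Q (θ s)) (F.dq Q (θ s)) := by
      have := hpos s ⟨hs.1.le, hs.2⟩
      exact lt_of_lt_of_le (by positivity) h2
    have h4 := ((F.hasDerivAt_a Q (hθ' s hs')).div_const c).const_sub 1
    have h5 := HasDerivAt.of_local_left_inverse (hθc.continuousAt (Icc_mem_nhds hs.1 hs.2)) h4
      (by simp [h3.ne', hc0.ne']) (by
        filter_upwards [Icc_mem_nhds hs.1 hs.2] with x hx
        rw [hθa x hx]
        field_simp
        ring)
    rwa [inv_neg, inv_div] at h5

/-- The trajectory arriving at `y`, run backwards at constant `S`-speed, has energy at most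
`S(y)² / 4`. -/
theorem exists_jacobiEnergy_le (hH : IsClassicalHamiltonian H) (hD : IsPotentialWell H D E)
    (hc : IsCompact (closure D)) (hy : y ∈ D) (hyS : F.S y < F.w) :
    ∃ γ ∈ curvesToBoundary D y, jacobiEnergy H D E γ ≤ F.S y ^ 2 / 4 := by
  obtain ⟨-, hSy, hQ, hT, hqT⟩ := F.of_S_lt (subset_closure hy) hyS
  have hT0 := F.coords_snd_pos hy hyS
  have hS0 := F.S_pos hy
  set Q := (F.coords y).1
  set T := (F.coords y).2
  obtain ⟨θ, hθ0, hθ1, hanti, hθc, hθ, hpos, hderiv⟩ := F.exists_action_parametrization hQ hT0 hT.2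
  rw [← hSy] at hderiv
  set c := F.S y
  have hκ := F.κ_pos
  have hK := F.K_pos
  have hr := F.infDist_frontier_le hQ
  have hθ' : ∀ s ∈ Icc (0 : ℝ) 1, θ s ∈ Icc 0 F.τ := fun s hs =>
    ⟨(hθ s hs).1, (hθ s hs).2.trans hT.2⟩
  have hIoo : ∀ s ∈ Ioo (0 : ℝ) 1, s ∈ Icc (0 : ℝ) 1 := fun s hs => ⟨hs.1.le, hs.2.le⟩
  have hmemD : ∀ s ∈ Ico (0 : ℝ) 1, F.q Q (θ s) ∈ D := fun s hs => by
    have hs' : s ∈ Icc (0 : ℝ) 1 := ⟨hs.1, hs.2.le⟩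
    exact F.q_mem_of_le hQ (hpos s hs) (hθ s hs').2 hT.2 (hqT ▸ hy)
  have hend : F.q Q (θ 1) = Q := by rw [hθ1, F.q_zero]
  have hγd : ∀ s ∈ Ioo (0 : ℝ) 1, HasDerivAt (fun s => F.q Q (θ s))
      (-(c / inner ℝ (F.p Q (θ s)) (F.dq Q (θ s))) • F.dq Q (θ s)) s := fun s hs =>
    HasDerivAt.scomp s (F.hasDerivAt_q Q (F.mem_Ioo (hθ' s (hIoo s hs)))) (hderiv s hs)
  obtain ⟨hint, hAC⟩ := MonotoneOn.absolutelyContinuousOnInterval_of_hasDerivAt zero_le_one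
    hanti.neg hθc.neg (fun s hs => (hderiv s hs).neg)
  simp only [neg_neg] at hint
  have hW : IsW12 (closure D) (fun s => F.q Q (θ s)) := by
    refine ⟨fun s hs => ?_, ?_, ?_⟩
    · rcases hs.2.eq_or_lt with rfl | h
      · simp only [hend]
        exact frontier_subset_closure hQ
      · exact subset_closure (hmemD s ⟨hs.1, h⟩)
    · refine hAC.of_dist_le (C := F.K ^ 2) (by positivity) fun s hs t ht => ?_
      rw [uIcc_of_le zero_le_one] at hs ht
      have h1 := (convex_Icc 0 F.τ).norm_image_sub_le_of_norm_hasDerivWithin_le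
        (f := F.q Q) (f' := F.dq Q) (C := F.K ^ 2)
        (fun x hx => (F.hasDerivAt_q Q (F.mem_Ioo hx)).hasDerivWithinAt)
        (fun x hx => (F.norm_dq_le Q hx).trans
          (mul_le_of_le_one_right (by positivity) (F.mem_Ioo hx).2.le)) (hθ' t ht) (hθ' s hs)
      simpa only [dist_eq_norm, Pi.neg_apply, neg_sub_neg, norm_sub_rev (θ t)] using h1
    · rw [memLp_two_iff_integrable_sq_norm (measurable_deriv _).aestronglyMeasurable]
      rw [intervalIntegrable_iff_integrableOn_Ioo_of_le zero_le_one] at hint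
      -- The squared speed is `(c/I)²‖q'‖²` with `‖q'‖² ≤ K⁴θ²` and `I ≥ 2κθ²`; one factor `1/I`
      -- cancels `θ²`, leaving a multiple of `-θ' = c/I`, which is integrable.
      refine Integrable.mono' (hint.const_mul (F.K ^ 4 * c / (2 * F.κ)))
        ((measurable_deriv _).norm.pow_const 2).aestronglyMeasurable ?_
      filter_upwards [ae_restrict_mem measurableSet_Ioo] with s hs
      rw [(hγd s hs).deriv, norm_smul, norm_neg]
      have ht := hpos s ⟨hs.1.le, hs.2⟩
      have h1 := F.inner_p_dq_ge hr (hθ' s (hIoo s hs))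
      have h2 := F.norm_dq_le Q (hθ' s (hIoo s hs))
      have h3 : 0 < 2 * F.κ * θ s ^ 2 := by positivity
      set I := inner ℝ (F.p Q (θ s)) (F.dq Q (θ s))
      have hI : 0 < I := h3.trans_le h1
      rw [Real.norm_of_nonneg (by positivity), Real.norm_of_nonneg (by positivity)]
      calc (c / I * ‖F.dq Q (θ s)‖) ^ 2 ≤ (c / I * (F.K ^ 2 * θ s)) ^ 2 := by gcongr
        _ = F.K ^ 4 * θ s ^ 2 * c / I * (c / I) := by field_simp
        _ ≤ F.K ^ 4 * θ s ^ 2 * c / (2 * F.κ * θ s ^ 2) * (c / I) := by gcongr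
        _ = F.K ^ 4 * c / (2 * F.κ) * (c / I) := by field_simp
  have hX : (fun s => F.q Q (θ s)) ∈ curvesToBoundary D y := by
    refine ⟨hW, ?_, hmemD, ?_⟩
    · simp only [hθ0, hqT]
    · simpa only [hend] using hQ
  refine ⟨_, hX, ?_⟩
  have hle : jacobiEnergy H D E (fun s => F.q Q (θ s)) ≤ ∫ _ in (0 : ℝ)..1, (c / 2) ^ 2 := by
    refine intervalIntegral.integral_mono_on_of_le_Ioo zero_le_one
      (intervalIntegrable_jacobiG hH hD hc hX) intervalIntegrable_const fun s hs => ?_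
    have hsD := hmemD s ⟨hs.1.le, hs.2⟩
    have h1 : H (F.q Q (θ s), F.p Q (θ s)) = E := by
      rw [F.energy_eq hr (hθ' s (hIoo s hs))]
      exact hD.eq_of_mem_frontier Q hQ
    -- The reparametrised velocity is exactly the vector of `jacobiG_le_sq` for `k = c/2`, so `G` is
    -- at most `(c/2)²` at each time.
    have h2 := jacobiG_le_sq hH hsD (hD.lt_of_mem _ hsD) h1 (k := c / 2) (by positivity)
    rw [(hγd s hs).deriv, neg_smul]
    rw [← F.dq_eq hr (hθ' s (hIoo s hs)), mul_div_cancel₀ c two_ne_zero] at h2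
    exact h2
  refine hle.trans_eq ?_
  rw [intervalIntegral.integral_const, sub_zero, one_smul]
  ring

end CollarFrame

end

/-! ### Conclusion. -/

theorem mainTheorem4 {n : ℕ} (hn : 0 < n) (H : Conf n × Conf n → ℝ)
    (hH : IsClassicalHamiltonian H) (D : Set (Conf n)) (E : ℝ) (hD : IsPotentialWell H D E)
    (hcompact : IsCompact (closure D)) :
    ∃ δ : ℝ, 0 < δ ∧ CollarProperty H D E δ ∧
      ∀ y ∈ D, Metric.infDist y (frontier D) ≤ δ →
        ∃ γ ∈ curvesToBoundary D y,
          IsMinOn (jacobiEnergy H D E) (curvesToBoundary D y) γ ∧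
          ∀ γ' ∈ curvesToBoundary D y,
            IsMinOn (jacobiEnergy H D E) (curvesToBoundary D y) γ' → EqOn γ' γ (Icc 0 1) := by
  rcases D.eq_empty_or_nonempty with rfl | hne
  · exact ⟨1, one_pos, fun y hy => hy.elim, fun y hy => hy.elim⟩
  obtain ⟨F⟩ := exists_collarFrame hn hH hD hcompact hne
  -- The collar property holds for every width up to `F.δ`; the smaller `F.δ'` also ensures `S(y) <
  -- w`.
  refine ⟨F.δ', F.δ'_pos, F.collarProperty F.δ'_le, fun y hy hyd => ?_⟩
  have hyS := F.S_lt hy hyd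
  obtain ⟨γ, hγ, hJ⟩ := F.exists_jacobiEnergy_le hH hD hcompact hy hyS
  refine ⟨γ, hγ, fun γ' hγ' => ?_, fun γ' hγ' hmin s hs => ?_⟩
  · have h := F.le_jacobiEnergy hH hD hcompact hγ' (k := F.S y / 2) (by linarith [F.S_pos hy])
    refine hJ.trans (le_trans (le_of_eq ?_) h)
    ring
  · obtain ⟨T, hT, hTa, hTq⟩ := F.rigidity hH hD hcompact hy hyS hγ hJ hs
    obtain ⟨T', hT', hTa', hTq'⟩ := F.rigidity hH hD hcompact hy hyS hγ' ((hmin hγ).trans hJ) hs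
    obtain ⟨-, -, hQ, -, -⟩ := F.of_S_lt (subset_closure hy) hyS
    -- At each `s` both curves lie on the trajectory from the same `Q` and have the same action,
    -- which determines the time.
    rw [hTq, hTq', (F.a_strictMonoOn hQ).injOn hT hT' (hTa.trans hTa'.symm)]
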